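/- For complex variables $s_j=\sigma_j+it_j$ ($j=1,2,3$) let $\zeta_{MT,2}(s_1,s_2,s_3)$ be the Mordell–Tornheim double zeta-function, i.e. the meromorphic continuation to $\mathbb{C}^3$ of $$\sum_{m=1}^\infty\sum_{n=1}^\infty \frac{1}{m^{s_1}n^{s_2}(m+n)^{s_3}},$$ which converges absolutely for $\sigma_1+\sigma_3>1$, $\sigma_2+\sigma_3>1$, $\sigma_1+\sigma_2+\sigma_3>2$, and let $$\zeta_{MT,2}^{[2]}(s_1,s_2,s_3)=\sum_{k=2}^\infty\Bigl|\sum_{m=1}^{k-1}\frac{1}{m^{s_1}(k-m)^{s_2}}\Bigr|^2\frac{1}{k^{s_3}}.$$ **Theorem 1.4.** Fix $s_1=\sigma_1+it_1$, $s_2=\sigma_2+it_2\in\mathbb{C}$ and $\sigma_3\in\mathbb{R}$ with $\sigma_1,\sigma_2\ge 0$, $\sigma_3>0$, $t_1,t_2\ge 0$, $\sigma_1+\sigma_3\le 1$, $\sigma_2+\sigma_3\le 1$ and $\sigma_1+\sigma_2+\sigma_3>3/2$, and put $s_3=\sigma_3+it_3$. Suppose that for $t_3\ge 2$ the point $(s_1,s_2,s_3)$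 does not meet the hyperplanes $s_1+s_3=1$, $s_2+s_3=1$, $s_1+s_2+s_3=2$. Then the series $\zeta_{MT,2}^{[2]}(s_1,s_2,2\sigma_3)$ converges, $|\zeta_{MT,2}(s_1,s_2,\sigma_3+it_3)|^2$ is integrable over $2\le t_3\le T$ for every $T\ge 2$, and, as $T\to\infty$, $$\int_2^T|\zeta_{MT,2}(s_1,s_2,\sigma_3+it_3)|^2\,dt_3=\zeta_{MT,2}^{[2]}(s_1,s_2,2\sigma_3)\,T+\begin{cases}O\bigl(T^{5/2-\sigma_1-\sigma_2-\sigma_3}\bigr)&(3/2<\sigma_1+\sigma_2+\sigma_3<2),\\ O\bigl((T\log T)^{1/2}\bigr)&(\sigma_1+\sigma_2+\sigma_3=2),\end{cases}$$ where the implicit constants depend only on $s_1$, $s_2$ and $\sigma_3$. (The hypotheses force $\sigma_1+\sigma_2+\sigma_3\le 2-\sigma_3<2$, so the second case is listed only for completeness.) -/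

import Mathlib

open Complex Filter Asymptotics MeasureTheory

noncomputable section

/-- The Mordell-Tornheim double series
`∑_{m ≥ 1} ∑_{n ≥ 1} m ^ (-s₁) * n ^ (-s₂) * (m + n) ^ (-s₃)`, at `s = (s₁, s₂, s₃)`.
The summation index `(i, j)` stands for `m = i + 1`, `n = j + 1`. -/
def mtSeries (s : ℂ × ℂ × ℂ) : ℂ :=
  ∑' p : ℕ × ℕ,
    1 / (((p.1 + 1 : ℕ) : ℂ) ^ s.1 * ((p.2 + 1 : ℕ) : ℂ) ^ s.2.1 *
      (((p.1 + 1) + (p.2 + 1) : ℕ) : ℂ) ^ s.2.2)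

/-- The convex open tube `σ₁ + σ₃ > 1 - N`, `σ₂ + σ₃ > 1 - N`, `σ₁ + σ₂ + σ₃ > 2 - N` in `ℂ³`.
For `N = 0` it is the region of absolute convergence of the Mordell-Tornheim series, and these
tubes increase to `ℂ³` as `N` grows. -/
def mtTube (N : ℕ) : Set (ℂ × ℂ × ℂ) :=
  {s | 1 - (N : ℝ) < s.1.re + s.2.2.re ∧ 1 - (N : ℝ) < s.2.1.re + s.2.2.re ∧
    2 - (N : ℝ) < s.1.re + s.2.1.re + s.2.2.re}

/-- The polynomial whose zeros are the singular hyperplanes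
`s₁ + s₂ + s₃ = 2`, `s₁ + s₃ = 1 - l` and `s₂ + s₃ = 1 - l` with `0 ≤ l < N`;
these are all the singular hyperplanes of the Mordell-Tornheim double zeta-function that
meet `mtTube N`. -/
def mtPolar (N : ℕ) (s : ℂ × ℂ × ℂ) : ℂ :=
  (s.1 + s.2.1 + s.2.2 - 2) *
    ∏ l ∈ Finset.range N, ((s.1 + s.2.2 - 1 + l) * (s.2.1 + s.2.2 - 1 + l))

/-- `G / mtPolar N` is the meromorphic continuation of the Mordell-Tornheim series to the
tube `mtTube N`: the numerator `G` is holomorphic (in the three variables jointly) on the tube,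
and the quotient agrees with the series in its region of absolute convergence. -/
def IsMTContinuation (N : ℕ) (G : ℂ × ℂ × ℂ → ℂ) : Prop :=
  DifferentiableOn ℂ G (mtTube N) ∧ ∀ s ∈ mtTube 0, G s = mtPolar N s * mtSeries s

open Classical in
/-- The value at `s` of the meromorphic continuation to `ℂ³` of the Mordell-Tornheim double
series. By `mtZetaAt_eq` below it does not depend on the choices made here.
(On the singular hyperplanes, where the function has no value, this gives `0`.) -/
def mtZetaAt (s : ℂ × ℂ × ℂ) : ℂ :=
  if h : ∃ p : ℕ × (ℂ × ℂ × ℂ → ℂ), s ∈ mtTube p.1 ∧ IsMTContinuation p.1 p.2 then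
    h.choose.2 s / mtPolar h.choose.1 s
  else 0

/-- The Mordell-Tornheim double zeta-function `ζ_{MT,2}(s₁, s₂, s₃)`, meromorphically
continued to `ℂ³`. -/
def mtZeta (s₁ s₂ s₃ : ℂ) : ℂ := mtZetaAt (s₁, s₂, s₃)

/-- The `k`-th term of the series `ζ^{[2]}_{MT,2}(s₁, s₂, s₃)`. -/
def mtSquareTerm (s₁ s₂ s₃ : ℂ) (k : ℕ) : ℂ :=
  ((‖∑ m ∈ Finset.Icc 1 (k - 1), 1 / ((m : ℂ) ^ s₁ * ((k - m : ℕ) : ℂ) ^ s₂)‖ ^ 2 : ℝ) : ℂ) /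
    (k : ℂ) ^ s₃

/-- `ζ^{[2]}_{MT,2}(s₁, s₂, s₃)
  = ∑_{k ≥ 2} |∑_{m=1}^{k-1} m ^ (-s₁) * (k - m) ^ (-s₂)| ^ 2 * k ^ (-s₃)`. -/
def mtSquareZeta (s₁ s₂ s₃ : ℂ) : ℂ := ∑' k : ℕ, mtSquareTerm s₁ s₂ s₃ (k + 2)

theorem mtTube_mono {M N : ℕ} (h : M ≤ N) : mtTube M ⊆ mtTube N := by
  intro s hs
  have h' : (M : ℝ) ≤ N := by exact_mod_cast h
  simp only [mtTube, Set.mem_ofPred_eq] at hs ⊢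
  refine ⟨?_, ?_, ?_⟩ <;> linarith [hs.1, hs.2.1, hs.2.2]

/-- On `mtTube M` the polynomials `mtPolar M` and `mtPolar N`, `M ≤ N`, have the same zeros. -/
theorem mtPolar_eq_zero_iff {M N : ℕ} (h : M ≤ N) {s : ℂ × ℂ × ℂ} (hs : s ∈ mtTube M) :
    mtPolar N s = 0 ↔ mtPolar M s = 0 := by
  simp only [mtPolar, mul_eq_zero, Finset.prod_eq_zero_iff, Finset.mem_range]
  constructor
  · rintro (h0 | ⟨l, hl, h0⟩)
    · exact Or.inl h0
    · by_cases hlM : l < M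
      · exact Or.inr ⟨l, hlM, h0⟩
      · exfalso
        have hl' : (M : ℝ) ≤ l := by exact_mod_cast not_lt.mp hlM
        obtain ⟨h1, h2, -⟩ := hs
        rcases h0 with h0 | h0
        · have := congrArg Complex.re h0
          simp at this
          linarith
        · have := congrArg Complex.re h0
          simp at this
          linarith
  · rintro (h0 | ⟨l, hl, h0⟩)
    · exact Or.inl h0
    · exact Or.inr ⟨l, lt_of_lt_of_le hl h, h0⟩

theorem differentiable_mtPolar (N : ℕ) : Differentiable ℂ (mtPolar N) := by
  unfold mtPolar
  fun_prop

/-- Two continuations to the tubes `mtTube M ⊆ mtTube N` agree on the smaller tube. -/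
theorem IsMTContinuation.div_eq {M N : ℕ} (hMN : M ≤ N) {G H : ℂ × ℂ × ℂ → ℂ}
    (hG : IsMTContinuation M G) (hH : IsMTContinuation N H) {s : ℂ × ℂ × ℂ}
    (hs : s ∈ mtTube M) : G s / mtPolar M s = H s / mtPolar N s := by
  obtain ⟨a, b, c⟩ := s
  have key : mtPolar N (a, b, c) * G (a, b, c) - mtPolar M (a, b, c) * H (a, b, c) = 0 := by
    set r : ℕ → ℝ := fun K => max (max (1 - (K : ℝ) - a.re) (1 - (K : ℝ) - b.re))
      (2 - (K : ℝ) - a.re - b.re) with hr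
    have hmem : ∀ (K : ℕ) (z : ℂ), (a, b, z) ∈ mtTube K ↔ r K < z.re := by
      intro K z
      simp only [mtTube, Set.mem_ofPred_eq, hr, max_lt_iff]
      constructor
      · rintro ⟨h1, h2, h3⟩
        exact ⟨⟨by linarith, by linarith⟩, by linarith⟩
      · rintro ⟨⟨h1, h2⟩, h3⟩
        exact ⟨by linarith, by linarith, by linarith⟩
    have hopen : ∀ x : ℝ, IsOpen {z : ℂ | x < z.re} := fun x =>
      isOpen_lt continuous_const Complex.continuous_re
    have hd : DifferentiableOn ℂ
        (fun z : ℂ => mtPolar N (a, b, z) * G (a, b, z) - mtPolar M (a, b, z) * H (a, b, z))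
        {z : ℂ | r M < z.re} := by
      have hemb : Differentiable ℂ (fun z : ℂ => ((a, b, z) : ℂ × ℂ × ℂ)) := by fun_prop
      have h1 : DifferentiableOn ℂ (fun z : ℂ => G (a, b, z)) {z : ℂ | r M < z.re} :=
        hG.1.comp hemb.differentiableOn fun z hz => (hmem M z).2 hz
      have h2 : DifferentiableOn ℂ (fun z : ℂ => H (a, b, z)) {z : ℂ | r M < z.re} :=
        hH.1.comp hemb.differentiableOn fun z hz => mtTube_mono hMN ((hmem M z).2 hz)
      have h3 : ∀ K, DifferentiableOn ℂ (fun z : ℂ => mtPolar K (a, b, z))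
          {z : ℂ | r M < z.re} := fun K =>
        ((differentiable_mtPolar K).comp hemb).differentiableOn
      exact ((h3 N).mul h1).sub ((h3 M).mul h2)
    have han := hd.analyticOnNhd (hopen _)
    have hpre : IsPreconnected {z : ℂ | r M < z.re} :=
      (convex_halfSpace_re_gt (r M)).isPreconnected
    set z₀ : ℂ := ((max (r 0) (r M) + 1 : ℝ) : ℂ) with hz₀
    have hz0 : r 0 < z₀.re := by
      rw [hz₀, Complex.ofReal_re]; linarith [le_max_left (r 0) (r M)]
    have hzM : r M < z₀.re := by
      rw [hz₀, Complex.ofReal_re]; linarith [le_max_right (r 0) (r M)]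
    have hev : (fun z : ℂ => mtPolar N (a, b, z) * G (a, b, z)
        - mtPolar M (a, b, z) * H (a, b, z)) =ᶠ[nhds z₀] 0 := by
      filter_upwards [(hopen (r 0)).mem_nhds hz0] with z hz
      have hz' := (hmem 0 z).2 hz
      simp only [hG.2 _ hz', hH.2 _ hz', Pi.zero_apply]
      ring
    exact han.eqOn_zero_of_preconnected_of_eventuallyEq_zero hpre hzM hev ((hmem M c).1 hs)
  by_cases h0 : mtPolar M (a, b, c) = 0
  · simp [h0, (mtPolar_eq_zero_iff hMN hs).2 h0]
  · have h1 : mtPolar N (a, b, c) ≠ 0 := fun h => h0 ((mtPolar_eq_zero_iff hMN hs).1 h)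
    rw [div_eq_div_iff h0 h1]
    linear_combination key

/-- The value of the continued function can be computed from any continuation to any tube. -/
theorem mtZetaAt_eq {N : ℕ} {G : ℂ × ℂ × ℂ → ℂ} (hG : IsMTContinuation N G)
    {s : ℂ × ℂ × ℂ} (hs : s ∈ mtTube N) : mtZetaAt s = G s / mtPolar N s := by
  have h : ∃ p : ℕ × (ℂ × ℂ × ℂ → ℂ), s ∈ mtTube p.1 ∧ IsMTContinuation p.1 p.2 :=
    ⟨(N, G), hs, hG⟩
  rw [mtZetaAt, dif_pos h]
  obtain ⟨h1, h2⟩ := h.choose_spec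
  rcases le_total h.choose.1 N with hle | hle
  · exact h2.div_eq hle hG h1
  · exact (hG.div_eq hle h2 hs).symm

end

/-! Write σ = σ₁ + σ₂ + σ₃. Positivity of σ₃ forces σ₁, σ₂ < 1 and hence σ < 2. As a function of s₃
the double series is a Dirichlet series with coefficients ∑_{m+n=k} m^(-s₁) n^(-s₂) = O(k^(1-σ₁-σ₂))
(`norm_mtCoef_le`). On the line Re s₃ = σ₃ its terms have size k^(-(σ-1)) with σ - 1 > 1/2, so their
squares are summable. The proof approximates the continued function on [2, T] by the Dirichlet
polynomial of length 2M, with M comparable to T.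

Continuation. Pairs with m < n, m > n and m = n are treated separately. For m < n and m fixed,
Euler-Maclaurin summation over u = m + n ≥ 2m gives an integral and an error. By homogeneity the
integral is m^(1-s₁-s₂-s₃) times a function of (s₂, s₃), and summing over m produces ζ(s₁+s₂+s₃-1);
the errors converge absolutely on `mtTube 1`. The diagonal gives 2^(-s₃) ζ(s₁+s₂+s₃). Stopping at m
+ n ≤ 2M yields the exact formula `mtNum_div_mtPolar`: polynomial plus explicit remainders.

Remainders. The tails of the integrals and of ζ are bounded pointwise, essentially by M^(2-σ)/t +
M^(1-σ); here t₁, t₂ ≥ 0 makes every denominator at least t₃ in modulus. The Euler-Maclaurin errors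
contain a part multiplied by s₃, whose pointwise bound t M^(1-σ) would lose a factor T after
squaring and integrating. This part is s₃ times a Mellin transform ∫ h(u) u^(-it) du with h(u) =
O(u^(-σ)), up to a negligible tail. A Gaussian form of Plancherel in the variable log u
(`integral_norm_sq_mellin_le`) bounds the mean square of that transform by O(M^(2-2σ)), uniformly in
T. Altogether the remainder has mean square R = O(M^(4-2σ))
(`exists_integral_norm_sq_mtZeta_sub_le`).

Conclusion. The diagonal of the polynomial's mean square supplies the main term; the off-diagonal
part is O(T^(4-2σ) log T) (`exists_abs_integral_dirPoly_sub_le`). If P is the mean square of the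
polynomial, replacing the polynomial by the zeta-function costs at most δP + (1 + 1/δ)R for any δ >
0. The choice δ = T^(-(σ-3/2)) balances the two terms at T^(5/2-σ). -/

noncomputable section

/-! ### Holomorphic dependence of sums and integrals on parameters -/

/-- Cauchy's estimate for the Fréchet derivative. -/
theorem norm_fderiv_le_of_norm_le {E : Type*} [NormedAddCommGroup E] [NormedSpace ℂ E]
    {f : E → ℂ} {x y : E} {r C : ℝ} (hr : 0 < r)
    (hd : DifferentiableOn ℂ f (Metric.ball x (2 * r)))
    (hb : ∀ z ∈ Metric.ball x (2 * r), ‖f z‖ ≤ C) (hy : y ∈ Metric.ball x r) :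
    ‖fderiv ℂ f y‖ ≤ 2 * C / r := by
  have hsub : Metric.ball y r ⊆ Metric.ball x (2 * r) := by
    apply Metric.ball_subset_ball'
    have := Metric.mem_ball.1 hy
    linarith
  refine norm_fderiv_le_div_of_mapsTo_ball (hd.mono hsub) (fun z hz => ?_) hr
  rw [Metric.mem_closedBall, dist_eq_norm]
  have h1 := hb z (hsub hz)
  have h2 := hb y (hsub (Metric.mem_ball_self hr))
  linarith [norm_sub_le (f z) (f y)]

/-- Cauchy's estimate on the ball of half the radius turns a summable majorant of the terms into one
for their derivatives, so no derivative has to be bounded by hand. -/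
theorem differentiableAt_tsum_of_norm_le {E : Type*} [NormedAddCommGroup E] [NormedSpace ℂ E]
    {ι : Type*} {f : ι → E → ℂ} {u : ι → ℝ} {x : E} {r : ℝ} (hr : 0 < r) (hu : Summable u)
    (hd : ∀ i, DifferentiableOn ℂ (f i) (Metric.ball x r))
    (hb : ∀ i, ∀ y ∈ Metric.ball x r, ‖f i y‖ ≤ u i) :
    DifferentiableAt ℂ (fun y => ∑' i, f i y) x := by
  -- Convexity of balls, used for preconnectedness, refers to the real structure.
  let _ : NormedSpace ℝ E := NormedSpace.restrictScalars ℝ ℂ E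
  have hr2 : 0 < r / 2 := by positivity
  have h2 : 2 * (r / 2) = r := by ring
  have hsub : Metric.ball x (r / 2) ⊆ Metric.ball x r := Metric.ball_subset_ball (by linarith)
  refine (hasFDerivAt_tsum_of_isPreconnected (𝕜 := ℂ) (f' := fun i y => fderiv ℂ (f i) y)
    ((hu.mul_left 2).div_const (r / 2)) Metric.isOpen_ball
    (convex_ball x (r / 2)).isPreconnected (fun i y hy => ?_) (fun i y hy => ?_)
    (Metric.mem_ball_self hr2) ?_ (Metric.mem_ball_self hr2)).differentiableAt
  · exact ((hd i).differentiableAt (Metric.isOpen_ball.mem_nhds (hsub hy))).hasFDerivAt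
  · refine norm_fderiv_le_of_norm_le hr2 ?_ ?_ hy
    · rw [h2]; exact hd i
    · rw [h2]; exact hb i
  · exact Summable.of_norm_bounded hu fun i => hb i x (Metric.mem_ball_self hr)

/-- A functional on ℂ³ is a combination of the three coordinate functionals, with its values on the
basis vectors as coefficients. -/
theorem aestronglyMeasurable_clm_prod {α : Type*} [MeasurableSpace α] {μ : Measure α}
    {L : α → (ℂ × ℂ × ℂ →L[ℂ] ℂ)} (hL : ∀ v, AEStronglyMeasurable (fun a => L a v) μ) :
    AEStronglyMeasurable L μ := by
  have h : L = fun a =>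
      (L a (1, 0, 0)) • (ContinuousLinearMap.fst ℂ ℂ (ℂ × ℂ)) +
      ((L a (0, 1, 0)) • ((ContinuousLinearMap.fst ℂ ℂ ℂ).comp
        (ContinuousLinearMap.snd ℂ ℂ (ℂ × ℂ))) +
      (L a (0, 0, 1)) • ((ContinuousLinearMap.snd ℂ ℂ ℂ).comp
        (ContinuousLinearMap.snd ℂ ℂ (ℂ × ℂ)))) := by
    funext a
    ext <;> simp <;> rfl
  rw [h]
  exact ((hL _).smul_const _).add (((hL _).smul_const _).add ((hL _).smul_const _))

theorem differentiableAt_integral_of_norm_le {α : Type*} [MeasurableSpace α] {μ : Measure α}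
    {F : ℂ × ℂ × ℂ → α → ℂ} {g : α → ℝ} {x : ℂ × ℂ × ℂ} {r : ℝ} (hr : 0 < r)
    (hg : Integrable g μ)
    (hm : ∀ y ∈ Metric.ball x r, AEStronglyMeasurable (F y) μ)
    (hd : ∀ᵐ a ∂μ, DifferentiableOn ℂ (fun y => F y a) (Metric.ball x r))
    (hb : ∀ᵐ a ∂μ, ∀ y ∈ Metric.ball x r, ‖F y a‖ ≤ g a) :
    DifferentiableAt ℂ (fun y => ∫ a, F y a ∂μ) x := by
  have hr2 : 0 < r / 2 := by positivity
  have h2 : 2 * (r / 2) = r := by ring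
  have hsub : Metric.ball x (r / 2) ⊆ Metric.ball x r := Metric.ball_subset_ball (by linarith)
  have hx := Metric.mem_ball_self (x := x) hr
  refine (hasFDerivAt_integral_of_dominated_of_fderiv_le (𝕜 := ℂ)
    (F' := fun y a => fderiv ℂ (fun y => F y a) y) (bound := fun a => 2 * g a / (r / 2))
    (Metric.ball_mem_nhds x hr2) ?_ ?_ ?_ ?_ ((hg.const_mul 2).div_const (r / 2))
    ?_).differentiableAt
  · filter_upwards [Metric.ball_mem_nhds x hr] with y hy using hm y hy
  · refine hg.mono' (hm x hx) ?_
    filter_upwards [hb] with a ha using ha x hx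
  · refine aestronglyMeasurable_clm_prod fun v => ?_
    -- The derivative in direction v is a limit of difference quotients with step 1/(n+N+1), each
    -- measurable. The shift by N keeps the sample points in the ball where measurability is known.
    obtain ⟨N, hN⟩ : ∃ N : ℕ, ∀ n : ℕ, N ≤ n →
        x + (((n : ℂ) + 1)⁻¹ • v) ∈ Metric.ball x r := by
      have ht : Tendsto (fun n : ℕ => x + (((n : ℂ) + 1)⁻¹ • v)) atTop (nhds x) := by
        have h0 : Tendsto (fun n : ℕ => ((n : ℂ) + 1)⁻¹) atTop (nhds 0) := by
          simpa using tendsto_one_div_add_atTop_nhds_zero_nat (𝕜 := ℂ)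
        simpa using (Tendsto.smul_const h0 v).const_add x
      exact eventually_atTop.1 (ht (Metric.ball_mem_nhds x hr))
    refine aestronglyMeasurable_of_tendsto_ae atTop
      (f := fun (n : ℕ) a => (((n + N : ℕ) : ℂ) + 1) •
        (F (x + ((((n + N : ℕ) : ℂ) + 1)⁻¹ • v)) a - F x a)) (fun n => ?_) ?_
    · exact ((hm _ (hN _ (Nat.le_add_left _ _))).sub (hm x hx)).const_smul (((n + N : ℕ) : ℂ) + 1)
    · filter_upwards [hd] with a ha
      refine (ha.differentiableAt (Metric.ball_mem_nhds x hr)).hasFDerivAt.lim (𝕜 := ℂ) v ?_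
      have : (fun n : ℕ => ‖(((n + N : ℕ) : ℂ) + 1)‖) = fun n : ℕ => (((n + N : ℕ) : ℝ) + 1) := by
        funext n
        have : (((n + N : ℕ) : ℂ) + 1) = (((n + N + 1 : ℕ)) : ℂ) := by push_cast; ring
        rw [this, Complex.norm_natCast]; push_cast; ring
      rw [this]
      exact tendsto_atTop_add_const_right _ _
        (tendsto_natCast_atTop_atTop.comp (tendsto_add_atTop_nat N))
  · filter_upwards [hd, hb] with a ha hba y hy
    refine norm_fderiv_le_of_norm_le hr2 ?_ ?_ hy
    · rw [h2]; exact ha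
    · rw [h2]; exact hba
  · filter_upwards [hd] with a ha y hy
    exact (ha.differentiableAt (Metric.isOpen_ball.mem_nhds (hsub hy))).hasFDerivAt

/-! ### The kernel and its Euler-Maclaurin errors -/

/-- The summand `m ^ (-a) * n ^ (-b) * (m + n) ^ (-c)` as a function of `u = m + n`. -/
def mtKer (m : ℕ) (a b c : ℂ) (u : ℝ) : ℂ :=
  (m : ℂ) ^ (-a) * ((u - m : ℝ) : ℂ) ^ (-b) * (u : ℂ) ^ (-c)

/-- The derivative of `mtKer` in `u`. -/
def mtKerDeriv (m : ℕ) (a b c : ℂ) (u : ℝ) : ℂ :=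
  -(b * mtKer m a (b + 1) c u) - c * mtKer m a b (c + 1) u

theorem norm_mtKer {m : ℕ} (hm : 0 < m) (a b c : ℂ) {u : ℝ} (hu : (m : ℝ) < u) :
    ‖mtKer m a b c u‖ = (m : ℝ) ^ (-a.re) * (u - m) ^ (-b.re) * u ^ (-c.re) := by
  have hm' : (0 : ℝ) < m := by exact_mod_cast hm
  rw [mtKer, norm_mul, norm_mul, Complex.norm_natCast_cpow_of_pos hm,
    Complex.norm_cpow_eq_rpow_re_of_pos (sub_pos.2 hu),
    Complex.norm_cpow_eq_rpow_re_of_pos (hm'.trans hu)]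
  simp

theorem rpow_neg_le_of_half_le {u v β : ℝ} (hu : 0 < u) (h1 : u / 2 ≤ v) (h2 : v ≤ u) :
    v ^ (-β) ≤ 2 ^ |β| * u ^ (-β) := by
  have hv : 0 < v := by linarith
  rcases le_total 0 β with hβ | hβ
  · have h : v ^ (-β) ≤ (u / 2) ^ (-β) :=
      Real.rpow_le_rpow_of_nonpos (by positivity) h1 (by linarith)
    rw [Real.div_rpow hu.le (by norm_num), Real.rpow_neg (by norm_num : (0 : ℝ) ≤ 2)] at h
    rw [abs_of_nonneg hβ, mul_comm]
    simpa [div_inv_eq_mul] using h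
  · have h : v ^ (-β) ≤ u ^ (-β) := Real.rpow_le_rpow hv.le h2 (by linarith)
    have h3 : (1 : ℝ) ≤ 2 ^ |β| := Real.one_le_rpow (by norm_num) (abs_nonneg _)
    have h4 : 0 ≤ u ^ (-β) := by positivity
    nlinarith

/-- For u ≥ 2m the factor u - m is comparable to u, so b and c act through their sum only. This is
the reason for splitting the double sum at the diagonal. -/
theorem norm_mtKer_le {m : ℕ} (hm : 0 < m) (a b c : ℂ) {u : ℝ} (hu : 2 * (m : ℝ) ≤ u) :
    ‖mtKer m a b c u‖ ≤ 2 ^ |b.re| * ((m : ℝ) ^ (-a.re) * u ^ (-(b.re + c.re))) := by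
  have hm' : (0 : ℝ) < m := by exact_mod_cast hm
  have hu0 : 0 < u := by linarith
  rw [norm_mtKer hm a b c (by linarith)]
  have h := rpow_neg_le_of_half_le (β := b.re) (v := u - m) hu0 (by linarith) (by linarith)
  rw [neg_add, Real.rpow_add hu0]
  calc (m : ℝ) ^ (-a.re) * (u - m) ^ (-b.re) * u ^ (-c.re)
      ≤ (m : ℝ) ^ (-a.re) * (2 ^ |b.re| * u ^ (-b.re)) * u ^ (-c.re) := by gcongr
    _ = _ := by ring

theorem hasDerivAt_ofReal_sub_cpow (b : ℂ) {m u : ℝ} (hu : m < u) :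
    HasDerivAt (fun u : ℝ => ((u - m : ℝ) : ℂ) ^ (-b))
      (-b * ((u - m : ℝ) : ℂ) ^ (-(b + 1))) u := by
  have h1 : HasDerivAt (fun z : ℂ => (z - (m : ℂ)) ^ (-b))
      (-b * ((u : ℂ) - m) ^ (-b - 1) * 1) (u : ℂ) :=
    ((hasDerivAt_id (u : ℂ)).sub_const (m : ℂ)).cpow_const
      (Or.inl (by simpa using hu))
  have h2 := h1.comp_ofReal
  simp only [ofReal_sub]
  convert h2 using 1
  rw [mul_one, neg_add, sub_eq_add_neg (-b)]

theorem hasDerivAt_mtKer {m : ℕ} (a b c : ℂ) {u : ℝ} (hu : (m : ℝ) < u) :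
    HasDerivAt (mtKer m a b c) (mtKerDeriv m a b c u) u := by
  have hu0 : 0 < u := (Nat.cast_nonneg m).trans_lt hu
  have h1 := hasDerivAt_ofReal_sub_cpow b hu
  have h2 : HasDerivAt (fun u : ℝ => (u : ℂ) ^ (-c)) (-c * (u : ℂ) ^ (-(c + 1))) u := by
    simpa using hasDerivAt_ofReal_sub_cpow c hu0
  have h3 := (h1.const_mul ((m : ℂ) ^ (-a))).mul h2
  refine h3.congr_deriv ?_
  simp only [mtKerDeriv, mtKer]
  ring

theorem continuousOn_mtKer (m : ℕ) (a b c : ℂ) :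
    ContinuousOn (mtKer m a b c) (Set.Ioi (m : ℝ)) := fun _ hu =>
  (hasDerivAt_mtKer a b c hu).continuousAt.continuousWithinAt

theorem continuousOn_mtKerDeriv (m : ℕ) (a b c : ℂ) :
    ContinuousOn (mtKerDeriv m a b c) (Set.Ioi (m : ℝ)) :=
  ((continuousOn_mtKer m a (b + 1) c).const_smul b).neg.sub
    ((continuousOn_mtKer m a b (c + 1)).const_smul c)

/-- Differentiation gains one power of u at the price of ‖b‖ + ‖c‖; the factor ‖c‖ is what later
grows with t₃. -/
theorem norm_mtKerDeriv_le {m : ℕ} (hm : 0 < m) (a b c : ℂ) {u : ℝ} (hu : 2 * (m : ℝ) ≤ u) :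
    ‖mtKerDeriv m a b c u‖ ≤
      (‖b‖ + ‖c‖) * 2 ^ (|b.re| + 1) * ((m : ℝ) ^ (-a.re) * u ^ (-(b.re + c.re + 1))) := by
  have hm' : (0 : ℝ) < m := by exact_mod_cast hm
  have hu0 : 0 < u := by linarith
  have h1 := norm_mtKer_le hm a (b + 1) c hu
  have h2 := norm_mtKer_le hm a b (c + 1) hu
  simp only [add_re, one_re] at h1 h2
  have e1 : b.re + 1 + c.re = b.re + c.re + 1 := by ring
  have e2 : b.re + (c.re + 1) = b.re + c.re + 1 := by ring
  rw [e1] at h1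
  rw [e2] at h2
  have hX : 0 ≤ (m : ℝ) ^ (-a.re) * u ^ (-(b.re + c.re + 1)) := by positivity
  have p1 : (2 : ℝ) ^ |b.re + 1| ≤ 2 ^ (|b.re| + 1) := by
    apply Real.rpow_le_rpow_of_exponent_le (by norm_num)
    simpa using abs_add_le b.re 1
  have p2 : (2 : ℝ) ^ |b.re| ≤ 2 ^ (|b.re| + 1) := by
    apply Real.rpow_le_rpow_of_exponent_le (by norm_num); linarith
  calc ‖mtKerDeriv m a b c u‖
      ≤ ‖b‖ * ‖mtKer m a (b + 1) c u‖ + ‖c‖ * ‖mtKer m a b (c + 1) u‖ := by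
        rw [mtKerDeriv]
        refine (norm_sub_le _ _).trans ?_
        rw [norm_neg, norm_mul, norm_mul]
    _ ≤ ‖b‖ * (2 ^ (|b.re| + 1) * ((m : ℝ) ^ (-a.re) * u ^ (-(b.re + c.re + 1))))
        + ‖c‖ * (2 ^ (|b.re| + 1) * ((m : ℝ) ^ (-a.re) * u ^ (-(b.re + c.re + 1)))) := by
        gcongr
        · exact h1.trans (by gcongr)
        · exact h2.trans (by gcongr)
    _ = _ := by ring

theorem intervalIntegrable_mtKer {m : ℕ} (a b c : ℂ) {x y : ℝ} (hx : (m : ℝ) < x)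
    (hy : (m : ℝ) < y) : IntervalIntegrable (mtKer m a b c) volume x y := by
  refine ((continuousOn_mtKer m a b c).mono fun u hu => ?_).intervalIntegrable
  exact (lt_min hx hy).trans_le hu.1

/-- The error made on replacing the value of `mtKer` at `x + 1` by its integral over
`[x, x + 1]`. -/
def mtErr (m : ℕ) (x : ℕ) (a b c : ℂ) : ℂ :=
  mtKer m a b c (x + 1) - ∫ u in (x : ℝ)..(x + 1 : ℝ), mtKer m a b c u

/-- Integration by parts against the weight u - x, which vanishes at x and equals 1 at x + 1. -/
theorem mtErr_eq_integral {m x : ℕ} (hx : m < x) (a b c : ℂ) :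
    mtErr m x a b c = ∫ u in (x : ℝ)..(x + 1 : ℝ), ((u - x : ℝ) : ℂ) * mtKerDeriv m a b c u := by
  have hx' : (m : ℝ) < x := by exact_mod_cast hx
  have hsub : Set.uIcc (x : ℝ) (x + 1) ⊆ Set.Ioi (m : ℝ) := by
    rw [Set.uIcc_of_le (by linarith)]
    exact fun u hu => hx'.trans_le hu.1
  have h := intervalIntegral.integral_mul_deriv_eq_deriv_mul
    (a := (x : ℝ)) (b := x + 1) (u := fun u : ℝ => ((u - x : ℝ) : ℂ)) (u' := fun _ => 1)
    (v := mtKer m a b c) (v' := mtKerDeriv m a b c)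
    (fun u _ => by simpa using ((hasDerivAt_id u).sub_const (x : ℝ)).ofReal_comp)
    (fun u hu => hasDerivAt_mtKer a b c (hsub hu))
    (by simp) ((continuousOn_mtKerDeriv m a b c).mono hsub).intervalIntegrable
  rw [h, mtErr]
  simp

theorem norm_mtErr_le {m x : ℕ} (hm : 0 < m) (hx : 2 * m ≤ x) (a b c : ℂ)
    (hbc : 0 ≤ b.re + c.re + 1) :
    ‖mtErr m x a b c‖ ≤ (‖b‖ + ‖c‖) * 2 ^ (|b.re| + 1) *
      ((m : ℝ) ^ (-a.re) * (x : ℝ) ^ (-(b.re + c.re + 1))) := by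
  have hx' : 2 * (m : ℝ) ≤ x := by exact_mod_cast hx
  have hm' : (0 : ℝ) < m := by exact_mod_cast hm
  rw [mtErr_eq_integral (by omega)]
  have h := intervalIntegral.norm_integral_le_of_norm_le_const (a := (x : ℝ)) (b := x + 1)
    (f := fun u : ℝ => ((u - x : ℝ) : ℂ) * mtKerDeriv m a b c u)
    (C := (‖b‖ + ‖c‖) * 2 ^ (|b.re| + 1) *
      ((m : ℝ) ^ (-a.re) * (x : ℝ) ^ (-(b.re + c.re + 1)))) (fun u hu => ?_)
  · simpa using h
  · rw [Set.uIoc_of_le (by linarith)] at hu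
    rw [norm_mul, Complex.norm_real, Real.norm_eq_abs, abs_of_pos (by linarith [hu.1])]
    have h1 := norm_mtKerDeriv_le hm a b c (u := u) (by linarith [hu.1])
    have h2 : u ^ (-(b.re + c.re + 1)) ≤ (x : ℝ) ^ (-(b.re + c.re + 1)) :=
      Real.rpow_le_rpow_of_nonpos (by linarith) hu.1.le (by linarith)
    calc (u - x) * ‖mtKerDeriv m a b c u‖ ≤ 1 * ‖mtKerDeriv m a b c u‖ := by
          gcongr; linarith [hu.2]
      _ ≤ _ := by
          rw [one_mul]
          refine h1.trans ?_
          gcongr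

/-- Shifting part of the decay from `x` to `m ≤ x`. -/
theorem exists_rpow_mul_rpow_le {α δ : ℝ} (hδ : 0 < δ) (h : 1 < α + δ) :
    ∃ p q : ℝ, 1 < p ∧ 1 < q ∧ ∀ m x : ℝ, 0 < m → m ≤ x →
      m ^ (-α) * x ^ (-(δ + 1)) ≤ m ^ (-p) * x ^ (-q) := by
  -- Moving x^(-θ) over to m^(-θ) leaves the exponents α + θ and δ + 1 - θ. Both exceed 1 exactly
  -- when 1 - α < θ < δ; θ > 0 gives the direction of the inequality.
  obtain ⟨θ, h1, h2⟩ := exists_between (max_lt hδ (by linarith : 1 - α < δ))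
  have hθ := (max_lt_iff.1 h1).1
  have hθ' := (max_lt_iff.1 h1).2
  refine ⟨α + θ, δ + 1 - θ, by linarith, by linarith, fun m x hm hmx => ?_⟩
  have hx := hm.trans_le hmx
  have e1 : m ^ (-α) = m ^ (-(α + θ)) * m ^ θ := by
    rw [← Real.rpow_add hm]; ring_nf
  have e2 : x ^ (-(δ + 1 - θ)) = x ^ θ * x ^ (-(δ + 1)) := by
    rw [← Real.rpow_add hx]; ring_nf
  rw [e1, e2]
  have h3 : m ^ θ ≤ x ^ θ := Real.rpow_le_rpow hm.le hmx hθ.le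
  calc m ^ (-(α + θ)) * m ^ θ * x ^ (-(δ + 1)) ≤ m ^ (-(α + θ)) * x ^ θ * x ^ (-(δ + 1)) := by
        gcongr
    _ = _ := by ring

theorem summable_succ_rpow_neg {p : ℝ} (hp : 1 < p) :
    Summable (fun i : ℕ => ((i + 1 : ℕ) : ℝ) ^ (-p)) :=
  (summable_nat_add_iff 1).2 (Real.summable_nat_rpow.2 (by linarith))

/-- Used with α = Re a and δ = Re(b + c), where the two hypotheses are conditions of `mtTube 1`;
since q > 1, the total error of the lower half converges there. -/
theorem exists_sum_rpow_mul_rpow_le {α δ : ℝ} (hδ : 0 < δ) (h : 1 < α + δ) :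
    ∃ C q : ℝ, 1 < q ∧ 0 ≤ C ∧ ∀ x : ℕ,
      ∑ i ∈ Finset.range (x / 2), ((i + 1 : ℕ) : ℝ) ^ (-α) * (x : ℝ) ^ (-(δ + 1)) ≤
        C * (x : ℝ) ^ (-q) := by
  obtain ⟨p, q, hp, hq, hpq⟩ := exists_rpow_mul_rpow_le hδ h
  have hs := summable_succ_rpow_neg hp
  refine ⟨∑' i : ℕ, ((i + 1 : ℕ) : ℝ) ^ (-p), q, hq, tsum_nonneg fun i => by positivity,
    fun x => ?_⟩
  calc ∑ i ∈ Finset.range (x / 2), ((i + 1 : ℕ) : ℝ) ^ (-α) * (x : ℝ) ^ (-(δ + 1))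
      ≤ ∑ i ∈ Finset.range (x / 2), ((i + 1 : ℕ) : ℝ) ^ (-p) * (x : ℝ) ^ (-q) := by
        refine Finset.sum_le_sum fun i hi => hpq _ _ (by positivity) ?_
        have := Finset.mem_range.1 hi
        exact_mod_cast (by omega : i + 1 ≤ x)
    _ = (∑ i ∈ Finset.range (x / 2), ((i + 1 : ℕ) : ℝ) ^ (-p)) * (x : ℝ) ^ (-q) := by
        rw [Finset.sum_mul]
    _ ≤ _ := by
        gcongr
        exact hs.sum_le_tsum _ fun i _ => by positivity

/-- The lower half `m < n` of the coefficient sum over `m + n = x + 1`. -/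
def mtHalf (x : ℕ) (a b c : ℂ) : ℂ :=
  ∑ i ∈ Finset.range (x / 2), mtKer (i + 1) a b c (x + 1)

/-- The range m ≤ x/2 is the condition m < n for m + n = x + 1, and it keeps the whole interval [x,
x + 1] in the region u ≥ 2m. -/
def mtHalfErr (x : ℕ) (a b c : ℂ) : ℂ :=
  ∑ i ∈ Finset.range (x / 2), mtErr (i + 1) x a b c

/-- Lower bounds α and δ replace the real parts so that one majorant serves a whole ball of
parameters. -/
theorem norm_mtHalfErr_le (x : ℕ) (a b c : ℂ) {α δ : ℝ} (hα : α ≤ a.re) (hδ0 : 0 ≤ δ)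
    (hδ : δ ≤ b.re + c.re) :
    ‖mtHalfErr x a b c‖ ≤ (‖b‖ + ‖c‖) * 2 ^ (|b.re| + 1) *
      ∑ i ∈ Finset.range (x / 2), ((i + 1 : ℕ) : ℝ) ^ (-α) * (x : ℝ) ^ (-(δ + 1)) := by
  rw [mtHalfErr, Finset.mul_sum]
  refine (norm_sum_le _ _).trans (Finset.sum_le_sum fun i hi => ?_)
  have hi' := Finset.mem_range.1 hi
  refine (norm_mtErr_le (Nat.succ_pos i) (by omega) a b c (by linarith)).trans ?_
  have h1 : (1 : ℝ) ≤ ((i + 1 : ℕ) : ℝ) := by push_cast; linarith [Nat.cast_nonneg (α := ℝ) i]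
  have h2 : (1 : ℝ) ≤ (x : ℝ) := by exact_mod_cast (by omega : 1 ≤ x)
  gcongr


/-! ### Explicit bounds for power sums -/

/-- A telescoping majorant from the mean value theorem; the factor 2^q comes from ξ ≤ n + 1 ≤ 2n. -/
theorem rpow_neg_le_sub {q n : ℝ} (hq : 1 < q) (hn : 1 ≤ n) :
    n ^ (-q) ≤ 2 ^ q / (q - 1) * (n ^ (1 - q) - (n + 1) ^ (1 - q)) := by
  have hn0 : 0 < n := by linarith
  obtain ⟨ξ, ⟨h1, h2⟩, h⟩ := exists_hasDerivAt_eq_slope (fun u : ℝ => u ^ (1 - q))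
    (fun u => (1 - q) * u ^ (1 - q - 1)) (by linarith : n < n + 1)
    (fun u hu => (Real.continuousAt_rpow_const u _
      (Or.inl (by linarith [hu.1]))).continuousWithinAt)
    (fun u hu => Real.hasDerivAt_rpow_const (Or.inl (by linarith [hu.1])))
  simp only [add_sub_cancel_left, div_one] at h
  have e : (1 - q - 1 : ℝ) = -q := by ring
  rw [e] at h
  have h3 : n ^ (1 - q) - (n + 1) ^ (1 - q) = (q - 1) * ξ ^ (-q) := by linarith
  have hξ : 0 < ξ := by linarith
  have h4 : (2 * n) ^ (-q) ≤ ξ ^ (-q) :=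
    Real.rpow_le_rpow_of_nonpos hξ (by linarith) (by linarith)
  rw [Real.mul_rpow (by norm_num) hn0.le, Real.rpow_neg (by norm_num)] at h4
  have h2q : (0 : ℝ) < 2 ^ q := by positivity
  rw [h3]
  have hq1 : q - 1 ≠ 0 := by linarith
  have e2 : 2 ^ q / (q - 1) * ((q - 1) * ξ ^ (-q)) = 2 ^ q * ξ ^ (-q) := by
    field_simp
  rw [e2]
  calc n ^ (-q) = 2 ^ q * ((2 ^ q)⁻¹ * n ^ (-q)) := by field_simp
    _ ≤ _ := by gcongr

theorem sum_Ico_rpow_neg_le {q : ℝ} (hq : 1 < q) {M : ℕ} (hM : 1 ≤ M) (K : ℕ) :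
    ∑ n ∈ Finset.Ico M K, (n : ℝ) ^ (-q) ≤ 2 ^ q / (q - 1) * (M : ℝ) ^ (1 - q) := by
  have hC : 0 ≤ 2 ^ q / (q - 1) := div_nonneg (by positivity) (by linarith)
  rcases le_total K M with h | h
  · rw [Finset.Ico_eq_empty_of_le h, Finset.sum_empty]; positivity
  calc ∑ n ∈ Finset.Ico M K, (n : ℝ) ^ (-q)
      ≤ ∑ n ∈ Finset.Ico M K,
        2 ^ q / (q - 1) * ((n : ℝ) ^ (1 - q) - ((n + 1 : ℕ) : ℝ) ^ (1 - q)) := by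
        refine Finset.sum_le_sum fun n hn => ?_
        have := (Finset.mem_Ico.1 hn).1
        have h2 := rpow_neg_le_sub hq (n := n) (by exact_mod_cast hM.trans this)
        simpa using h2
    _ = 2 ^ q / (q - 1) * ((M : ℝ) ^ (1 - q) - (K : ℝ) ^ (1 - q)) := by
        rw [← Finset.mul_sum]
        congr 1
        have := Finset.sum_Ico_sub (fun n : ℕ => -((n : ℝ) ^ (1 - q))) h
        rw [show (M : ℝ) ^ (1 - q) - (K : ℝ) ^ (1 - q) =
          -((K : ℝ) ^ (1 - q)) - -((M : ℝ) ^ (1 - q)) by ring, ← this]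
        exact Finset.sum_congr rfl fun n _ => by ring
    _ ≤ _ := by
        gcongr
        have : (0 : ℝ) ≤ (K : ℝ) ^ (1 - q) := by positivity
        linarith

theorem tsum_add_rpow_neg_le {q : ℝ} (hq : 1 < q) {M : ℕ} (hM : 1 ≤ M) :
    ∑' i : ℕ, ((i + M : ℕ) : ℝ) ^ (-q) ≤ 2 ^ q / (q - 1) * (M : ℝ) ^ (1 - q) := by
  refine Real.tsum_le_of_sum_range_le (fun i => by positivity) fun n => ?_
  have := sum_Ico_rpow_neg_le hq hM (n + M)
  rw [Finset.sum_Ico_eq_sum_range] at this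
  simpa [add_comm] using this

theorem sum_range_rpow_neg_le {α : ℝ} (h0 : 0 ≤ α) (h1 : α < 1) (M : ℕ) :
    ∑ i ∈ Finset.range M, ((i + 1 : ℕ) : ℝ) ^ (-α) ≤ 1 / (1 - α) * (M : ℝ) ^ (1 - α) := by
  induction M with
  | zero =>
    simp [Real.zero_rpow (by linarith : 1 - α ≠ 0)]
  | succ n ih =>
    rw [Finset.sum_range_succ]
    have hn : (0 : ℝ) ≤ n := Nat.cast_nonneg n
    obtain ⟨ξ, ⟨hξ1, hξ2⟩, h⟩ := exists_hasDerivAt_eq_slope (fun u : ℝ => u ^ (1 - α))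
      (fun u => (1 - α) * u ^ (1 - α - 1)) (by linarith : (n : ℝ) < n + 1)
      (Real.continuous_rpow_const (by linarith)).continuousOn
      (fun u hu => Real.hasDerivAt_rpow_const (Or.inl (by linarith [hu.1])))
    simp only [add_sub_cancel_left, div_one] at h
    rw [show (1 - α - 1 : ℝ) = -α by ring] at h
    have h3 : ((n : ℝ) + 1) ^ (-α) ≤ ξ ^ (-α) :=
      Real.rpow_le_rpow_of_nonpos (by linarith) hξ2.le (by linarith)
    have hα : 0 < 1 - α := by linarith
    have h4 : ξ ^ (-α) = 1 / (1 - α) * (((n : ℝ) + 1) ^ (1 - α) - (n : ℝ) ^ (1 - α)) := by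
      rw [← h]; field_simp
    push_cast at *
    linarith

/-! ### The Riemann zeta-function on the right half-plane -/

/-- The error terms in the Euler-Maclaurin formula for `(w - 1) ζ(w)`. -/
def zetaErr (i : ℕ) (w : ℂ) : ℂ :=
  (w - 1) * ((i + 2 : ℕ) : ℂ) ^ (-w) + ((i + 2 : ℕ) : ℂ) ^ (1 - w) - ((i + 1 : ℕ) : ℂ) ^ (1 - w)

/-- The continuation of `(w - 1) ζ(w)` to `0 < Re w`. -/
def zetaNum (w : ℂ) : ℂ := w + ∑' i : ℕ, zetaErr i w

/-- With n = i + 1, this is the increment over [n, n + 1] of (w - 1)(u - n)u^(-w) + u^(1-w). In the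
derivative the terms of order u^(-w) cancel, leaving -w(w - 1)(u - n)u^(-w-1). -/
theorem norm_zetaErr_le (i : ℕ) {w : ℂ} (hw : 0 < w.re) :
    ‖zetaErr i w‖ ≤ ‖w‖ * ‖w - 1‖ * ((i + 1 : ℕ) : ℝ) ^ (-(w.re + 1)) := by
  set n : ℝ := ((i + 1 : ℕ) : ℝ) with hn
  have hn1 : 1 ≤ n := by rw [hn]; push_cast; linarith [Nat.cast_nonneg (α := ℝ) i]
  have hder : ∀ s : ℂ, ∀ u : ℝ, 0 < u →
      HasDerivAt (fun u : ℝ => (u : ℂ) ^ (-s)) (-s * (u : ℂ) ^ (-(s + 1))) u := by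
    intro s u hu
    simpa using hasDerivAt_ofReal_sub_cpow s hu
  have hf : ∀ u ∈ Set.Icc n (n + 1), HasDerivWithinAt
      (fun u : ℝ => (w - 1) * (((u - n : ℝ) : ℂ) * (u : ℂ) ^ (-w)) + (u : ℂ) ^ (-(w - 1)))
      (-(w * (w - 1) * ((u - n : ℝ) : ℂ) * (u : ℂ) ^ (-(w + 1)))) (Set.Icc n (n + 1)) u := by
    intro u hu
    have hu0 : 0 < u := by linarith [hu.1]
    have h1 : HasDerivAt (fun u : ℝ => ((u - n : ℝ) : ℂ)) 1 u := by
      simpa using ((hasDerivAt_id u).sub_const n).ofReal_comp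
    have h2 := ((h1.mul (hder w u hu0)).const_mul (w - 1)).add (hder (w - 1) u hu0)
    refine (h2.congr_deriv ?_).hasDerivWithinAt
    rw [sub_add_cancel]
    ring
  have h := norm_image_sub_le_of_norm_deriv_le_segment' hf
    (C := ‖w‖ * ‖w - 1‖ * n ^ (-(w.re + 1))) (fun u hu => ?_) (n + 1)
    (Set.right_mem_Icc.2 (by linarith))
  · have e : zetaErr i w = ((w - 1) * (((n + 1 - n : ℝ) : ℂ) * ((n + 1 : ℝ) : ℂ) ^ (-w)) +
        ((n + 1 : ℝ) : ℂ) ^ (-(w - 1))) -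
        ((w - 1) * (((n - n : ℝ) : ℂ) * (n : ℂ) ^ (-w)) + (n : ℂ) ^ (-(w - 1))) := by
      have e1 : ((i + 2 : ℕ) : ℂ) = ((n + 1 : ℝ) : ℂ) := by
        rw [hn]; push_cast; ring
      have e2 : ((i + 1 : ℕ) : ℂ) = (n : ℂ) := by rw [hn]; push_cast; ring
      rw [zetaErr, e1, e2, neg_sub]
      simp
    rw [e]
    simpa using h
  · have hu0 : 0 < u := by linarith [hu.1]
    rw [norm_neg, norm_mul, norm_mul, norm_mul, Complex.norm_real,
      Complex.norm_cpow_eq_rpow_re_of_pos hu0, Real.norm_eq_abs,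
      abs_of_nonneg (by linarith [hu.1])]
    have h1 : u ^ (-(w + 1)).re ≤ n ^ (-(w.re + 1)) := by
      simpa using Real.rpow_le_rpow_of_nonpos (by linarith) hu.1 (by linarith : -(w.re + 1) ≤ 0)
    have h2 : u - n ≤ 1 := by linarith [hu.2]
    calc ‖w‖ * ‖w - 1‖ * (u - n) * u ^ (-(w + 1)).re
        ≤ ‖w‖ * ‖w - 1‖ * 1 * n ^ (-(w.re + 1)) := by
          gcongr
      _ = _ := by ring

theorem summable_zetaErr {w : ℂ} (hw : 0 < w.re) : Summable (fun i => zetaErr i w) :=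
  Summable.of_norm_bounded ((summable_succ_rpow_neg (by linarith : 1 < w.re + 1)).mul_left _)
    fun i => norm_zetaErr_le i hw

theorem differentiableAt_zetaNum {w : ℂ} (hw : 0 < w.re) : DifferentiableAt ℂ zetaNum w := by
  refine differentiableAt_id.add ?_
  have hr : 0 < w.re / 2 := by positivity
  have hre : ∀ y ∈ Metric.ball w (w.re / 2), w.re / 2 < y.re ∧ ‖y‖ ≤ ‖w‖ + w.re / 2 := by
    intro y hy
    have h := mem_ball_iff_norm.1 hy
    have h1 := (abs_le.1 ((Complex.abs_re_le_norm (y - w)).trans h.le)).1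
    rw [sub_re] at h1
    have h2 := (abs_lt.1 ((Complex.abs_re_le_norm (y - w)).trans_lt h)).1
    rw [sub_re] at h2
    refine ⟨by linarith, ?_⟩
    have := norm_add_le w (y - w)
    rw [add_sub_cancel] at this
    linarith
  refine differentiableAt_tsum_of_norm_le hr (((summable_succ_rpow_neg
    (by linarith : 1 < w.re / 2 + 1)).mul_left
      ((‖w‖ + w.re / 2) * ((‖w‖ + w.re / 2) + 1)))) (fun i => ?_) fun i y hy => ?_
  · have h1 : ((i + 1 : ℕ) : ℂ) ≠ 0 := Nat.cast_ne_zero.2 (by omega)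
    have h2 : ((i + 2 : ℕ) : ℂ) ≠ 0 := Nat.cast_ne_zero.2 (by omega)
    intro y _
    refine DifferentiableAt.differentiableWithinAt ?_
    unfold zetaErr
    refine ((DifferentiableAt.mul (by fun_prop) ?_).add ?_).sub ?_
    · exact DifferentiableAt.const_cpow (by fun_prop) (Or.inl h2)
    · exact DifferentiableAt.const_cpow (by fun_prop) (Or.inl h2)
    · exact DifferentiableAt.const_cpow (by fun_prop) (Or.inl h1)
  · obtain ⟨h1, h2⟩ := hre y hy
    refine (norm_zetaErr_le i (by linarith)).trans ?_
    have h3 : ‖y - 1‖ ≤ (‖w‖ + w.re / 2) + 1 := by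
      have := norm_sub_le y 1
      rw [norm_one] at this
      linarith
    have h4 : (1 : ℝ) ≤ ((i + 1 : ℕ) : ℝ) := by
      push_cast; linarith [Nat.cast_nonneg (α := ℝ) i]
    gcongr

theorem sub_one_mul_sum_cpow (w : ℂ) (M : ℕ) :
    (w - 1) * ∑ i ∈ Finset.range (M + 1), ((i + 1 : ℕ) : ℂ) ^ (-w) + ((M + 1 : ℕ) : ℂ) ^ (1 - w)
      = w + ∑ i ∈ Finset.range M, zetaErr i w := by
  induction M with
  | zero => simp
  | succ n ih =>
    rw [Finset.sum_range_succ _ (n + 1), Finset.sum_range_succ (fun i => zetaErr i w),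
      ← add_assoc, ← ih, zetaErr, show n + 1 + 1 = n + 2 from rfl]
    ring

/-- By telescoping, the left side is the tail of the `zetaErr` series. The factor ‖w - 1‖ is kept
explicit because the result is later divided by w - 1. -/
theorem norm_zetaNum_sub_le {w : ℂ} (hw : 0 < w.re) {M : ℕ} (hM : 1 ≤ M) :
    ‖zetaNum w - (w - 1) * ∑ i ∈ Finset.range M, ((i + 1 : ℕ) : ℂ) ^ (-w) - (M : ℂ) ^ (1 - w)‖ ≤
      ‖w‖ * ‖w - 1‖ * (2 ^ (w.re + 1) / w.re * (M : ℝ) ^ (-w.re)) := by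
  obtain ⟨M, rfl⟩ : ∃ k, M = k + 1 := ⟨M - 1, by omega⟩
  have hs := summable_zetaErr hw
  have e : zetaNum w - (w - 1) * ∑ i ∈ Finset.range (M + 1), ((i + 1 : ℕ) : ℂ) ^ (-w) -
      ((M + 1 : ℕ) : ℂ) ^ (1 - w) = ∑' i, zetaErr (i + M) w := by
    have h1 := sub_one_mul_sum_cpow w M
    have h2 := hs.sum_add_tsum_nat_add M
    rw [zetaNum, ← h2]
    linear_combination -h1
  rw [e]
  have hs2 := ((summable_nat_add_iff M).2
    (summable_succ_rpow_neg (by linarith : 1 < w.re + 1))).mul_left (‖w‖ * ‖w - 1‖)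
  refine (tsum_of_norm_bounded hs2.hasSum fun i => norm_zetaErr_le (i + M) hw).trans ?_
  rw [tsum_mul_left]
  gcongr
  have := tsum_add_rpow_neg_le (by linarith : 1 < w.re + 1) (M := M + 1) (by omega)
  simpa [add_assoc] using this

theorem tendsto_zetaNum {w : ℂ} (hw : 1 < w.re) :
    Tendsto (fun M : ℕ => (w - 1) * ∑ i ∈ Finset.range M, ((i + 1 : ℕ) : ℂ) ^ (-w)) atTop
      (nhds (zetaNum w)) := by
  rw [← tendsto_add_atTop_iff_nat 1]
  have h1 : Tendsto (fun M : ℕ => w + ∑ i ∈ Finset.range M, zetaErr i w) atTop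
      (nhds (zetaNum w)) :=
    ((summable_zetaErr (by linarith)).hasSum.tendsto_sum_nat).const_add w
  have h2 : Tendsto (fun M : ℕ => ((M + 1 : ℕ) : ℂ) ^ (1 - w)) atTop (nhds 0) := by
    rw [tendsto_zero_iff_norm_tendsto_zero]
    have : (fun M : ℕ => ‖((M + 1 : ℕ) : ℂ) ^ (1 - w)‖) =
        fun M : ℕ => ((M + 1 : ℕ) : ℝ) ^ (-(w.re - 1)) := by
      funext M
      rw [Complex.norm_natCast_cpow_of_pos (by omega)]
      simp
    rw [this]
    exact ((tendsto_rpow_neg_atTop (by linarith)).comp tendsto_natCast_atTop_atTop).comp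
      (tendsto_add_atTop_nat 1)
  have h3 := h1.sub h2
  rw [sub_zero] at h3
  refine h3.congr fun M => ?_
  rw [← sub_one_mul_sum_cpow]
  ring


/-! ### Integrals of the kernel and their continuation -/

/-- The kernel is homogeneous in (m, u). The exponent a' is arbitrary because it is applied to the
base 1. -/
theorem mtKer_mul {m : ℕ} (hm : 0 < m) (a a' b c : ℂ) {v : ℝ} (hv : 1 < v) :
    mtKer m a b c (m * v) = (m : ℂ) ^ (-(a + b + c)) * mtKer 1 a' b c v := by
  have hm' : (m : ℂ) ≠ 0 := Nat.cast_ne_zero.2 hm.ne'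
  have hm0 : (0 : ℝ) ≤ m := Nat.cast_nonneg m
  have e1 : (((m : ℝ) * v - m : ℝ) : ℂ) = ((m : ℝ) : ℂ) * ((v - 1 : ℝ) : ℂ) := by
    push_cast; ring
  rw [mtKer, mtKer, e1, ofReal_mul, Complex.mul_cpow_ofReal_nonneg hm0 (by linarith),
    Complex.mul_cpow_ofReal_nonneg hm0 (by linarith), neg_add, neg_add, Complex.cpow_add _ _ hm',
    Complex.cpow_add _ _ hm']
  simp
  ring

theorem integrableOn_mtKer {m : ℕ} (hm : 0 < m) (a b c : ℂ) (h : 1 < b.re + c.re) {X : ℝ}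
    (hX : 2 * (m : ℝ) ≤ X) : IntegrableOn (mtKer m a b c) (Set.Ioi X) := by
  have hm' : (0 : ℝ) < m := by exact_mod_cast hm
  have hint : IntegrableOn (fun u : ℝ => 2 ^ |b.re| * ((m : ℝ) ^ (-a.re) *
      u ^ (-(b.re + c.re)))) (Set.Ioi X) :=
    ((integrableOn_Ioi_rpow_of_lt (by linarith) (by linarith)).const_mul _).const_mul _
  refine hint.mono' (((continuousOn_mtKer m a b c).mono fun u hu => ?_).aestronglyMeasurable
    measurableSet_Ioi) ?_
  · have : X < u := hu
    exact Set.mem_Ioi.2 (by linarith)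
  · refine (ae_restrict_iff' measurableSet_Ioi).2 (Eventually.of_forall fun u hu => ?_)
    have : X < u := hu
    exact norm_mtKer_le hm a b c (by linarith)

theorem norm_integral_Ioi_mtKer_le {m : ℕ} (hm : 0 < m) (a b c : ℂ) (h : 1 < b.re + c.re) {X : ℝ}
    (hX : 2 * (m : ℝ) ≤ X) :
    ‖∫ u in Set.Ioi X, mtKer m a b c u‖ ≤ 2 ^ |b.re| * ((m : ℝ) ^ (-a.re) *
      (X ^ (1 - (b.re + c.re)) / (b.re + c.re - 1))) := by
  have hm' : (0 : ℝ) < m := by exact_mod_cast hm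
  have hX0 : 0 < X := by linarith
  have hint : IntegrableOn (fun u : ℝ => 2 ^ |b.re| * ((m : ℝ) ^ (-a.re) *
      u ^ (-(b.re + c.re)))) (Set.Ioi X) :=
    ((integrableOn_Ioi_rpow_of_lt (by linarith) (by linarith)).const_mul _).const_mul _
  refine (norm_integral_le_of_norm_le hint ((ae_restrict_iff' measurableSet_Ioi).2
    (Eventually.of_forall fun u hu => norm_mtKer_le hm a b c ?_))).trans_eq ?_
  · have : X < u := hu
    linarith
  · rw [integral_const_mul, integral_const_mul, integral_Ioi_rpow_of_lt (by linarith) hX0]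
    have e : -(b.re + c.re) + 1 = -(b.re + c.re - 1) := by ring
    rw [show 1 - (b.re + c.re) = -(b.re + c.re - 1) by ring, e, neg_div_neg_eq]

/-- The integral `∫_2^∞ (v - 1) ^ (-b - 1) * v ^ (-c) dv`. -/
def mtK (b c : ℂ) : ℂ := ∫ u in Set.Ioi (2 : ℝ), mtKer 1 0 (b + 1) c u

/-- `(b + c - 1)` times the continuation of `∫_2^∞ (v - 1) ^ (-b) * v ^ (-c) dv`. -/
def mtINum (b c : ℂ) : ℂ := 2 ^ (1 - c) - b * mtK b c

/-- The continuation of `∫_X^∞ m ^ (-a) * (u - m) ^ (-b) * u ^ (-c) du`. -/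
def mtTail (m : ℕ) (X : ℝ) (a b c : ℂ) : ℂ :=
  (m : ℂ) ^ (1 - (a + b + c)) * (mtINum b c / (b + c - 1)) -
    ∫ u in (2 * m : ℝ)..X, mtKer m a b c u

theorem integral_Ioi_mtKer_eq {m : ℕ} (hm : 0 < m) (a b c : ℂ) :
    ∫ u in Set.Ioi (2 * m : ℝ), mtKer m (a - 1) (b + 1) c u =
      (m : ℂ) ^ (1 - (a + b + c)) * mtK b c := by
  have hm' : (0 : ℝ) < m := by exact_mod_cast hm
  have hmc : (m : ℂ) ≠ 0 := Nat.cast_ne_zero.2 hm.ne'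
  have h := integral_comp_mul_left_Ioi (fun u => mtKer m (a - 1) (b + 1) c u) 2 hm'
  rw [mul_comm (2 : ℝ)]
  have h2 : ∫ v in Set.Ioi (2 : ℝ), mtKer m (a - 1) (b + 1) c (m * v) =
      (m : ℂ) ^ (-(a + b + c)) * mtK b c := by
    rw [mtK, ← integral_const_mul]
    refine setIntegral_congr_fun measurableSet_Ioi fun v hv => ?_
    have hv' : (2 : ℝ) < v := hv
    rw [mtKer_mul hm (a - 1) 0 (b + 1) c (by linarith)]
    congr 3
    ring
  rw [h2] at h
  have h3 : (∫ u in Set.Ioi ((m : ℝ) * 2), mtKer m (a - 1) (b + 1) c u) =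
      (m : ℝ) • ((m : ℂ) ^ (-(a + b + c)) * mtK b c) := by
    rw [h, smul_smul, mul_inv_cancel₀ hm'.ne', one_smul]
  rw [h3, sub_eq_add_neg, Complex.cpow_add _ _ hmc, Complex.cpow_one, Complex.real_smul]
  push_cast
  ring

/-- Writing u = (u - m) + m splits the derivative into a multiple of the kernel itself and a term
decaying one power of u faster. Integrated, this continues the kernel integral from Re(b + c) > 1 to
Re(b + c) > 0. -/
theorem mtKerDeriv_eq {m : ℕ} (hm : 0 < m) (a b c : ℂ) {u : ℝ} (hu : (m : ℝ) < u) :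
    mtKerDeriv m a b (c - 1) u =
      -((b + c - 1) * mtKer m a b c u) - b * mtKer m (a - 1) (b + 1) c u := by
  have hm' : (0 : ℝ) < m := by exact_mod_cast hm
  have hu0 : (u : ℂ) ≠ 0 := ofReal_ne_zero.2 (by linarith)
  have hum : ((u - m : ℝ) : ℂ) ≠ 0 := ofReal_ne_zero.2 (by linarith)
  have hmc : (m : ℂ) ≠ 0 := Nat.cast_ne_zero.2 hm.ne'
  have e1 : (u : ℂ) ^ (-(c - 1)) = u * (u : ℂ) ^ (-c) := by
    rw [neg_sub, sub_eq_add_neg, Complex.cpow_add _ _ hu0, Complex.cpow_one]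
  have e2 : ((u - m : ℝ) : ℂ) ^ (-b) = ((u - m : ℝ) : ℂ) * ((u - m : ℝ) : ℂ) ^ (-(b + 1)) := by
    rw [show -b = 1 + -(b + 1) by ring, Complex.cpow_add _ _ hum, Complex.cpow_one]
  have e3 : (m : ℂ) ^ (-(a - 1)) = m * (m : ℂ) ^ (-a) := by
    rw [neg_sub, sub_eq_add_neg, Complex.cpow_add _ _ hmc, Complex.cpow_one]
  simp only [mtKerDeriv, mtKer, sub_add_cancel]
  rw [e1, e2, e3]
  push_cast
  ring

/-- The fundamental theorem of calculus on [2m, X] moves the lower endpoint from 2m to X: the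
boundary terms at 2m cancel against the definition of `mtINum`. -/
theorem mul_mtTail {m : ℕ} (hm : 0 < m) {a b c : ℂ} (h1 : b + c ≠ 1) (h : 0 < b.re + c.re) {X : ℝ}
    (hX : 2 * (m : ℝ) ≤ X) :
    (b + c - 1) * mtTail m X a b c =
      mtKer m a b (c - 1) X - b * ∫ u in Set.Ioi X, mtKer m (a - 1) (b + 1) c u := by
  have hm' : (0 : ℝ) < m := by exact_mod_cast hm
  have hne : b + c - 1 ≠ 0 := sub_ne_zero.2 h1
  have hsub : Set.uIcc (2 * m : ℝ) X ⊆ Set.Ioi (m : ℝ) := by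
    rw [Set.uIcc_of_le hX]
    intro u hu
    exact Set.mem_Ioi.2 (by linarith [hu.1])
  have hftc := intervalIntegral.integral_eq_sub_of_hasDerivAt (a := (2 * m : ℝ)) (b := X)
    (f := mtKer m a b (c - 1)) (f' := mtKerDeriv m a b (c - 1))
    (fun u hu => hasDerivAt_mtKer a b (c - 1) (hsub hu))
    ((continuousOn_mtKerDeriv m a b (c - 1)).mono hsub).intervalIntegrable
  have hi1 : IntervalIntegrable (mtKer m a b c) volume (2 * m : ℝ) X :=
    intervalIntegrable_mtKer a b c (by linarith) (by linarith)
  have hi2 : IntervalIntegrable (mtKer m (a - 1) (b + 1) c) volume (2 * m : ℝ) X :=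
    intervalIntegrable_mtKer _ _ _ (by linarith) (by linarith)
  have e1 : ∫ u in (2 * m : ℝ)..X, mtKerDeriv m a b (c - 1) u =
      -((b + c - 1) * ∫ u in (2 * m : ℝ)..X, mtKer m a b c u) -
        b * ∫ u in (2 * m : ℝ)..X, mtKer m (a - 1) (b + 1) c u := by
    rw [← intervalIntegral.integral_const_mul, ← intervalIntegral.integral_const_mul,
      ← intervalIntegral.integral_neg,
      ← intervalIntegral.integral_sub (f := fun u => -((b + c - 1) * mtKer m a b c u))
        (hi1.const_mul _).neg (hi2.const_mul _)]
    exact intervalIntegral.integral_congr fun u hu => mtKerDeriv_eq hm a b c (hsub hu)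
  rw [e1] at hftc
  have hlt : 1 < (b + 1).re + c.re := by simp only [add_re, one_re]; linarith
  have e2 := intervalIntegral.integral_interval_add_Ioi
    (integrableOn_mtKer hm (a - 1) (b + 1) c hlt le_rfl)
    (integrableOn_mtKer hm (a - 1) (b + 1) c hlt hX)
  rw [integral_Ioi_mtKer_eq hm] at e2
  have e3 : mtKer m a b (c - 1) (2 * m : ℝ) = (m : ℂ) ^ (1 - (a + b + c)) * 2 ^ (1 - c) := by
    rw [mul_comm, mtKer_mul hm a 0 b (c - 1) (by norm_num)]
    congr 1
    · congr 1; ring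
    · simp [mtKer]
      norm_num
  rw [e3] at hftc
  have e4 : (b + c - 1) * mtTail m X a b c = (m : ℂ) ^ (1 - (a + b + c)) * mtINum b c -
      (b + c - 1) * ∫ u in (2 * m : ℝ)..X, mtKer m a b c u := by
    rw [mtTail]
    field_simp
  rw [e4, mtINum]
  linear_combination hftc + b * e2

/-- The continued tail has the size expected from the divergent integral, with a denominator ‖b + c
- 1‖ that will supply the decay 1/t. -/
theorem norm_mtTail_le {m : ℕ} (hm : 0 < m) {a b c : ℂ} (h1 : b + c ≠ 1) (h : 0 < b.re + c.re)
    {X : ℝ} (hX : 2 * (m : ℝ) ≤ X) :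
    ‖mtTail m X a b c‖ ≤ (2 ^ |b.re| + ‖b‖ * 2 ^ |b.re + 1| / (b.re + c.re)) / ‖b + c - 1‖ *
      ((m : ℝ) ^ (-a.re) * X ^ (1 - (b.re + c.re))) := by
  have hm' : (0 : ℝ) < m := by exact_mod_cast hm
  have hX0 : 0 < X := by linarith
  have hne : b + c - 1 ≠ 0 := sub_ne_zero.2 h1
  have hpos : 0 < ‖b + c - 1‖ := norm_pos_iff.2 hne
  have hk := mul_mtTail hm (a := a) h1 h hX
  have hlt : 1 < (b + 1).re + c.re := by simp only [add_re, one_re]; linarith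
  have b1 := norm_mtKer_le hm a b (c - 1) hX
  have b2 := norm_integral_Ioi_mtKer_le hm (a - 1) (b + 1) c hlt hX
  simp only [add_re, sub_re, one_re] at b1 b2
  rw [show -(b.re + (c.re - 1)) = 1 - (b.re + c.re) by ring] at b1
  rw [show 1 - (b.re + 1 + c.re) = -(b.re + c.re) by ring,
    show b.re + 1 + c.re - 1 = b.re + c.re by ring] at b2
  have b3 : (m : ℝ) ^ (-(a.re - 1)) * X ^ (-(b.re + c.re)) ≤
      (m : ℝ) ^ (-a.re) * X ^ (1 - (b.re + c.re)) := by
    have : (m : ℝ) ^ (-(a.re - 1)) = (m : ℝ) ^ (-a.re) * m := by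
      rw [neg_sub, sub_eq_add_neg, add_comm, Real.rpow_add hm', Real.rpow_one]
    have h2 : X ^ (1 - (b.re + c.re)) = X * X ^ (-(b.re + c.re)) := by
      rw [sub_eq_add_neg, Real.rpow_add hX0, Real.rpow_one]
    rw [this, h2, mul_assoc]
    gcongr
    linarith
  rw [div_mul_eq_mul_div, le_div_iff₀ hpos, mul_comm ‖mtTail m X a b c‖, ← norm_mul, hk]
  calc _ ≤ ‖mtKer m a b (c - 1) X‖ +
        ‖b‖ * ‖∫ u in Set.Ioi X, mtKer m (a - 1) (b + 1) c u‖ := by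
        rw [← norm_mul]; exact norm_sub_le _ _
    _ ≤ 2 ^ |b.re| * ((m : ℝ) ^ (-a.re) * X ^ (1 - (b.re + c.re))) + ‖b‖ *
        (2 ^ |b.re + 1| * ((m : ℝ) ^ (-(a.re - 1)) * (X ^ (-(b.re + c.re)) / (b.re + c.re)))) := by
        gcongr
    _ = 2 ^ |b.re| * ((m : ℝ) ^ (-a.re) * X ^ (1 - (b.re + c.re))) + ‖b‖ *
        2 ^ |b.re + 1| / (b.re + c.re) * ((m : ℝ) ^ (-(a.re - 1)) * X ^ (-(b.re + c.re))) := by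
        ring
    _ ≤ 2 ^ |b.re| * ((m : ℝ) ^ (-a.re) * X ^ (1 - (b.re + c.re))) + ‖b‖ *
        2 ^ |b.re + 1| / (b.re + c.re) * ((m : ℝ) ^ (-a.re) * X ^ (1 - (b.re + c.re))) := by
        gcongr
    _ = _ := by ring

/-- Euler-Maclaurin summation over the lower half of the triangle `m + n ≤ 2 M`. -/
theorem sum_mtHalf (M : ℕ) (a b c : ℂ) :
    ∑ x ∈ Finset.range (2 * M), mtHalf x a b c =
      ∑ x ∈ Finset.range (2 * M), mtHalfErr x a b c +
      mtINum b c / (b + c - 1) *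
        ∑ i ∈ Finset.range M, ((i + 1 : ℕ) : ℂ) ^ (-(a + b + c - 1)) -
      ∑ i ∈ Finset.range M, mtTail (i + 1) (2 * M : ℕ) a b c := by
  have h1 : ∀ x, mtHalf x a b c = mtHalfErr x a b c +
      ∑ i ∈ Finset.range (x / 2), ∫ u in (x : ℝ)..(x + 1 : ℝ), mtKer (i + 1) a b c u := by
    intro x
    rw [mtHalf, mtHalfErr, ← Finset.sum_add_distrib]
    exact Finset.sum_congr rfl fun i _ => by rw [mtErr]; ring
  have h2 : ∑ x ∈ Finset.range (2 * M), ∑ i ∈ Finset.range (x / 2),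
      ∫ u in (x : ℝ)..(x + 1 : ℝ), mtKer (i + 1) a b c u =
      ∑ i ∈ Finset.range M, ∫ u in (2 * ((i + 1 : ℕ) : ℝ))..((2 * M : ℕ) : ℝ),
        mtKer (i + 1) a b c u := by
    -- The condition i < x/2 is x ≥ 2(i + 1), so for fixed m = i + 1 the unit intervals join up to
    -- [2m, 2M].
    rw [Finset.sum_comm' (t' := Finset.range M)
      (s' := fun i => Finset.Ico (2 * (i + 1)) (2 * M))]
    · refine Finset.sum_congr rfl fun i hi => ?_
      have hi' := Finset.mem_range.1 hi
      have := intervalIntegral.sum_integral_adjacent_intervals_Ico (f := mtKer (i + 1) a b c)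
        (μ := volume) (a := fun n : ℕ => (n : ℝ)) (m := 2 * (i + 1)) (n := 2 * M) (by omega)
        (fun k hk => by
          have h3 : i + 1 < k := by have := hk.1; omega
          have h4 : i + 1 < k + 1 := by omega
          exact intervalIntegrable_mtKer _ _ _ (by exact_mod_cast h3) (by exact_mod_cast h4))
      simpa using this
    · intro x i
      simp only [Finset.mem_range, Finset.mem_Ico]
      omega
  rw [Finset.sum_congr rfl fun x _ => h1 x, Finset.sum_add_distrib, h2, add_sub_assoc,
    Finset.mul_sum, ← Finset.sum_sub_distrib]
  congr 1
  refine Finset.sum_congr rfl fun i _ => ?_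
  rw [mtTail, neg_sub]
  ring


/-! ### Holomorphy of the continued numerator -/

/-- The sum of all error terms `mtErr` over the lower half. -/
def mtErrSum (a b c : ℂ) : ℂ := ∑' x : ℕ, mtHalfErr x a b c

theorem summable_mtHalfErr {a b c : ℂ} (h1 : 0 < b.re + c.re) (h2 : 1 < a.re + b.re + c.re) :
    Summable (fun x => mtHalfErr x a b c) := by
  obtain ⟨C, q, hq, hC, hb⟩ := exists_sum_rpow_mul_rpow_le h1
    (by linarith : 1 < a.re + (b.re + c.re))
  refine Summable.of_norm_bounded (((Real.summable_nat_rpow.2 (by linarith : -q < -1)).mul_left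
    C).mul_left ((‖b‖ + ‖c‖) * 2 ^ (|b.re| + 1))) fun x => ?_
  refine (norm_mtHalfErr_le x a b c le_rfl h1.le le_rfl).trans ?_
  gcongr
  exact hb x

theorem mem_ball_prod_re {s y : ℂ × ℂ × ℂ} {r : ℝ} (h : y ∈ Metric.ball s r) :
    (|y.1.re - s.1.re| < r ∧ |y.2.1.re - s.2.1.re| < r ∧ |y.2.2.re - s.2.2.re| < r) ∧
      ‖y.2.1‖ ≤ ‖s.2.1‖ + r ∧ ‖y.2.2‖ ≤ ‖s.2.2‖ + r := by
  rw [Metric.mem_ball, dist_eq_norm, Prod.norm_def, max_lt_iff, Prod.norm_def, max_lt_iff] at h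
  obtain ⟨h1, h2, h3⟩ := h
  simp only [Prod.fst_sub, Prod.snd_sub] at h1 h2 h3
  have key : ∀ z : ℂ, ‖z‖ < r → |z.re| < r := fun z hz => (Complex.abs_re_le_norm z).trans_lt hz
  refine ⟨⟨key _ h1, key _ h2, key _ h3⟩, ?_, ?_⟩
  · have := norm_add_le s.2.1 (y.2.1 - s.2.1)
    rw [add_sub_cancel] at this
    linarith
  · have := norm_add_le s.2.2 (y.2.2 - s.2.2)
    rw [add_sub_cancel] at this
    linarith

theorem differentiable_mtKer {m : ℕ} (hm : 0 < m) {u : ℝ} (hu : (m : ℝ) < u) :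
    Differentiable ℂ (fun y : ℂ × ℂ × ℂ => mtKer m y.1 y.2.1 y.2.2 u) := by
  have h1 : (m : ℂ) ≠ 0 := Nat.cast_ne_zero.2 hm.ne'
  have h2 : ((u - m : ℝ) : ℂ) ≠ 0 := ofReal_ne_zero.2 (by linarith)
  have h3 : (u : ℂ) ≠ 0 := ofReal_ne_zero.2 ((Nat.cast_nonneg m).trans_lt hu).ne'
  unfold mtKer
  intro y
  exact ((DifferentiableAt.const_cpow (by fun_prop) (Or.inl h1)).mul
    (DifferentiableAt.const_cpow (by fun_prop) (Or.inl h2))).mul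
    (DifferentiableAt.const_cpow (by fun_prop) (Or.inl h3))

theorem differentiableAt_mtK {s : ℂ × ℂ × ℂ} (h1 : 0 < s.2.1.re + s.2.2.re) :
    DifferentiableAt ℂ (fun y : ℂ × ℂ × ℂ => mtK y.2.1 y.2.2) s := by
  unfold mtK
  set δ := s.2.1.re + s.2.2.re with hδ
  -- Moving b and c by less than δ/4 each keeps Re(b + c) above δ/2, so u^(-(1+δ/2)) is a uniform
  -- integrable majorant.
  have hr : 0 < δ / 4 := by positivity
  have hint : IntegrableOn (fun u : ℝ => 2 ^ (|s.2.1.re + 1| + δ / 4) * u ^ (-(1 + δ / 2)))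
      (Set.Ioi 2) :=
    (integrableOn_Ioi_rpow_of_lt (by linarith) (by norm_num)).const_mul _
  refine differentiableAt_integral_of_norm_le (μ := volume.restrict (Set.Ioi 2))
    (F := fun y u => mtKer 1 0 (y.2.1 + 1) y.2.2 u) hr hint (fun y _ => ?_) ?_ ?_
  · refine ((continuousOn_mtKer 1 0 _ _).mono fun u hu => ?_).aestronglyMeasurable
      measurableSet_Ioi
    have : (2 : ℝ) < u := hu
    simp only [Nat.cast_one, Set.mem_Ioi]
    linarith
  · refine (ae_restrict_iff' measurableSet_Ioi).2 (Eventually.of_forall fun u hu => ?_)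
    have hu' : (2 : ℝ) < u := hu
    have h := differentiable_mtKer (m := 1) one_pos (u := u) (by push_cast; linarith)
    have h' : Differentiable ℂ
        (fun y : ℂ × ℂ × ℂ => (((0 : ℂ), y.2.1 + 1, y.2.2) : ℂ × ℂ × ℂ)) := by
      fun_prop
    exact (h.comp h').differentiableOn
  · refine (ae_restrict_iff' measurableSet_Ioi).2 (Eventually.of_forall fun u hu y hy => ?_)
    have hu' : (2 : ℝ) < u := hu
    obtain ⟨⟨-, h3, h4⟩, -⟩ := mem_ball_prod_re hy
    have h := norm_mtKer_le (m := 1) one_pos 0 (y.2.1 + 1) y.2.2 (u := u) (by push_cast; linarith)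
    simp only [Nat.cast_one, Real.one_rpow, one_mul, add_re, one_re] at h
    refine h.trans ?_
    have e1 : |y.2.1.re + 1| ≤ |s.2.1.re + 1| + δ / 4 := by
      have := abs_add_le (s.2.1.re + 1) (y.2.1.re - s.2.1.re)
      rw [show s.2.1.re + 1 + (y.2.1.re - s.2.1.re) = y.2.1.re + 1 by ring] at this
      linarith
    have e2 : -(y.2.1.re + 1 + y.2.2.re) ≤ -(1 + δ / 2) := by
      linarith [(abs_lt.1 h3).1, (abs_lt.1 h4).1]
    gcongr
    · norm_num
    · linarith

theorem differentiableAt_mtINum {s : ℂ × ℂ × ℂ} (h1 : 0 < s.2.1.re + s.2.2.re) :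
    DifferentiableAt ℂ (fun y : ℂ × ℂ × ℂ => mtINum y.2.1 y.2.2) s := by
  unfold mtINum
  refine DifferentiableAt.sub ?_ (DifferentiableAt.mul (by fun_prop) (differentiableAt_mtK h1))
  exact DifferentiableAt.const_cpow (by fun_prop) (Or.inl two_ne_zero)

theorem differentiableAt_mtErr {m x : ℕ} (hm : 0 < m) (hx : 2 * m ≤ x) {s : ℂ × ℂ × ℂ}
    (h1 : 0 < s.2.1.re + s.2.2.re) :
    DifferentiableAt ℂ (fun y : ℂ × ℂ × ℂ => mtErr m x y.1 y.2.1 y.2.2) s := by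
  have hm' : (1 : ℝ) ≤ m := by exact_mod_cast hm
  have hx' : 2 * (m : ℝ) ≤ x := by exact_mod_cast hx
  unfold mtErr
  refine (differentiable_mtKer hm (by linarith)).differentiableAt.sub ?_
  simp only [intervalIntegral.integral_of_le (by linarith : (x : ℝ) ≤ x + 1)]
  set δ := s.2.1.re + s.2.2.re with hδ
  have hr : 0 < δ / 2 := by positivity
  refine differentiableAt_integral_of_norm_le (μ := volume.restrict (Set.Ioc (x : ℝ) (x + 1)))
    (F := fun y u => mtKer m y.1 y.2.1 y.2.2 u)
    (g := fun _ => 2 ^ (|s.2.1.re| + δ / 2) * ((m : ℝ) ^ (-(s.1.re - δ / 2)) * 1))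
    hr (integrable_const _) (fun y _ => ?_) ?_ ?_
  · refine ((continuousOn_mtKer m _ _ _).mono fun u hu => ?_).aestronglyMeasurable
      measurableSet_Ioc
    exact Set.mem_Ioi.2 (by linarith [hu.1])
  · refine (ae_restrict_iff' measurableSet_Ioc).2 (Eventually.of_forall fun u hu => ?_)
    exact (differentiable_mtKer hm (by linarith [hu.1])).differentiableOn
  · refine (ae_restrict_iff' measurableSet_Ioc).2 (Eventually.of_forall fun u hu y hy => ?_)
    obtain ⟨⟨h2, h3, h4⟩, -⟩ := mem_ball_prod_re hy
    refine (norm_mtKer_le hm y.1 y.2.1 y.2.2 (u := u) (by linarith [hu.1])).trans ?_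
    have e1 : |y.2.1.re| ≤ |s.2.1.re| + δ / 2 := by
      have := abs_add_le s.2.1.re (y.2.1.re - s.2.1.re)
      rw [add_sub_cancel] at this
      linarith
    have e2 : u ^ (-(y.2.1.re + y.2.2.re)) ≤ 1 :=
      Real.rpow_le_one_of_one_le_of_nonpos (by linarith [hu.1])
        (by linarith [(abs_lt.1 h3).1, (abs_lt.1 h4).1])
    have e3 : -y.1.re ≤ -(s.1.re - δ / 2) := by linarith [(abs_lt.1 h2).1]
    have hu0 : 0 < u := by linarith [hu.1]
    have h12 : (1 : ℝ) ≤ 2 := by norm_num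
    gcongr

theorem differentiableAt_mtErrSum {s : ℂ × ℂ × ℂ} (h1 : 0 < s.2.1.re + s.2.2.re)
    (h2 : 1 < s.1.re + s.2.1.re + s.2.2.re) :
    DifferentiableAt ℂ (fun y : ℂ × ℂ × ℂ => mtErrSum y.1 y.2.1 y.2.2) s := by
  unfold mtErrSum
  -- On a ball of radius r, Re(b + c) drops by at most 2r and Re(a + b + c) by at most 3r. Both
  -- bounds on r are needed to stay within the summability conditions.
  obtain ⟨r, hr, hr1⟩ := exists_between (lt_min (half_pos h1)
    (by linarith : 0 < (s.1.re + s.2.1.re + s.2.2.re - 1) / 3))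
  have hr2 := (lt_min_iff.1 hr1).1
  have hr3 := (lt_min_iff.1 hr1).2
  set δ := s.2.1.re + s.2.2.re - 2 * r with hδ
  set α := s.1.re - r with hα
  have hδ0 : 0 < δ := by rw [hδ]; linarith
  obtain ⟨C, q, hq, hC, hb⟩ := exists_sum_rpow_mul_rpow_le hδ0
    (by rw [hα, hδ]; linarith : 1 < α + δ)
  refine differentiableAt_tsum_of_norm_le (u := fun x : ℕ =>
    ((‖s.2.1‖ + r) + (‖s.2.2‖ + r)) * 2 ^ (|s.2.1.re| + r + 1) * (C * (x : ℝ) ^ (-q))) hr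
    (((Real.summable_nat_rpow.2 (by linarith : -q < -1)).mul_left C).mul_left _)
    (fun x y hy => ?_) fun x y hy => ?_
  · obtain ⟨⟨-, h4, h5⟩, -⟩ := mem_ball_prod_re hy
    refine DifferentiableAt.differentiableWithinAt ?_
    unfold mtHalfErr
    refine DifferentiableAt.fun_sum fun i hi => ?_
    have := Finset.mem_range.1 hi
    exact differentiableAt_mtErr (Nat.succ_pos i) (by omega)
      (by linarith [(abs_lt.1 h4).1, (abs_lt.1 h5).1])
  · obtain ⟨⟨h3, h4, h5⟩, h6, h7⟩ := mem_ball_prod_re hy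
    refine (norm_mtHalfErr_le x y.1 y.2.1 y.2.2 (α := α) (δ := δ)
      (by linarith [(abs_lt.1 h3).1]) hδ0.le
      (by linarith [(abs_lt.1 h4).1, (abs_lt.1 h5).1])).trans ?_
    have e1 : |y.2.1.re| + 1 ≤ |s.2.1.re| + r + 1 := by
      have := abs_add_le s.2.1.re (y.2.1.re - s.2.1.re)
      rw [add_sub_cancel] at this
      linarith
    gcongr
    · norm_num
    · exact hb x

/-- The numerator of the continued Mordell-Tornheim double zeta-function on `mtTube 1`. -/
def mtNum (s : ℂ × ℂ × ℂ) : ℂ :=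
  zetaNum (s.1 + s.2.1 + s.2.2 - 1) *
      ((s.1 + s.2.2 - 1) * mtINum s.2.1 s.2.2 + (s.2.1 + s.2.2 - 1) * mtINum s.1 s.2.2) +
    (s.1 + s.2.1 + s.2.2 - 2) * ((s.1 + s.2.2 - 1) * (s.2.1 + s.2.2 - 1)) *
      (mtErrSum s.1 s.2.1 s.2.2 + mtErrSum s.2.1 s.1 s.2.2 +
        2 ^ (-s.2.2) * (zetaNum (s.1 + s.2.1 + s.2.2) / (s.1 + s.2.1 + s.2.2 - 1)))

theorem mem_mtTube_one {s : ℂ × ℂ × ℂ} : s ∈ mtTube 1 ↔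
    0 < s.1.re + s.2.2.re ∧ 0 < s.2.1.re + s.2.2.re ∧ 1 < s.1.re + s.2.1.re + s.2.2.re := by
  simp only [mtTube, Set.mem_ofPred_eq]
  norm_num

theorem differentiableOn_mtNum : DifferentiableOn ℂ mtNum (mtTube 1) := by
  intro s hs
  obtain ⟨h1, h2, h3⟩ := mem_mtTube_one.1 hs
  refine DifferentiableAt.differentiableWithinAt ?_
  have hswap : DifferentiableAt ℂ (fun y : ℂ × ℂ × ℂ => ((y.2.1, y.1, y.2.2) : ℂ × ℂ × ℂ)) s := by
    fun_prop
  have hS : DifferentiableAt ℂ (fun y : ℂ × ℂ × ℂ => y.1 + y.2.1 + y.2.2) s := by fun_prop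
  have hS1 : DifferentiableAt ℂ (fun y : ℂ × ℂ × ℂ => y.1 + y.2.1 + y.2.2 - 1) s := by fun_prop
  have hz1 : DifferentiableAt ℂ (fun y : ℂ × ℂ × ℂ => zetaNum (y.1 + y.2.1 + y.2.2 - 1)) s :=
    DifferentiableAt.comp (g := zetaNum) (f := fun y : ℂ × ℂ × ℂ => y.1 + y.2.1 + y.2.2 - 1) s
      (differentiableAt_zetaNum (by simp only [add_re, sub_re, one_re]; linarith)) hS1
  have hz2 : DifferentiableAt ℂ (fun y : ℂ × ℂ × ℂ => zetaNum (y.1 + y.2.1 + y.2.2)) s :=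
    DifferentiableAt.comp (g := zetaNum) (f := fun y : ℂ × ℂ × ℂ => y.1 + y.2.1 + y.2.2) s
      (differentiableAt_zetaNum (by simp only [add_re]; linarith)) hS
  have hI1 := differentiableAt_mtINum h2
  have hI2 : DifferentiableAt ℂ (fun y : ℂ × ℂ × ℂ => mtINum y.1 y.2.2) s :=
    DifferentiableAt.comp (g := fun y : ℂ × ℂ × ℂ => mtINum y.2.1 y.2.2)
      (f := fun y : ℂ × ℂ × ℂ => ((y.2.1, y.1, y.2.2) : ℂ × ℂ × ℂ)) s
      (differentiableAt_mtINum h1) hswap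
  have hE1 := differentiableAt_mtErrSum h2 h3
  have hE2 : DifferentiableAt ℂ (fun y : ℂ × ℂ × ℂ => mtErrSum y.2.1 y.1 y.2.2) s :=
    DifferentiableAt.comp (g := fun y : ℂ × ℂ × ℂ => mtErrSum y.1 y.2.1 y.2.2)
      (f := fun y : ℂ × ℂ × ℂ => ((y.2.1, y.1, y.2.2) : ℂ × ℂ × ℂ)) s
      (differentiableAt_mtErrSum h1 (by simp only; linarith)) hswap
  have hne : s.1 + s.2.1 + s.2.2 - 1 ≠ 0 := by
    intro h
    have := congrArg Complex.re h
    simp only [add_re, sub_re, one_re, zero_re] at this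
    linarith
  have h2c : DifferentiableAt ℂ (fun y : ℂ × ℂ × ℂ => (2 : ℂ) ^ (-y.2.2)) s :=
    DifferentiableAt.const_cpow (by fun_prop) (Or.inl two_ne_zero)
  have hq : DifferentiableAt ℂ (fun y : ℂ × ℂ × ℂ =>
      zetaNum (y.1 + y.2.1 + y.2.2) / (y.1 + y.2.1 + y.2.2 - 1)) s := by
    simp only [div_eq_mul_inv]
    exact hz2.mul (hS1.fun_inv hne)
  unfold mtNum
  refine (hz1.mul ((DifferentiableAt.mul (by fun_prop) hI1).add
    (DifferentiableAt.mul (by fun_prop) hI2))).add (DifferentiableAt.mul (by fun_prop)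
    ((hE1.add hE2).add (h2c.mul hq)))


/-! ### The truncated formula and agreement with the series -/

/-- The pairs (i, j) with i + j = x - 1 are sorted by i < j, i > j and i = j; the last occurs only
for odd x. -/
theorem sum_range_eq_halves {A : Type*} [AddCommMonoid A] (g : ℕ → ℕ → A) (x : ℕ) :
    ∑ i ∈ Finset.range x, g i (x - 1 - i) =
      ∑ i ∈ Finset.range (x / 2), g i (x - 1 - i) +
      ∑ i ∈ Finset.range (x / 2), g (x - 1 - i) i +
      if Odd x then g (x / 2) (x / 2) else 0 := by
  have hrefl : ∀ k : ℕ, k ≤ x → ∑ i ∈ Finset.range k, g (x - k + i) (k - 1 - i) =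
      ∑ i ∈ Finset.range k, g (x - 1 - i) i := by
    intro k hk
    rw [← Finset.sum_range_reflect]
    refine Finset.sum_congr rfl fun i hi => ?_
    have := Finset.mem_range.1 hi
    congr 1 <;> omega
  rcases Nat.even_or_odd' x with ⟨k, rfl | rfl⟩
  · have h1 : 2 * k / 2 = k := by omega
    have h2 : ¬ Odd (2 * k) := by simp
    rw [h1, if_neg h2, add_zero, ← hrefl k (by omega)]
    nth_rewrite 1 [two_mul]
    rw [Finset.sum_range_add]
    congr 1
    refine Finset.sum_congr rfl fun i hi => ?_
    have := Finset.mem_range.1 hi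
    congr 1 <;> omega
  · have h1 : (2 * k + 1) / 2 = k := by omega
    have h2 : Odd (2 * k + 1) := ⟨k, rfl⟩
    rw [h1, if_pos h2, ← hrefl k (by omega)]
    have h3 : Finset.range (2 * k + 1) = Finset.range (k + (1 + k)) := by congr 1; omega
    rw [h3, Finset.sum_range_add, Finset.sum_range_add, Finset.sum_range_one, add_assoc,
      add_comm (∑ i ∈ Finset.range k, g (2 * k + 1 - k + i) (k - 1 - i))]
    congr 1
    congr 1
    · congr 1; omega
    · refine Finset.sum_congr rfl fun i hi => ?_
      have := Finset.mem_range.1 hi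
      congr 1 <;> omega

/-- The coefficient `∑_{m + n = x + 1} m ^ (-a) * n ^ (-b)`. -/
def mtCoef (x : ℕ) (a b : ℂ) : ℂ :=
  ∑ i ∈ Finset.range x, ((i + 1 : ℕ) : ℂ) ^ (-a) * ((x - i : ℕ) : ℂ) ^ (-b)

/-- On the diagonal x = 2k + 1 and m = n = k + 1, so m + n = 2m and the term factors as 2^(-c)
m^(-(a+b+c)). This is the origin of ζ(a + b + c) in `mtNum`. -/
theorem mtCoef_mul (x : ℕ) (a b c : ℂ) :
    mtCoef x a b * ((x + 1 : ℕ) : ℂ) ^ (-c) = mtHalf x a b c + mtHalf x b a c +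
      if Odd x then 2 ^ (-c) * ((x / 2 + 1 : ℕ) : ℂ) ^ (-(a + b + c)) else 0 := by
  have h := sum_range_eq_halves (fun i j => ((i + 1 : ℕ) : ℂ) ^ (-a) * ((j + 1 : ℕ) : ℂ) ^ (-b) *
    ((x + 1 : ℕ) : ℂ) ^ (-c)) x
  have hker : ∀ (a b : ℂ) (i : ℕ), i < x → mtKer (i + 1) a b c (x + 1) =
      ((i + 1 : ℕ) : ℂ) ^ (-a) * ((x - 1 - i + 1 : ℕ) : ℂ) ^ (-b) * ((x + 1 : ℕ) : ℂ) ^ (-c) := by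
    intro a b i hi
    have e : ((x : ℝ) + 1 - ((i + 1 : ℕ) : ℝ)) = ((x - 1 - i + 1 : ℕ) : ℝ) := by
      rw [show x - 1 - i + 1 = x - i by omega, Nat.cast_sub hi.le]
      push_cast; ring
    rw [mtKer, e]
    push_cast
    rfl
  rw [mtCoef, Finset.sum_mul, mtHalf, mtHalf]
  convert h using 1
  · refine Finset.sum_congr rfl fun i hi => ?_
    have := Finset.mem_range.1 hi
    rw [show x - 1 - i + 1 = x - i by omega]
  · congr 1
    · congr 1
      · refine Finset.sum_congr rfl fun i hi => hker a b i ?_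
        have := Finset.mem_range.1 hi
        omega
      · refine Finset.sum_congr rfl fun i hi => ?_
        have := Finset.mem_range.1 hi
        rw [hker b a i (by omega)]
        ring
    · split_ifs with ho
      · obtain ⟨k, rfl⟩ := ho
        have h1 : (2 * k + 1) / 2 = k := by omega
        have hk : ((k + 1 : ℕ) : ℂ) ≠ 0 := Nat.cast_ne_zero.2 (by omega)
        have e : ((2 * k + 1 + 1 : ℕ) : ℂ) = ((2 : ℝ) : ℂ) * (((k + 1 : ℕ) : ℝ) : ℂ) := by
          push_cast; ring
        rw [h1, e, Complex.mul_cpow_ofReal_nonneg (by norm_num) (by positivity), neg_add, neg_add,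
          Complex.cpow_add _ _ hk, Complex.cpow_add _ _ hk]
        push_cast
        ring
      · rfl

theorem sum_range_two_mul_odd (d : ℕ → ℂ) (M : ℕ) :
    ∑ x ∈ Finset.range (2 * M), (if Odd x then d (x / 2) else 0) = ∑ i ∈ Finset.range M, d i := by
  induction M with
  | zero => simp
  | succ n ih =>
    rw [show 2 * (n + 1) = 2 * n + 1 + 1 by ring, Finset.sum_range_succ, Finset.sum_range_succ, ih,
      Finset.sum_range_succ, if_neg (by simp), if_pos ⟨n, rfl⟩, add_zero,
      show (2 * n + 1) / 2 = n by omega]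

/-- What the lower half sum over `m + n > 2 M` contributes after continuation. -/
def mtHalfRem (M : ℕ) (a b c : ℂ) : ℂ :=
  (mtErrSum a b c - ∑ x ∈ Finset.range (2 * M), mtHalfErr x a b c) +
  mtINum b c / (b + c - 1) * (zetaNum (a + b + c - 1) / (a + b + c - 2) -
    ∑ i ∈ Finset.range M, ((i + 1 : ℕ) : ℂ) ^ (-(a + b + c - 1))) +
  ∑ i ∈ Finset.range M, mtTail (i + 1) (2 * M : ℕ) a b c

/-- The contribution of the diagonal pairs with m + n > 2M, after continuation. -/
def mtDiagRem (M : ℕ) (a b c : ℂ) : ℂ :=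
  2 ^ (-c) * (zetaNum (a + b + c) / (a + b + c - 1) -
    ∑ i ∈ Finset.range M, ((i + 1 : ℕ) : ℂ) ^ (-(a + b + c)))

theorem mtPolar_one (a b c : ℂ) :
    mtPolar 1 (a, b, c) = (a + b + c - 2) * ((a + c - 1) * (b + c - 1)) := by
  simp [mtPolar]

/-- The truncated formula for the continued function. -/
theorem mtNum_div_mtPolar (M : ℕ) {a b c : ℂ} (h1 : a + c ≠ 1) (h2 : b + c ≠ 1)
    (h3 : a + b + c ≠ 2) :
    mtNum (a, b, c) / mtPolar 1 (a, b, c) =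
      ∑ x ∈ Finset.range (2 * M), mtCoef x a b * ((x + 1 : ℕ) : ℂ) ^ (-c) +
      (mtHalfRem M a b c + mtHalfRem M b a c + mtDiagRem M a b c) := by
  have n1 : a + c - 1 ≠ 0 := sub_ne_zero.2 h1
  have n2 : b + c - 1 ≠ 0 := sub_ne_zero.2 h2
  have n3 : a + b + c - 2 ≠ 0 := sub_ne_zero.2 h3
  have e1 : ∑ x ∈ Finset.range (2 * M), mtCoef x a b * ((x + 1 : ℕ) : ℂ) ^ (-c) =
      ∑ x ∈ Finset.range (2 * M), mtHalf x a b c + ∑ x ∈ Finset.range (2 * M), mtHalf x b a c +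
      2 ^ (-c) * ∑ i ∈ Finset.range M, ((i + 1 : ℕ) : ℂ) ^ (-(a + b + c)) := by
    rw [Finset.sum_congr rfl fun x _ => mtCoef_mul x a b c, Finset.sum_add_distrib,
      Finset.sum_add_distrib, sum_range_two_mul_odd
        (fun i => 2 ^ (-c) * ((i + 1 : ℕ) : ℂ) ^ (-(a + b + c))), Finset.mul_sum]
  have e2 : mtNum (a, b, c) / mtPolar 1 (a, b, c) =
      zetaNum (a + b + c - 1) / (a + b + c - 2) *
        (mtINum b c / (b + c - 1) + mtINum a c / (a + c - 1)) +
      (mtErrSum a b c + mtErrSum b a c + 2 ^ (-c) * (zetaNum (a + b + c) / (a + b + c - 1))) := by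
    rw [mtPolar_one, mtNum]
    simp only
    rw [add_div, mul_div_cancel_left₀ _ (mul_ne_zero n3 (mul_ne_zero n1 n2))]
    congr 1
    rw [div_add_div _ _ n2 n1, div_mul_div_comm]
    congr 1 <;> ring
  rw [e1, e2, sum_mtHalf, sum_mtHalf, mtHalfRem, mtHalfRem, mtDiagRem, add_comm b a]
  ring

theorem tendsto_mtHalfRem {a b c : ℂ} (h1 : 1 < b.re + c.re) (h2 : 2 < a.re + b.re + c.re) :
    Tendsto (fun M => mtHalfRem M a b c) atTop (nhds 0) := by
  have t2 : Tendsto (fun M : ℕ => 2 * M) atTop atTop :=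
    tendsto_id.const_mul_atTop' (by norm_num)
  have l1 : Tendsto (fun M : ℕ => mtErrSum a b c - ∑ x ∈ Finset.range (2 * M), mtHalfErr x a b c)
      atTop (nhds 0) := by
    have := ((summable_mtHalfErr (a := a) (b := b) (c := c) (by linarith)
      (by linarith)).hasSum.tendsto_sum_nat.comp t2).const_sub (mtErrSum a b c)
    rwa [mtErrSum, sub_self] at this
  have hS : a + b + c - 2 ≠ 0 := by
    intro h
    have := congrArg Complex.re h
    simp at this
    linarith
  have l2 : Tendsto (fun M : ℕ => mtINum b c / (b + c - 1) * (zetaNum (a + b + c - 1) /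
      (a + b + c - 2) - ∑ i ∈ Finset.range M, ((i + 1 : ℕ) : ℂ) ^ (-(a + b + c - 1))))
      atTop (nhds 0) := by
    have h := tendsto_zetaNum (w := a + b + c - 1) (by simp; linarith)
    rw [show a + b + c - 1 - 1 = a + b + c - 2 by ring] at h
    have h' := ((h.div_const (a + b + c - 2)).const_sub (zetaNum (a + b + c - 1) /
      (a + b + c - 2))).const_mul (mtINum b c / (b + c - 1))
    rw [sub_self, mul_zero] at h'
    refine h'.congr fun M => ?_
    rw [mul_div_cancel_left₀ _ hS]
  have l3 : Tendsto (fun M : ℕ => ∑ i ∈ Finset.range M, mtTail (i + 1) (2 * M : ℕ) a b c)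
      atTop (nhds 0) := by
    -- Each tail integral carries an extra factor 2M compared with the kernel at 2M; q > 1 still
    -- leaves decay (2M)^(1-q).
    obtain ⟨C, q, hq, hC, hb⟩ := exists_sum_rpow_mul_rpow_le (δ := b.re + c.re - 1) (α := a.re)
      (by linarith) (by linarith)
    have hbc : b + c ≠ 1 := by
      intro h
      have := congrArg Complex.re h
      simp at this
      linarith
    set D := (2 ^ |b.re| + ‖b‖ * 2 ^ |b.re + 1| / (b.re + c.re)) / ‖b + c - 1‖ with hD
    have hD0 : 0 ≤ D := by
      have : 0 < b.re + c.re := by linarith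
      positivity
    have hlim : Tendsto (fun M : ℕ => D * (C * ((2 * M : ℕ) : ℝ) ^ (-(q - 1)))) atTop (nhds 0) := by
      have h := (((tendsto_rpow_neg_atTop (by linarith : 0 < q - 1)).comp
        tendsto_natCast_atTop_atTop).comp t2)
      simpa using (h.const_mul C).const_mul D
    refine squeeze_zero_norm' ?_ hlim
    filter_upwards [eventually_ge_atTop 1] with M hM
    have hX : (0 : ℝ) < ((2 * M : ℕ) : ℝ) := by exact_mod_cast (by omega : 0 < 2 * M)
    have e1 : ∀ e : ℝ, ((2 * M : ℕ) : ℝ) ^ (1 - e) =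
        ((2 * M : ℕ) : ℝ) * ((2 * M : ℕ) : ℝ) ^ (-e) := by
      intro e
      rw [sub_eq_add_neg, Real.rpow_add hX, Real.rpow_one]
    calc ‖∑ i ∈ Finset.range M, mtTail (i + 1) (2 * M : ℕ) a b c‖
        ≤ ∑ i ∈ Finset.range M, D * (((2 * M : ℕ) : ℝ) * (((i + 1 : ℕ) : ℝ) ^ (-a.re) *
          ((2 * M : ℕ) : ℝ) ^ (-(b.re + c.re)))) := by
          refine (norm_sum_le _ _).trans (Finset.sum_le_sum fun i hi => ?_)
          have hi' := Finset.mem_range.1 hi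
          refine (norm_mtTail_le (Nat.succ_pos i) hbc (by linarith)
            (by exact_mod_cast (by omega : 2 * (i + 1) ≤ 2 * M))).trans_eq ?_
          rw [← hD, e1]
          ring
      _ = D * (((2 * M : ℕ) : ℝ) * ∑ i ∈ Finset.range (2 * M / 2), (((i + 1 : ℕ) : ℝ) ^ (-a.re) *
          ((2 * M : ℕ) : ℝ) ^ (-(b.re + c.re - 1 + 1)))) := by
          rw [← Finset.mul_sum, ← Finset.mul_sum, sub_add_cancel, show 2 * M / 2 = M by omega]
      _ ≤ D * (((2 * M : ℕ) : ℝ) * (C * ((2 * M : ℕ) : ℝ) ^ (-q))) := by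
          gcongr
          exact hb (2 * M)
      _ = D * (C * ((2 * M : ℕ) : ℝ) ^ (-(q - 1))) := by
          rw [neg_sub, e1]
          ring
  have := (l1.add l2).add l3
  simpa [mtHalfRem] using this

theorem tendsto_mtDiagRem {a b c : ℂ} (h2 : 1 < a.re + b.re + c.re) :
    Tendsto (fun M => mtDiagRem M a b c) atTop (nhds 0) := by
  have hS : a + b + c - 1 ≠ 0 := by
    intro h
    have := congrArg Complex.re h
    simp at this
    linarith
  have h := tendsto_zetaNum (w := a + b + c) (by simpa using h2)
  have h' := ((h.div_const (a + b + c - 1)).const_sub (zetaNum (a + b + c) /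
    (a + b + c - 1))).const_mul (2 ^ (-c) : ℂ)
  rw [sub_self, mul_zero] at h'
  refine h'.congr fun M => ?_
  rw [mul_div_cancel_left₀ _ hS, mtDiagRem]

theorem mtKer_natCast (i j : ℕ) (a b c : ℂ) :
    mtKer (i + 1) a b c ((i + j + 2 : ℕ) : ℝ) =
      ((i + 1 : ℕ) : ℂ) ^ (-a) * ((j + 1 : ℕ) : ℂ) ^ (-b) * ((i + j + 2 : ℕ) : ℂ) ^ (-c) := by
  have e : (((i + j + 2 : ℕ) : ℝ) - ((i + 1 : ℕ) : ℝ)) = ((j + 1 : ℕ) : ℝ) := by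
    push_cast; ring
  rw [mtKer, e]
  push_cast
  rfl

/-- Sharing the decay between m and m + n dominates the half i ≤ j of the double series by a product
of two convergent series. The other half follows by exchanging a and b. -/
theorem exists_norm_mtKer_natCast_le {a b c : ℂ} (h1 : 1 < b.re + c.re)
    (h2 : 2 < a.re + b.re + c.re) :
    ∃ C p q : ℝ, 0 ≤ C ∧ 1 < p ∧ 1 < q ∧ ∀ i j : ℕ, i ≤ j →
      ‖mtKer (i + 1) a b c ((i + j + 2 : ℕ) : ℝ)‖ ≤
        C * (((i + 1 : ℕ) : ℝ) ^ (-p) * ((j + 1 : ℕ) : ℝ) ^ (-q)) := by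
  obtain ⟨p, q, hp, hq, h⟩ := exists_rpow_mul_rpow_le (δ := b.re + c.re - 1) (α := a.re)
    (by linarith) (by linarith)
  refine ⟨2 ^ |b.re|, p, q, by positivity, hp, hq, fun i j hij => ?_⟩
  have hu : 2 * ((i + 1 : ℕ) : ℝ) ≤ ((i + j + 2 : ℕ) : ℝ) := by exact_mod_cast (by omega)
  refine (norm_mtKer_le (Nat.succ_pos i) a b c hu).trans ?_
  refine mul_le_mul_of_nonneg_left ?_ (by positivity)
  have h3 := h ((i + 1 : ℕ) : ℝ) ((i + j + 2 : ℕ) : ℝ) (by positivity)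
    (by exact_mod_cast (by omega))
  rw [sub_add_cancel] at h3
  refine h3.trans ?_
  gcongr ?_ * ?_
  exact Real.rpow_le_rpow_of_nonpos (by positivity) (by exact_mod_cast (by omega)) (by linarith)

theorem summable_mtSeries {a b c : ℂ} (h1 : 1 < a.re + c.re) (h2 : 1 < b.re + c.re)
    (h3 : 2 < a.re + b.re + c.re) :
    Summable (fun p : ℕ × ℕ => mtKer (p.1 + 1) a b c ((p.1 + p.2 + 2 : ℕ) : ℝ)) := by
  obtain ⟨C, p, q, hC, hp, hq, hb⟩ := exists_norm_mtKer_natCast_le h2 h3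
  obtain ⟨C', p', q', hC', hp', hq', hb'⟩ := exists_norm_mtKer_natCast_le (a := b) (b := a) (c := c)
    h1 (by linarith)
  have s1 := ((summable_succ_rpow_neg hp).mul_of_nonneg (summable_succ_rpow_neg hq)
    (fun i => by positivity) fun i => by positivity).mul_left C
  have s2 := ((summable_succ_rpow_neg hq').mul_of_nonneg (summable_succ_rpow_neg hp')
    (fun i => by positivity) fun i => by positivity).mul_left C'
  refine Summable.of_norm_bounded (s1.add s2) fun ij => ?_
  obtain ⟨i, j⟩ := ij
  simp only
  rcases le_total i j with h | h
  · refine (hb i j h).trans (le_add_of_nonneg_right (by positivity))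
  · refine le_add_of_nonneg_of_le (by positivity) ?_
    have e : mtKer (i + 1) a b c ((i + j + 2 : ℕ) : ℝ) =
        mtKer (j + 1) b a c ((j + i + 2 : ℕ) : ℝ) := by
      rw [mtKer_natCast, mtKer_natCast, add_comm j i]
      ring
    rw [e]
    refine (hb' j i h).trans_eq ?_
    ring

/-- Absolute convergence permits summation along antidiagonals m + n = constant. -/
theorem tendsto_sum_mtCoef {a b c : ℂ} (h1 : 1 < a.re + c.re) (h2 : 1 < b.re + c.re)
    (h3 : 2 < a.re + b.re + c.re) :
    Tendsto (fun N => ∑ x ∈ Finset.range N, mtCoef x a b * ((x + 1 : ℕ) : ℂ) ^ (-c)) atTop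
      (nhds (mtSeries (a, b, c))) := by
  have hs := (summable_mtSeries h1 h2 h3).hasSum
  have e : ∑' p : ℕ × ℕ, mtKer (p.1 + 1) a b c ((p.1 + p.2 + 2 : ℕ) : ℝ) = mtSeries (a, b, c) := by
    rw [mtSeries]
    refine tsum_congr fun p => ?_
    rw [mtKer_natCast, Complex.cpow_neg, Complex.cpow_neg, Complex.cpow_neg, one_div, mul_inv,
      mul_inv, show p.1 + 1 + (p.2 + 1) = p.1 + p.2 + 2 by ring]
  rw [e, ← Finset.HasAntidiagonal.sigmaAntidiagonalEquivProd.hasSum_iff] at hs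
  have hsig := hs.sigma fun n => hasSum_fintype _
  -- The index x = 0 stands for m + n = 1 and contributes an empty sum, hence the shift by one.
  rw [← tendsto_add_atTop_iff_nat 1]
  refine hsig.tendsto_sum_nat.congr fun N => ?_
  rw [Finset.sum_range_succ', mtCoef, Finset.range_zero, Finset.sum_empty, zero_mul, add_zero]
  refine Finset.sum_congr rfl fun n _ => ?_
  refine (Finset.sum_coe_sort (Finset.HasAntidiagonal.antidiagonal n)
    (fun p : ℕ × ℕ => mtKer (p.1 + 1) a b c ((p.1 + p.2 + 2 : ℕ) : ℝ))).trans ?_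
  rw [Finset.Nat.sum_antidiagonal_eq_sum_range_succ_mk, mtCoef, Finset.sum_mul]
  refine Finset.sum_congr rfl fun i hi => ?_
  have := Finset.mem_range.1 hi
  rw [mtKer_natCast, show n - i + 1 = n + 1 - i by omega, show i + (n - i) + 2 = n + 1 + 1 by omega]

/-- The left side of the truncated formula does not depend on M; in the region of absolute
convergence the remainders tend to 0 and the partial sums tend to the series. -/
theorem isMTContinuation_mtNum : IsMTContinuation 1 mtNum := by
  refine ⟨differentiableOn_mtNum, ?_⟩
  rintro ⟨a, b, c⟩ hs
  simp only [mtTube, Set.mem_ofPred_eq, Nat.cast_zero, sub_zero] at hs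
  obtain ⟨h1, h2, h3⟩ := hs
  have ne : ∀ {z : ℂ} {r : ℝ}, r < z.re → z ≠ r := by
    rintro z r h rfl
    simp at h
  have n1 : a + c ≠ 1 := by simpa using ne (z := a + c) (r := 1) (by simpa using h1)
  have n2 : b + c ≠ 1 := by simpa using ne (z := b + c) (r := 1) (by simpa using h2)
  have n3 : a + b + c ≠ 2 := by simpa using ne (z := a + b + c) (r := 2) (by simpa using h3)
  have t2 : Tendsto (fun M : ℕ => 2 * M) atTop atTop :=
    tendsto_id.const_mul_atTop' (by norm_num)
  have l1 := (tendsto_sum_mtCoef h1 h2 h3).comp t2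
  have l2 := ((tendsto_mtHalfRem h2 h3).add (tendsto_mtHalfRem (a := b) (b := a) (c := c) h1
    (by linarith))).add (tendsto_mtDiagRem (a := a) (b := b) (c := c) (by linarith))
  have l3 := l1.add l2
  simp only [add_zero] at l3
  have hpol : mtPolar 1 (a, b, c) ≠ 0 := by
    rw [mtPolar_one]
    exact mul_ne_zero (sub_ne_zero.2 n3) (mul_ne_zero (sub_ne_zero.2 n1) (sub_ne_zero.2 n2))
  have h4 : mtNum (a, b, c) / mtPolar 1 (a, b, c) = mtSeries (a, b, c) := by
    refine tendsto_nhds_unique (tendsto_const_nhds (f := (atTop : Filter ℕ))) (l3.congr fun M => ?_)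
    exact (mtNum_div_mtPolar M n1 n2 n3).symm
  rw [← h4, mul_div_cancel₀ _ hpol]


/-! ### Gaussian mean squares and truncated Mellin transforms -/

/-- The Fourier transform of `t ↦ exp (-b t ^ 2)`. -/
def gaussKer (b x : ℝ) : ℝ := √(Real.pi / b) * Real.exp (-x ^ 2 / (4 * b))

theorem gaussKer_nonneg (b x : ℝ) : 0 ≤ gaussKer b x := by unfold gaussKer; positivity

theorem continuous_gaussKer (b : ℝ) : Continuous (gaussKer b) := by unfold gaussKer; fun_prop

theorem integral_gaussian_mul_exp {b : ℝ} (hb : 0 < b) (x : ℝ) :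
    ∫ t : ℝ, (Real.exp (-b * t ^ 2) : ℂ) * cexp (I * t * x) = (gaussKer b x : ℂ) := by
  have h := fourierIntegral_gaussian (b := (b : ℂ)) (by simpa using hb) (x : ℂ)
  have e1 : ∫ t : ℝ, (Real.exp (-b * t ^ 2) : ℂ) * cexp (I * t * x) =
      ∫ t : ℝ, cexp (I * x * t) * cexp (-b * t ^ 2) := by
    refine integral_congr_ae (Eventually.of_forall fun t => ?_)
    simp only
    rw [mul_comm, mul_right_comm I]
    push_cast
    rfl
  rw [e1, h, gaussKer, Real.sqrt_eq_rpow]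
  push_cast
  rw [Complex.ofReal_cpow (by positivity)]
  push_cast
  rfl

theorem integrable_gaussKer {b : ℝ} (hb : 0 < b) : Integrable (gaussKer b) := by
  unfold gaussKer
  have h := integrable_exp_neg_mul_sq (b := 1 / (4 * b)) (by positivity)
  refine (h.congr (Eventually.of_forall fun x => ?_)).const_mul _
  simp only
  congr 1
  ring

/-- The mass does not depend on b. Since b will be 1/T², this makes the Mellin mean square bound
uniform in T. -/
theorem integral_gaussKer {b : ℝ} (hb : 0 < b) : ∫ x, gaussKer b x = 2 * Real.pi := by
  have e : ∀ x, gaussKer b x = √(Real.pi / b) * Real.exp (-(1 / (4 * b)) * x ^ 2) := by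
    intro x
    rw [gaussKer]
    congr 2
    ring
  simp_rw [e]
  rw [integral_const_mul, integral_gaussian, ← Real.sqrt_mul (by positivity)]
  rw [show Real.pi / b * (Real.pi / (1 / (4 * b))) = (2 * Real.pi) ^ 2 by field_simp; norm_num]
  exact Real.sqrt_sq (by positivity)

/-- The Gaussian mean square of the Fourier transform of a complex measure. -/
theorem integral_gaussian_mul_norm_sq_le {α : Type*} [MeasurableSpace α] {μ : Measure α} [SFinite μ]
    {h : α → ℂ} (hh : Integrable h μ) {l : α → ℝ} (hl : Measurable l) {b : ℝ} (hb : 0 < b) :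
    ∫ t : ℝ, Real.exp (-b * t ^ 2) * ‖∫ a, h a * cexp (I * t * l a) ∂μ‖ ^ 2 ≤
      ∫ p : α × α, ‖h p.1‖ * ‖h p.2‖ * gaussKer b (l p.1 - l p.2) ∂(μ.prod μ) := by
  set f : ℝ → ℂ := fun t => ∫ a, h a * cexp (I * t * l a) ∂μ with hf
  have hconj : ∀ t : ℝ, (starRingEnd ℂ) (f t) =
      ∫ a, (starRingEnd ℂ) (h a) * cexp (-(I * t * l a)) ∂μ := by
    intro t
    rw [hf]
    simp only
    rw [← integral_conj]
    refine integral_congr_ae (Eventually.of_forall fun a => ?_)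
    simp only
    rw [map_mul, ← Complex.exp_conj]
    simp
  have hsq : ∀ t : ℝ, ((‖f t‖ ^ 2 : ℝ) : ℂ) = ∫ p : α × α,
      h p.1 * (starRingEnd ℂ) (h p.2) * cexp (I * t * (l p.1 - l p.2 : ℝ)) ∂(μ.prod μ) := by
    intro t
    rw [← Complex.normSq_eq_norm_sq, ← Complex.mul_conj, hconj, hf]
    simp only
    rw [← integral_prod_mul]
    refine integral_congr_ae (Eventually.of_forall fun p => ?_)
    simp only
    rw [show I * (t : ℂ) * ((l p.1 - l p.2 : ℝ) : ℂ) = I * t * l p.1 + -(I * t * l p.2) by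
      push_cast; ring, Complex.exp_add]
    ring
  have hint2 : Integrable (fun p : α × α => h p.1 * (starRingEnd ℂ) (h p.2)) (μ.prod μ) :=
    hh.mul_prod (Complex.conjLIE.toContinuousLinearEquiv.integrable_comp_iff.2 hh)
  have hint3 : Integrable (fun q : ℝ × (α × α) => (Real.exp (-b * q.1 ^ 2) : ℂ) *
      (h q.2.1 * (starRingEnd ℂ) (h q.2.2))) (volume.prod (μ.prod μ)) :=
    (integrable_exp_neg_mul_sq hb).ofReal.mul_prod hint2
  have hint4 : Integrable (fun q : ℝ × (α × α) => (Real.exp (-b * q.1 ^ 2) : ℂ) *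
      (h q.2.1 * (starRingEnd ℂ) (h q.2.2)) * cexp (I * q.1 * (l q.2.1 - l q.2.2 : ℝ)))
      (volume.prod (μ.prod μ)) := by
    refine hint3.mul_bdd (c := 1) (Measurable.aestronglyMeasurable (by fun_prop))
      (Eventually.of_forall fun q => ?_)
    rw [show I * (q.1 : ℂ) * ((l q.2.1 - l q.2.2 : ℝ) : ℂ) =
      ((q.1 * (l q.2.1 - l q.2.2) : ℝ) : ℂ) * I by push_cast; ring, Complex.norm_exp_ofReal_mul_I]
  -- Fubini: for each pair of points the t-integral is the Fourier transform of the Gaussian at the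
  -- difference of the frequencies.
  have hmain : ((∫ t : ℝ, Real.exp (-b * t ^ 2) * ‖f t‖ ^ 2 : ℝ) : ℂ) =
      ∫ p : α × α, h p.1 * (starRingEnd ℂ) (h p.2) * (gaussKer b (l p.1 - l p.2) : ℂ)
        ∂(μ.prod μ) := by
    rw [← integral_complex_ofReal]
    have e1 : ∀ t : ℝ, ((Real.exp (-b * t ^ 2) * ‖f t‖ ^ 2 : ℝ) : ℂ) = ∫ p : α × α,
        (Real.exp (-b * t ^ 2) : ℂ) * (h p.1 * (starRingEnd ℂ) (h p.2)) *
          cexp (I * t * (l p.1 - l p.2 : ℝ)) ∂(μ.prod μ) := by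
      intro t
      rw [Complex.ofReal_mul, hsq, ← integral_const_mul]
      exact integral_congr_ae (Eventually.of_forall fun p => by simp only; ring)
    simp_rw [e1]
    rw [integral_integral_swap hint4]
    refine integral_congr_ae (Eventually.of_forall fun p => ?_)
    simp only
    rw [← integral_gaussian_mul_exp hb, ← integral_const_mul]
    exact integral_congr_ae (Eventually.of_forall fun t => by simp only; ring)
  have hre : ∫ t : ℝ, Real.exp (-b * t ^ 2) * ‖f t‖ ^ 2 ≤
      ‖((∫ t : ℝ, Real.exp (-b * t ^ 2) * ‖f t‖ ^ 2 : ℝ) : ℂ)‖ := by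
    rw [Complex.norm_real]
    exact Real.le_norm_self _
  refine hre.trans ?_
  rw [hmain]
  refine (norm_integral_le_integral_norm _).trans_eq ?_
  refine integral_congr_ae (Eventually.of_forall fun p => ?_)
  simp only
  rw [norm_mul, norm_mul, Complex.norm_real, Real.norm_of_nonneg (gaussKer_nonneg _ _),
    RCLike.norm_conj]

/-- The substitution x = log v turns dv/v into dx, and the kernel has total mass 2π. -/
theorem integral_inv_mul_gaussKer_le {b : ℝ} (hb : 0 < b) {N K : ℝ} (hN : 0 < N) (hNK : N ≤ K)
    (y : ℝ) : ∫ v in Set.Ioc N K, v⁻¹ * gaussKer b (y - Real.log v) ≤ 2 * Real.pi := by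
  rw [← intervalIntegral.integral_of_le hNK]
  have hsub : ∀ v ∈ Set.uIcc N K, 0 < v := by
    intro v hv
    rw [Set.uIcc_of_le hNK] at hv
    exact hN.trans_le hv.1
  have h := intervalIntegral.integral_comp_mul_deriv (a := N) (b := K) (f := Real.log)
    (f' := fun v => v⁻¹) (g := fun x => gaussKer b (y - x))
    (fun v hv => Real.hasDerivAt_log (hsub v hv).ne')
    (continuousOn_id.inv₀ fun v hv => (hsub v hv).ne')
    ((continuous_gaussKer b).comp (by fun_prop))
  have e : ∫ v in N..K, v⁻¹ * gaussKer b (y - Real.log v) =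
      ∫ x in Real.log N..Real.log K, gaussKer b (y - x) := by
    rw [← h]
    exact intervalIntegral.integral_congr fun v _ => by simp [mul_comm]
  rw [e, intervalIntegral.integral_of_le (Real.log_le_log hN hNK), ← integral_gaussKer hb,
    ← integral_sub_left_eq_self (gaussKer b) volume y]
  exact setIntegral_le_integral ((integrable_gaussKer hb).comp_sub_left y)
    (Eventually.of_forall fun x => gaussKer_nonneg _ _)

/-- By the arithmetic-geometric mean inequality u^(-σ)v^(-σ) ≤ (u^(1-2σ)v⁻¹ + v^(1-2σ)u⁻¹)/2. The
two halves have equal integrals by symmetry; in each, the variable with exponent -1 integrates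
against the kernel to at most 2π. -/
theorem integral_prod_rpow_gaussKer_le {b : ℝ} (hb : 0 < b) {N K σ : ℝ} (hN : 1 ≤ N) (hNK : N ≤ K)
    (hσ : 1 < σ) :
    ∫ p : ℝ × ℝ, p.1 ^ (-σ) * p.2 ^ (-σ) * gaussKer b (Real.log p.1 - Real.log p.2)
      ∂((volume.restrict (Set.Ioc N K)).prod (volume.restrict (Set.Ioc N K))) ≤
      2 * Real.pi * (N ^ (2 - 2 * σ) / (2 * σ - 2)) := by
  have hN0 : 0 < N := by linarith
  set μ := volume.restrict (Set.Ioc N K) with hμ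
  have hmem : ∀ᵐ u ∂μ, N < u := by
    refine (ae_restrict_iff' measurableSet_Ioc).2 (Eventually.of_forall fun u hu => hu.1)
  have hmemp : ∀ᵐ p ∂(μ.prod μ), N < p.1 ∧ N < p.2 := by
    refine (Measure.quasiMeasurePreserving_fst.ae hmem).and
      (Measure.quasiMeasurePreserving_snd.ae hmem)
  have hbd : ∀ x, gaussKer b x ≤ √(Real.pi / b) := by
    intro x
    rw [gaussKer]
    refine mul_le_of_le_one_right (by positivity) (Real.exp_le_one_iff.2 ?_)
    rw [neg_div]
    exact neg_nonpos.2 (by positivity)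
  set A : ℝ × ℝ → ℝ := fun p => p.1 ^ (1 - 2 * σ) * (p.2⁻¹ *
    gaussKer b (Real.log p.1 - Real.log p.2)) with hA
  have hgm : Measurable (gaussKer b) := (continuous_gaussKer b).measurable
  have hAint : Integrable A (μ.prod μ) := by
    refine Integrable.of_bound (C := √(Real.pi / b)) (Measurable.aestronglyMeasurable
      (by fun_prop)) ?_
    filter_upwards [hmemp] with p hp
    have h1 : p.1 ^ (1 - 2 * σ) ≤ 1 :=
      Real.rpow_le_one_of_one_le_of_nonpos (by linarith [hp.1]) (by linarith)
    have h2 : p.2⁻¹ ≤ 1 := inv_le_one_of_one_le₀ (by linarith [hp.2])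
    have p1 : 0 < p.1 := by linarith [hp.1]
    have p2 : 0 < p.2 := by linarith [hp.2]
    have h3 := gaussKer_nonneg b (Real.log p.1 - Real.log p.2)
    rw [hA]
    simp only
    rw [Real.norm_of_nonneg (by positivity)]
    calc p.1 ^ (1 - 2 * σ) * (p.2⁻¹ * gaussKer b (Real.log p.1 - Real.log p.2))
        ≤ 1 * (1 * √(Real.pi / b)) := by
          gcongr
          exact hbd _
      _ = _ := by ring
  have hA1 : ∫ p, A p ∂(μ.prod μ) ≤ 2 * Real.pi * (N ^ (2 - 2 * σ) / (2 * σ - 2)) := by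
    rw [integral_prod _ hAint]
    have hint : IntegrableOn (fun u : ℝ => u ^ (1 - 2 * σ) * (2 * Real.pi)) (Set.Ioi N) :=
      (integrableOn_Ioi_rpow_of_lt (by linarith) hN0).mul_const _
    calc ∫ u, ∫ v, A (u, v) ∂μ ∂μ ≤ ∫ u, u ^ (1 - 2 * σ) * (2 * Real.pi) ∂μ := by
          refine integral_mono_ae hAint.integral_prod_left
            (hint.mono_set Set.Ioc_subset_Ioi_self) ?_
          filter_upwards [hmem] with u hu
          have hu0 : 0 < u := hN0.trans hu
          rw [hA]
          simp only
          rw [integral_const_mul]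
          gcongr
          exact integral_inv_mul_gaussKer_le hb hN0 hNK _
      _ ≤ ∫ u in Set.Ioi N, u ^ (1 - 2 * σ) * (2 * Real.pi) := by
          refine setIntegral_mono_set hint ?_ Set.Ioc_subset_Ioi_self.eventuallyLE
          refine (ae_restrict_iff' measurableSet_Ioi).2 (Eventually.of_forall fun u hu => ?_)
          have hu0 : 0 < u := hN0.trans hu
          simp only [Pi.zero_apply]
          positivity
      _ = 2 * Real.pi * (N ^ (2 - 2 * σ) / (2 * σ - 2)) := by
          rw [integral_mul_const, integral_Ioi_rpow_of_lt (by linarith) hN0, mul_comm]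
          congr 1
          rw [show 1 - 2 * σ + 1 = 2 - 2 * σ by ring, show 2 * σ - 2 = -(2 - 2 * σ) by ring,
            div_neg, neg_div]
  have hswap : Integrable (fun p : ℝ × ℝ => A p.swap) (μ.prod μ) := hAint.swap
  have hA2 : ∫ p : ℝ × ℝ, A p.swap ∂(μ.prod μ) = ∫ p, A p ∂(μ.prod μ) := integral_prod_swap A
  calc _ ≤ ∫ p : ℝ × ℝ, (1 / 2) * (A p + A p.swap) ∂(μ.prod μ) := by
        refine integral_mono_of_nonneg ?_ ((hAint.add hswap).const_mul _) ?_
        · filter_upwards [hmemp] with p hp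
          have p1 : 0 < p.1 := by linarith [hp.1]
          have p2 : 0 < p.2 := by linarith [hp.2]
          have h3 := gaussKer_nonneg b (Real.log p.1 - Real.log p.2)
          simp only [Pi.zero_apply]
          positivity
        · filter_upwards [hmemp] with p hp
          have p1 : 0 < p.1 := by linarith [hp.1]
          have p2 : 0 < p.2 := by linarith [hp.2]
          have h3 := gaussKer_nonneg b (Real.log p.1 - Real.log p.2)
          have hsymm : gaussKer b (Real.log p.2 - Real.log p.1) =
              gaussKer b (Real.log p.1 - Real.log p.2) := by
            rw [gaussKer, gaussKer, ← neg_sub (Real.log p.1), neg_sq]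
          simp only [hA, Prod.fst_swap, Prod.snd_swap]
          rw [hsymm]
          have key : p.1 ^ (-σ) * p.2 ^ (-σ) ≤
              (1 / 2) * (p.1 ^ (1 - 2 * σ) * p.2⁻¹ + p.2 ^ (1 - 2 * σ) * p.1⁻¹) := by
            have e1 : ∀ x : ℝ, 0 < x → x ^ (1 - 2 * σ) = x * (x ^ (-σ)) ^ 2 := by
              intro x hx
              rw [sub_eq_add_neg, Real.rpow_add hx, Real.rpow_one, ← Real.rpow_natCast,
                ← Real.rpow_mul hx.le]
              congr 2
              push_cast
              ring
            rw [e1 _ p1, e1 _ p2]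
            set X := p.1 ^ (-σ)
            set Y := p.2 ^ (-σ)
            rw [← sub_nonneg]
            have : (1 / 2) * (p.1 * X ^ 2 * p.2⁻¹ + p.2 * Y ^ 2 * p.1⁻¹) - X * Y =
                (p.1 * X - p.2 * Y) ^ 2 / (2 * p.1 * p.2) := by
              field_simp
              ring
            rw [this]
            positivity
          calc _ ≤ (1 / 2) * (p.1 ^ (1 - 2 * σ) * p.2⁻¹ + p.2 ^ (1 - 2 * σ) * p.1⁻¹) *
                gaussKer b (Real.log p.1 - Real.log p.2) := by gcongr
            _ = _ := by ring
    _ = ∫ p, A p ∂(μ.prod μ) := by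
        rw [integral_const_mul, integral_add hAint hswap, hA2]
        ring
    _ ≤ _ := hA1


theorem gaussKer_neg (b x : ℝ) : gaussKer b (-x) = gaussKer b x := by
  rw [gaussKer, gaussKer, neg_sq]

theorem continuous_integral_mul_cexp {α : Type*} [MeasurableSpace α] {μ : Measure α}
    {h : α → ℂ} (hh : Integrable h μ) {l : α → ℝ} (hl : Measurable l) :
    Continuous (fun t : ℝ => ∫ a, h a * cexp (I * t * l a) ∂μ) := by
  have hn : ∀ (t : ℝ) (a : α), ‖cexp (I * t * l a)‖ = 1 := fun t a => by
    rw [show I * (t : ℂ) * (l a : ℂ) = ((t * l a : ℝ) : ℂ) * I by push_cast; ring,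
      Complex.norm_exp_ofReal_mul_I]
  refine continuous_of_dominated (bound := fun a => ‖h a‖) (fun t => ?_) (fun t => ?_) hh.norm ?_
  · exact hh.aestronglyMeasurable.mul (Measurable.aestronglyMeasurable (by fun_prop))
  · exact Eventually.of_forall fun a => by rw [norm_mul, hn, mul_one]
  · exact Eventually.of_forall fun a => by fun_prop

theorem norm_integral_mul_cexp_le {α : Type*} [MeasurableSpace α] {μ : Measure α}
    (h : α → ℂ) (l : α → ℝ) (t : ℝ) :
    ‖∫ a, h a * cexp (I * t * l a) ∂μ‖ ≤ ∫ a, ‖h a‖ ∂μ := by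
  refine (norm_integral_le_integral_norm _).trans_eq (integral_congr_ae
    (Eventually.of_forall fun a => ?_))
  simp only
  rw [norm_mul, show I * (t : ℂ) * (l a : ℂ) = ((t * l a : ℝ) : ℂ) * I by push_cast; ring,
    Complex.norm_exp_ofReal_mul_I, mul_one]

/-- A mean square bound for truncated Mellin transforms. -/
theorem integral_norm_sq_mellin_le {h : ℝ → ℂ} {N K C σ T : ℝ} (hm : Measurable h) (hN : 1 ≤ N)
    (hNK : N ≤ K) (hC : 0 ≤ C) (hσ : 1 < σ) (hb : ∀ u ∈ Set.Ioc N K, ‖h u‖ ≤ C * u ^ (-σ))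
    (hT : 2 ≤ T) :
    ∫ t in (2 : ℝ)..T, ‖∫ u in Set.Ioc N K, h u * cexp (I * t * (-Real.log u : ℝ))‖ ^ 2 ≤
      Real.exp 1 * (C ^ 2 * (2 * Real.pi * (N ^ (2 - 2 * σ) / (2 * σ - 2)))) := by
  set μ := volume.restrict (Set.Ioc N K) with hμ
  have hN0 : 0 < N := by linarith
  have hT0 : 0 < T := by linarith
  have hmem : ∀ᵐ u ∂μ, u ∈ Set.Ioc N K := ae_restrict_mem measurableSet_Ioc
  have hh : Integrable h μ := by
    refine Integrable.of_bound (C := C) hm.aestronglyMeasurable ?_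
    filter_upwards [hmem] with u hu
    refine (hb u hu).trans (mul_le_of_le_one_right hC ?_)
    exact Real.rpow_le_one_of_one_le_of_nonpos (by linarith [hu.1]) (by linarith)
  have hl : Measurable (fun u : ℝ => -Real.log u) := by fun_prop
  set f : ℝ → ℂ := fun t => ∫ u, h u * cexp (I * t * (-Real.log u : ℝ)) ∂μ with hf
  have hfc : Continuous f := continuous_integral_mul_cexp hh hl
  -- With this width the Gaussian weight is at least e⁻¹ on [2, T], whence the factor e in the
  -- bound.
  set b : ℝ := 1 / T ^ 2 with hbdef
  have hb0 : 0 < b := by positivity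
  have hmean := integral_gaussian_mul_norm_sq_le hh hl hb0
  have hint : Integrable (fun t : ℝ => Real.exp (-b * t ^ 2) * ‖f t‖ ^ 2) := by
    refine (integrable_exp_neg_mul_sq hb0).mul_bdd (c := (∫ a, ‖h a‖ ∂μ) ^ 2)
      (hfc.norm.pow 2).aestronglyMeasurable (Eventually.of_forall fun t => ?_)
    rw [norm_pow, norm_norm]
    gcongr
    exact norm_integral_mul_cexp_le h _ t
  have h1 : ∫ t in (2 : ℝ)..T, ‖f t‖ ^ 2 ≤
      Real.exp 1 * ∫ t : ℝ, Real.exp (-b * t ^ 2) * ‖f t‖ ^ 2 := by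
    rw [intervalIntegral.integral_of_le hT, ← integral_const_mul]
    refine (setIntegral_mono_on ?_ ((hint.const_mul _).integrableOn) measurableSet_Ioc
      (fun t ht => ?_)).trans (setIntegral_le_integral (hint.const_mul _)
        (Eventually.of_forall fun t => by simp only [Pi.zero_apply]; positivity))
    · exact ((hfc.norm.pow 2).integrableOn_Icc).mono_set Set.Ioc_subset_Icc_self
    · rw [← mul_assoc, ← Real.exp_add]
      refine le_mul_of_one_le_left (by positivity) (Real.one_le_exp ?_)
      have : b * t ^ 2 ≤ 1 := by
        rw [hbdef, one_div, inv_mul_le_iff₀ (by positivity), mul_one]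
        have : 0 ≤ t := by linarith [ht.1]
        gcongr
        exact ht.2
      linarith
  refine h1.trans (mul_le_mul_of_nonneg_left (hmean.trans ?_) (by positivity))
  have hker := integral_prod_rpow_gaussKer_le hb0 hN hNK hσ
  have hmemp : ∀ᵐ p ∂(μ.prod μ), p.1 ∈ Set.Ioc N K ∧ p.2 ∈ Set.Ioc N K :=
    (Measure.quasiMeasurePreserving_fst.ae hmem).and (Measure.quasiMeasurePreserving_snd.ae hmem)
  have hgm : Measurable (gaussKer b) := (continuous_gaussKer b).measurable
  calc _ ≤ ∫ p : ℝ × ℝ, C ^ 2 * (p.1 ^ (-σ) * p.2 ^ (-σ) *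
        gaussKer b (Real.log p.1 - Real.log p.2)) ∂(μ.prod μ) := by
        refine integral_mono_of_nonneg (Eventually.of_forall fun p => ?_) ?_ ?_
        · have := gaussKer_nonneg b (-Real.log p.1 - -Real.log p.2)
          simp only [Pi.zero_apply]
          positivity
        · refine Integrable.const_mul (Integrable.of_bound (C := √(Real.pi / b))
            (Measurable.aestronglyMeasurable (by fun_prop)) ?_) _
          filter_upwards [hmemp] with p hp
          have p1 : 0 < p.1 := by linarith [hp.1.1]
          have p2 : 0 < p.2 := by linarith [hp.2.1]
          have h3 := gaussKer_nonneg b (Real.log p.1 - Real.log p.2)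
          have q1 : p.1 ^ (-σ) ≤ 1 :=
            Real.rpow_le_one_of_one_le_of_nonpos (by linarith [hp.1.1]) (by linarith)
          have q2 : p.2 ^ (-σ) ≤ 1 :=
            Real.rpow_le_one_of_one_le_of_nonpos (by linarith [hp.2.1]) (by linarith)
          rw [Real.norm_of_nonneg (by positivity)]
          calc _ ≤ 1 * 1 * √(Real.pi / b) := by
                gcongr
                rw [gaussKer]
                refine mul_le_of_le_one_right (by positivity) (Real.exp_le_one_iff.2 ?_)
                rw [neg_div]
                exact neg_nonpos.2 (by positivity)
            _ = _ := by ring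
        · filter_upwards [hmemp] with p hp
          have p1 : 0 < p.1 := by linarith [hp.1.1]
          have p2 : 0 < p.2 := by linarith [hp.2.1]
          have h3 := gaussKer_nonneg b (Real.log p.1 - Real.log p.2)
          rw [show -Real.log p.1 - -Real.log p.2 = -(Real.log p.1 - Real.log p.2) by ring,
            gaussKer_neg]
          calc _ ≤ (C * p.1 ^ (-σ)) * (C * p.2 ^ (-σ)) *
                gaussKer b (Real.log p.1 - Real.log p.2) := by
                gcongr
                · exact hb _ hp.1
                · exact hb _ hp.2
            _ = _ := by ring
    _ ≤ _ := by
        rw [integral_const_mul]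
        gcongr

/-! ### Mean squares of Dirichlet polynomials -/

/-- The Dirichlet polynomial `∑ b n * n ^ (-i t)`, with `n = x + 1`. -/
def dirPoly (b : ℕ → ℂ) (N : ℕ) (t : ℝ) : ℂ :=
  ∑ x ∈ Finset.range N, b x * cexp (I * t * (-Real.log (x + 1) : ℝ))

theorem continuous_dirPoly (b : ℕ → ℂ) (N : ℕ) : Continuous (dirPoly b N) := by
  unfold dirPoly
  fun_prop

theorem norm_integral_cexp_le {θ : ℝ} (hθ : θ ≠ 0) (T : ℝ) :
    ‖∫ t in (2 : ℝ)..T, cexp (I * t * θ)‖ ≤ 2 / |θ| := by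
  have hc : I * (θ : ℂ) ≠ 0 := mul_ne_zero I_ne_zero (ofReal_ne_zero.2 hθ)
  have e : ∀ t : ℝ, cexp (I * t * θ) = cexp (I * θ * t) := fun t => by rw [mul_right_comm]
  simp_rw [e]
  rw [integral_exp_mul_complex hc, norm_div, norm_mul, Complex.norm_I, one_mul, Complex.norm_real,
    Real.norm_eq_abs]
  gcongr
  have hn : ∀ t : ℝ, ‖cexp (I * θ * t)‖ = 1 := fun t => by
    rw [show I * (θ : ℂ) * t = ((θ * t : ℝ) : ℂ) * I by push_cast; ring,
      Complex.norm_exp_ofReal_mul_I]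
  refine (norm_sub_le _ _).trans ?_
  rw [hn, hn]
  norm_num

/-- The square is multiplied out. Diagonal terms give the main term, and every other pair oscillates
with frequency log((y+1)/(x+1)), so its integral is bounded independently of T. -/
theorem abs_integral_dirPoly_sub_le (b : ℕ → ℂ) (N : ℕ) (T : ℝ) :
    |(∫ t in (2 : ℝ)..T, ‖dirPoly b N t‖ ^ 2) - (T - 2) * ∑ x ∈ Finset.range N, ‖b x‖ ^ 2| ≤
      2 * ∑ y ∈ Finset.range N, ∑ x ∈ Finset.range y,
        ‖b x‖ * ‖b y‖ * (2 / (Real.log (y + 1) - Real.log (x + 1))) := by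
  have hlog : ∀ {x y : ℕ}, x < y → Real.log ((x : ℝ) + 1) < Real.log ((y : ℝ) + 1) := by
    intro x y hxy
    exact Real.log_lt_log (by positivity) (by have : (x : ℝ) < y := by exact_mod_cast hxy
                                              linarith)
  set θ : ℕ → ℕ → ℝ := fun x y => Real.log (y + 1) - Real.log (x + 1) with hθ
  have hsq : ∀ t : ℝ, ((‖dirPoly b N t‖ ^ 2 : ℝ) : ℂ) = ∑ x ∈ Finset.range N,
      ∑ y ∈ Finset.range N, b x * (starRingEnd ℂ) (b y) * cexp (I * t * (θ x y : ℝ)) := by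
    intro t
    rw [← Complex.normSq_eq_norm_sq, ← Complex.mul_conj, dirPoly, map_sum, Finset.sum_mul_sum]
    refine Finset.sum_congr rfl fun x _ => Finset.sum_congr rfl fun y _ => ?_
    rw [map_mul, ← Complex.exp_conj, hθ,
      show I * (t : ℂ) * ((Real.log (y + 1) - Real.log (x + 1) : ℝ) : ℂ) =
        I * t * (-Real.log (x + 1) : ℝ) + (starRingEnd ℂ) (I * t * (-Real.log (y + 1) : ℝ)) by
          simp only [map_mul, Complex.conj_I, Complex.conj_ofReal]
          push_cast; ring, Complex.exp_add]
    ring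
  have hint : ((∫ t in (2 : ℝ)..T, ‖dirPoly b N t‖ ^ 2 : ℝ) : ℂ) = ∑ x ∈ Finset.range N,
      ∑ y ∈ Finset.range N, b x * (starRingEnd ℂ) (b y) *
        ∫ t in (2 : ℝ)..T, cexp (I * t * (θ x y : ℝ)) := by
    rw [← intervalIntegral.integral_ofReal]
    simp_rw [hsq]
    rw [intervalIntegral.integral_finsetSum fun x _ =>
      (Continuous.intervalIntegrable (by fun_prop) _ _)]
    refine Finset.sum_congr rfl fun x _ => ?_
    rw [intervalIntegral.integral_finsetSum fun y _ =>
      (Continuous.intervalIntegrable (by fun_prop) _ _)]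
    exact Finset.sum_congr rfl fun y _ => intervalIntegral.integral_const_mul _ _
  have hterm : ∀ x y, b x * (starRingEnd ℂ) (b y) * ∫ t in (2 : ℝ)..T, cexp (I * t * (θ x y : ℝ)) =
      (if x = y then (((T - 2) * ‖b x‖ ^ 2 : ℝ) : ℂ) else 0) +
      (if x = y then 0 else b x * (starRingEnd ℂ) (b y) *
        ∫ t in (2 : ℝ)..T, cexp (I * t * (θ x y : ℝ))) := by
    intro x y
    split_ifs with h
    · subst h
      simp only [hθ, sub_self, ofReal_zero, mul_zero, Complex.exp_zero, add_zero]
      rw [Complex.mul_conj, Complex.normSq_eq_norm_sq]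
      simp
      ring
    · rw [zero_add]
  have hdiff : (((∫ t in (2 : ℝ)..T, ‖dirPoly b N t‖ ^ 2) -
      (T - 2) * ∑ x ∈ Finset.range N, ‖b x‖ ^ 2 : ℝ) : ℂ) = ∑ x ∈ Finset.range N,
      ∑ y ∈ Finset.range N, (if x = y then 0 else b x * (starRingEnd ℂ) (b y) *
        ∫ t in (2 : ℝ)..T, cexp (I * t * (θ x y : ℝ))) := by
    rw [Complex.ofReal_sub, hint]
    rw [Finset.sum_congr rfl fun x _ => Finset.sum_congr rfl fun y _ => hterm x y]
    simp_rw [Finset.sum_add_distrib]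
    rw [Finset.sum_congr rfl fun x hx => Finset.sum_ite_eq (Finset.range N) x _]
    rw [Finset.sum_congr rfl fun x hx => if_pos hx, Finset.mul_sum]
    push_cast
    ring
  rw [← Real.norm_eq_abs, ← Complex.norm_real, hdiff]
  set g : ℕ → ℕ → ℝ := fun x y => ‖b x‖ * ‖b y‖ * (2 / θ x y) with hg
  have hbound : ∀ x y, ‖(if x = y then 0 else b x * (starRingEnd ℂ) (b y) *
      ∫ t in (2 : ℝ)..T, cexp (I * t * (θ x y : ℝ)))‖ ≤
      (if x < y then g x y else 0) + (if y < x then g y x else 0) := by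
    intro x y
    rcases lt_trichotomy x y with h | h | h
    · have h0 : 0 < θ x y := sub_pos.2 (hlog h)
      rw [if_neg h.ne, if_pos h, if_neg h.not_gt, add_zero, norm_mul, norm_mul, RCLike.norm_conj]
      have := norm_integral_cexp_le h0.ne' T
      rw [abs_of_pos h0] at this
      rw [hg]
      simp only
      gcongr
    · simp [h]
    · have h0 : 0 < θ y x := sub_pos.2 (hlog h)
      have e : θ x y = -θ y x := by simp only [hθ]; ring
      rw [if_neg h.ne', if_pos h, if_neg h.not_gt, zero_add, norm_mul, norm_mul, RCLike.norm_conj]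
      have := norm_integral_cexp_le (θ := θ x y) (by rw [e]; linarith) T
      rw [e, abs_neg, abs_of_pos h0, ← e] at this
      rw [hg]
      simp only
      rw [mul_comm ‖b y‖]
      gcongr
  have hrange : ∀ y ∈ Finset.range N, ∑ x ∈ Finset.range N, (if x < y then g x y else 0) =
      ∑ x ∈ Finset.range y, g x y := by
    intro y hy
    rw [← Finset.sum_filter]
    refine Finset.sum_congr ?_ fun _ _ => rfl
    ext x
    have := Finset.mem_range.1 hy
    simp only [Finset.mem_filter, Finset.mem_range]
    omega
  calc _ ≤ ∑ x ∈ Finset.range N, ∑ y ∈ Finset.range N,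
        ((if x < y then g x y else 0) + (if y < x then g y x else 0)) :=
        (norm_sum_le _ _).trans (Finset.sum_le_sum fun x _ => (norm_sum_le _ _).trans
          (Finset.sum_le_sum fun y _ => hbound x y))
    _ = ∑ y ∈ Finset.range N, ∑ x ∈ Finset.range N, (if x < y then g x y else 0) +
        ∑ x ∈ Finset.range N, ∑ y ∈ Finset.range N, (if y < x then g y x else 0) := by
        simp_rw [Finset.sum_add_distrib]
        rw [Finset.sum_comm]
    _ = _ := by
        rw [Finset.sum_congr rfl hrange]
        ring

/-- For j < k, 1/log(k/j) ≤ k/(k - j) = 1 + j/(k - j). The term 1 leads to ordinary power sums; in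
the other, j^(1-σ) ≤ k^(1-σ) and the harmonic sum over k - j produces the logarithm. -/
theorem exists_abs_integral_dirPoly_sub_le {b : ℕ → ℂ} {C σ : ℝ} (hC : 0 ≤ C) (h1 : 1 / 2 < σ)
    (h2 : σ < 1) (hb : ∀ x, ‖b x‖ ≤ C * ((x + 1 : ℕ) : ℝ) ^ (-σ)) :
    ∃ D : ℝ, 0 ≤ D ∧ ∀ (N : ℕ) (T : ℝ), 1 ≤ N →
      |(∫ t in (2 : ℝ)..T, ‖dirPoly b N t‖ ^ 2) - (T - 2) * ∑ x ∈ Finset.range N, ‖b x‖ ^ 2| ≤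
        D * ((N : ℝ) ^ (2 - 2 * σ) * (1 + Real.log N)) := by
  have hσ : 0 < 1 - σ := by linarith
  refine ⟨4 * C ^ 2 * (1 / (1 - σ) + 1) * (1 / (2 - 2 * σ)), by
    have : 0 < 2 - 2 * σ := by linarith
    positivity, fun N T hN => ?_⟩
  refine (abs_integral_dirPoly_sub_le b N T).trans ?_
  have hN1 : (1 : ℝ) ≤ N := by exact_mod_cast hN
  have hlogN : 0 ≤ Real.log N := Real.log_nonneg hN1
  have hinner : ∀ y ∈ Finset.range N, ∑ x ∈ Finset.range y,
      ‖b x‖ * ‖b y‖ * (2 / (Real.log (y + 1) - Real.log (x + 1))) ≤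
      2 * C ^ 2 * (((y + 1 : ℕ) : ℝ) ^ (-(2 * σ - 1)) *
        ((1 / (1 - σ) + 1) * (1 + Real.log N))) := by
    intro y hy
    have hyN := Finset.mem_range.1 hy
    set k : ℝ := ((y + 1 : ℕ) : ℝ) with hk
    have hk0 : 0 < k := by rw [hk]; positivity
    have hk' : (y : ℝ) + 1 = k := by rw [hk]; push_cast; ring
    have hkN : k ≤ N := by rw [hk]; exact_mod_cast hyN
    have hxy : ∀ x ∈ Finset.range y, ‖b x‖ * ‖b y‖ * (2 / (Real.log (y + 1) - Real.log (x + 1))) ≤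
        2 * C ^ 2 * (((x + 1 : ℕ) : ℝ) ^ (-σ) * k ^ (-σ) +
          k ^ (-(2 * σ - 1)) * ((y - 1 - x + 1 : ℕ) : ℝ)⁻¹) := by
      intro x hx
      have hxy := Finset.mem_range.1 hx
      set j : ℝ := ((x + 1 : ℕ) : ℝ) with hj
      have hj0 : 0 < j := by rw [hj]; positivity
      have hj' : (x : ℝ) + 1 = j := by rw [hj]; push_cast; ring
      have hjk : j < k := by rw [hj, hk]; exact_mod_cast (by omega : x + 1 < y + 1)
      have hd : ((y - 1 - x + 1 : ℕ) : ℝ) = k - j := by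
        rw [show y - 1 - x + 1 = y - x by omega, Nat.cast_sub hxy.le, hj, hk]
        push_cast; ring
      have hkj : 0 < k - j := by linarith
      rw [hd, hk', hj']
      have hlog : (k - j) / k ≤ Real.log k - Real.log j := by
        rw [← Real.log_div hk0.ne' hj0.ne']
        have := Real.one_sub_inv_le_log_of_pos (div_pos hk0 hj0)
        rw [inv_div] at this
        refine le_trans (le_of_eq ?_) this
        field_simp
      have h3 : 2 / (Real.log k - Real.log j) ≤ 2 * (1 + j / (k - j)) := by
        calc 2 / (Real.log k - Real.log j) ≤ 2 / ((k - j) / k) := by gcongr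
          _ = _ := by field_simp; ring
      have h4 : j ^ (-σ) * k ^ (-σ) * j ≤ k ^ (-(2 * σ - 1)) := by
        have e1 : j ^ (-σ) * j = j ^ (1 - σ) := by
          rw [sub_eq_add_neg, Real.rpow_add hj0, Real.rpow_one, mul_comm]
        have e2 : k ^ (-(2 * σ - 1)) = k ^ (1 - σ) * k ^ (-σ) := by
          rw [← Real.rpow_add hk0]; ring_nf
        rw [mul_right_comm, e1, e2]
        gcongr
      have b1 := hb x
      have b2 := hb y
      rw [← hj] at b1
      rw [← hk] at b2
      calc ‖b x‖ * ‖b y‖ * (2 / (Real.log k - Real.log j))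
          ≤ (C * j ^ (-σ)) * (C * k ^ (-σ)) * (2 * (1 + j / (k - j))) := by
            gcongr
            exact div_nonneg (by norm_num) (sub_nonneg.2 (Real.log_le_log hj0 hjk.le))
        _ = 2 * C ^ 2 * (j ^ (-σ) * k ^ (-σ) + j ^ (-σ) * k ^ (-σ) * j * (k - j)⁻¹) := by
            ring
        _ ≤ _ := by gcongr
    refine (Finset.sum_le_sum hxy).trans ?_
    rw [← Finset.mul_sum, Finset.sum_add_distrib, ← Finset.sum_mul, ← Finset.mul_sum]
    refine mul_le_mul_of_nonneg_left ?_ (by positivity)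
    have s1 : ∑ x ∈ Finset.range y, ((x + 1 : ℕ) : ℝ) ^ (-σ) ≤ 1 / (1 - σ) * k ^ (1 - σ) := by
      refine (sum_range_rpow_neg_le (by linarith) h2 y).trans ?_
      gcongr
      rw [← hk']; linarith
    have s2 : ∑ x ∈ Finset.range y, ((y - 1 - x + 1 : ℕ) : ℝ)⁻¹ ≤ 1 + Real.log N := by
      rw [Finset.sum_range_reflect (fun x => ((x + 1 : ℕ) : ℝ)⁻¹) y]
      have := harmonic_le_one_add_log y
      rw [harmonic] at this
      push_cast at this ⊢
      refine this.trans ?_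
      rcases Nat.eq_zero_or_pos y with rfl | hy0
      · simpa using hlogN
      · gcongr
    have e3 : k ^ (1 - σ) * k ^ (-σ) = k ^ (-(2 * σ - 1)) := by
      rw [← Real.rpow_add hk0]; ring_nf
    calc _ ≤ (1 / (1 - σ) * k ^ (1 - σ)) * k ^ (-σ) + k ^ (-(2 * σ - 1)) * (1 + Real.log N) := by
          gcongr
      _ = k ^ (-(2 * σ - 1)) * (1 / (1 - σ) * 1 + 1 * (1 + Real.log N)) := by rw [← e3]; ring
      _ ≤ k ^ (-(2 * σ - 1)) * (1 / (1 - σ) * (1 + Real.log N) + 1 * (1 + Real.log N)) := by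
          gcongr
          linarith
      _ = _ := by ring
  calc _ ≤ 2 * ∑ y ∈ Finset.range N, 2 * C ^ 2 * (((y + 1 : ℕ) : ℝ) ^ (-(2 * σ - 1)) *
        ((1 / (1 - σ) + 1) * (1 + Real.log N))) := by
        gcongr with y hy
        exact hinner y hy
    _ = 4 * C ^ 2 * ((1 / (1 - σ) + 1) * (1 + Real.log N)) *
        ∑ y ∈ Finset.range N, ((y + 1 : ℕ) : ℝ) ^ (-(2 * σ - 1)) := by
        rw [← Finset.mul_sum, ← Finset.sum_mul]; ring
    _ ≤ 4 * C ^ 2 * ((1 / (1 - σ) + 1) * (1 + Real.log N)) *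
        (1 / (1 - (2 * σ - 1)) * (N : ℝ) ^ (1 - (2 * σ - 1))) := by
        gcongr
        exact sum_range_rpow_neg_le (by linarith) (by linarith) N
    _ = _ := by
        rw [show 1 - (2 * σ - 1) = 2 - 2 * σ by ring]; ring


/-! ### Euler-Maclaurin errors as Mellin transforms -/

theorem sum_range_half_rpow_le {α δ : ℝ} (h0 : 0 ≤ α) (h1 : α < 1) {x : ℕ} {u : ℝ}
    (hu : 0 < u) (hx : (x : ℝ) ≤ u) :
    ∑ i ∈ Finset.range (x / 2), ((i + 1 : ℕ) : ℝ) ^ (-α) * u ^ (-(δ + 1)) ≤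
      1 / (1 - α) * u ^ (-(α + δ)) := by
  have hα : 0 < 1 - α := by linarith
  rw [← Finset.sum_mul]
  have e : u ^ (-(α + δ)) = u ^ (1 - α) * u ^ (-(δ + 1)) := by
    rw [← Real.rpow_add hu]; ring_nf
  have h2 : ((x / 2 : ℕ) : ℝ) ≤ u :=
    le_trans (by exact_mod_cast Nat.div_le_self x 2) hx
  calc _ ≤ (1 / (1 - α) * ((x / 2 : ℕ) : ℝ) ^ (1 - α)) * u ^ (-(δ + 1)) := by
        gcongr
        exact sum_range_rpow_neg_le h0 h1 _
    _ ≤ (1 / (1 - α) * u ^ (1 - α)) * u ^ (-(δ + 1)) := by gcongr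
    _ = _ := by rw [e]; ring

/-- The two pieces of `mtHalfErr` coming from the two terms of `mtKerDeriv`. -/
def mtErrPart (x : ℕ) (a b c : ℂ) : ℂ :=
  ∑ i ∈ Finset.range (x / 2), ∫ u in (x : ℝ)..(x + 1 : ℝ), ((u - x : ℝ) : ℂ) *
    mtKer (i + 1) a b c u

/-- Separates the part with the fixed coefficient b, for which absolute values suffice, from the
part with coefficient c, which grows with t₃ and needs a mean square estimate. -/
theorem mtHalfErr_eq (x : ℕ) (a b c : ℂ) :
    mtHalfErr x a b c = -(b * mtErrPart x a (b + 1) c) - c * mtErrPart x a b (c + 1) := by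
  rw [mtHalfErr, mtErrPart, mtErrPart, Finset.mul_sum, Finset.mul_sum, ← Finset.sum_neg_distrib,
    ← Finset.sum_sub_distrib]
  refine Finset.sum_congr rfl fun i hi => ?_
  have hi' := Finset.mem_range.1 hi
  have hix : i + 1 < x := by omega
  have hix' : ((i + 1 : ℕ) : ℝ) < x := by exact_mod_cast hix
  have hint : ∀ b c : ℂ, IntervalIntegrable (fun u : ℝ => ((u - x : ℝ) : ℂ) *
      mtKer (i + 1) a b c u) volume x (x + 1) := fun b c =>
    (intervalIntegrable_mtKer a b c hix' (by linarith)).continuousOn_mul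
      (Continuous.continuousOn (by fun_prop))
  rw [mtErr_eq_integral hix, ← intervalIntegral.integral_const_mul,
    ← intervalIntegral.integral_const_mul, ← intervalIntegral.integral_neg,
    ← intervalIntegral.integral_sub (f := fun u : ℝ => -(b * (((u - x : ℝ) : ℂ) *
      mtKer (i + 1) a (b + 1) c u))) ((hint _ _).const_mul _).neg ((hint _ _).const_mul _)]
  refine intervalIntegral.integral_congr fun u _ => ?_
  simp only [mtKerDeriv]
  ring

theorem norm_mtErrPart_le {a b c : ℂ} (h0 : 0 ≤ a.re) (h1 : a.re < 1) (hbc : 1 ≤ b.re + c.re)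
    (x : ℕ) : ‖mtErrPart x a b c‖ ≤
      2 ^ |b.re| / (1 - a.re) * (x : ℝ) ^ (-(a.re + b.re + c.re - 1)) := by
  rcases Nat.eq_zero_or_pos x with rfl | hx0
  · have : 0 < 1 - a.re := by linarith
    simp only [mtErrPart, Nat.zero_div, Finset.range_zero, Finset.sum_empty, norm_zero]
    positivity
  have hx : (0 : ℝ) < x := by exact_mod_cast hx0
  have h := sum_range_half_rpow_le (δ := b.re + c.re - 1) h0 h1 hx le_rfl
  rw [sub_add_cancel] at h
  calc ‖mtErrPart x a b c‖ ≤ ∑ i ∈ Finset.range (x / 2), 2 ^ |b.re| * (((i + 1 : ℕ) : ℝ) ^ (-a.re) *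
        (x : ℝ) ^ (-(b.re + c.re))) := by
        refine (norm_sum_le _ _).trans (Finset.sum_le_sum fun i hi => ?_)
        have hi' := Finset.mem_range.1 hi
        have hix : 2 * ((i + 1 : ℕ) : ℝ) ≤ x := by exact_mod_cast (by omega : 2 * (i + 1) ≤ x)
        have hI := intervalIntegral.norm_integral_le_of_norm_le_const (a := (x : ℝ)) (b := x + 1)
          (f := fun u : ℝ => ((u - x : ℝ) : ℂ) * mtKer (i + 1) a b c u)
          (C := 2 ^ |b.re| * (((i + 1 : ℕ) : ℝ) ^ (-a.re) * (x : ℝ) ^ (-(b.re + c.re))))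
          (fun u hu => ?_)
        · simpa using hI
        · rw [Set.uIoc_of_le (by linarith)] at hu
          rw [norm_mul, Complex.norm_real, Real.norm_eq_abs, abs_of_pos (by linarith [hu.1])]
          have h1 := norm_mtKer_le (Nat.succ_pos i) a b c (u := u) (by linarith [hu.1])
          have h2 : u ^ (-(b.re + c.re)) ≤ (x : ℝ) ^ (-(b.re + c.re)) :=
            Real.rpow_le_rpow_of_nonpos hx hu.1.le (by linarith)
          calc (u - x) * ‖mtKer (i + 1) a b c u‖ ≤ 1 * ‖mtKer (i + 1) a b c u‖ := by
                gcongr; linarith [hu.2]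
            _ ≤ _ := by
                rw [one_mul]
                refine h1.trans ?_
                gcongr
    _ ≤ 2 ^ |b.re| * (1 / (1 - a.re) * (x : ℝ) ^ (-(a.re + (b.re + c.re - 1)))) := by
        rw [← Finset.mul_sum]
        gcongr
    _ = _ := by
        rw [show a.re + (b.re + c.re - 1) = a.re + b.re + c.re - 1 by ring]
        ring

/-- The function on `(N, K]` whose Mellin transform is the second part of the error terms. -/
def mtMellin (N K : ℕ) (a b : ℂ) (c : ℝ) (u : ℝ) : ℂ :=
  ∑ x ∈ Finset.Ico N K, (Set.Ioc (x : ℝ) (x + 1)).indicator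
    (fun u : ℝ => ((u - x : ℝ) : ℂ) * ∑ i ∈ Finset.range (x / 2), mtKer (i + 1) a b c u) u

theorem measurable_mtKer (m : ℕ) (a b c : ℂ) : Measurable (mtKer m a b c) := by
  unfold mtKer
  fun_prop

theorem measurable_mtMellin (N K : ℕ) (a b : ℂ) (c : ℝ) : Measurable (mtMellin N K a b c) := by
  unfold mtMellin
  refine Finset.measurable_fun_sum _ fun x _ => Measurable.indicator ?_ measurableSet_Ioc
  have h := fun i => measurable_mtKer i a b c
  fun_prop

theorem norm_mtMellin_le {N K : ℕ} (hN : 1 ≤ N) {a b : ℂ} {c : ℝ} (h0 : 0 ≤ a.re) (h1 : a.re < 1)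
    {u : ℝ} (hu : u ∈ Set.Ioc (N : ℝ) K) :
    ‖mtMellin N K a b c u‖ ≤ 2 ^ |b.re| / (1 - a.re) * u ^ (-(a.re + b.re + c - 1)) := by
  have hN' : (1 : ℝ) ≤ N := by exact_mod_cast hN
  have hu0 : 0 < u := by linarith [hu.1]
  have hc : 0 < ⌈u⌉₊ := Nat.ceil_pos.2 hu0
  -- The unique integer with x < u ≤ x + 1: the half-open intervals are disjoint, so a single term
  -- of the sum is nonzero at u.
  set x := ⌈u⌉₊ - 1 with hx
  have hx1 : ⌈u⌉₊ = x + 1 := by omega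
  have hxu : (x : ℝ) < u := Nat.lt_ceil.1 (by omega)
  have hux : u ≤ x + 1 := by
    have := Nat.le_ceil u
    rw [hx1] at this
    exact_mod_cast this
  have hNx : N ≤ x := by
    have : N < ⌈u⌉₊ := Nat.lt_ceil.2 hu.1
    omega
  have hxK : x < K := by
    have : ⌈u⌉₊ ≤ K := Nat.ceil_le.2 hu.2
    omega
  have hval : mtMellin N K a b c u =
      ((u - x : ℝ) : ℂ) * ∑ i ∈ Finset.range (x / 2), mtKer (i + 1) a b c u := by
    rw [mtMellin, Finset.sum_eq_single x]
    · exact Set.indicator_of_mem (Set.mem_Ioc.2 ⟨hxu, hux⟩) _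
    · intro y _ hyx
      refine Set.indicator_of_notMem (fun hy => hyx ?_) _
      have h2 : (y : ℝ) < x + 1 := hy.1.trans_le hux
      have h3 : (x : ℝ) < y + 1 := hxu.trans_le hy.2
      have h4 : y < x + 1 := by exact_mod_cast h2
      have h5 : x < y + 1 := by exact_mod_cast h3
      omega
    · exact fun h => absurd (Finset.mem_Ico.2 ⟨hNx, hxK⟩) h
  have h := sum_range_half_rpow_le (δ := b.re + c - 1) h0 h1 hu0 hxu.le
  rw [sub_add_cancel] at h
  rw [hval, norm_mul, Complex.norm_real, Real.norm_eq_abs, abs_of_pos (by linarith)]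
  calc (u - x) * ‖∑ i ∈ Finset.range (x / 2), mtKer (i + 1) a b c u‖
      ≤ 1 * ∑ i ∈ Finset.range (x / 2), 2 ^ |b.re| *
        (((i + 1 : ℕ) : ℝ) ^ (-a.re) * u ^ (-(b.re + c))) := by
        gcongr
        · linarith
        · refine (norm_sum_le _ _).trans (Finset.sum_le_sum fun i hi => ?_)
          have hi' := Finset.mem_range.1 hi
          have hix : 2 * ((i + 1 : ℕ) : ℝ) ≤ x := by exact_mod_cast (by omega : 2 * (i + 1) ≤ x)
          simpa using norm_mtKer_le (Nat.succ_pos i) a b c (u := u) (by linarith)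
    _ ≤ 2 ^ |b.re| * (1 / (1 - a.re) * u ^ (-(a.re + (b.re + c - 1)))) := by
        rw [one_mul, ← Finset.mul_sum]
        gcongr
    _ = _ := by
        rw [show a.re + (b.re + c - 1) = a.re + b.re + c - 1 by ring]
        ring

theorem mtKer_add_mul_I {m : ℕ} (a b c : ℂ) (t : ℝ) {u : ℝ} (hu : 0 < u) :
    mtKer m a b (c + t * I) u = mtKer m a b c u * cexp (I * t * (-Real.log u : ℝ)) := by
  have hu' : (u : ℂ) ≠ 0 := ofReal_ne_zero.2 hu.ne'
  rw [mtKer, mtKer, neg_add, Complex.cpow_add _ _ hu', ← mul_assoc]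
  congr 1
  rw [Complex.cpow_def_of_ne_zero hu', ← Complex.ofReal_log hu.le]
  congr 1
  push_cast
  ring

/-- The imaginary part t enters the kernel only through u^(-it), so a finite block of error parts is
a single oscillatory integral with a t-independent density. -/
theorem integral_mtMellin (N K : ℕ) (a b : ℂ) (c t : ℝ) :
    ∫ u in Set.Ioc (N : ℝ) K, mtMellin N K a b c u * cexp (I * t * (-Real.log u : ℝ)) =
      ∑ x ∈ Finset.Ico N K, mtErrPart x a b (c + t * I) := by
  have hterm : ∀ x ∈ Finset.Ico N K, ∀ u : ℝ, (Set.Ioc (x : ℝ) (x + 1)).indicator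
      (fun u : ℝ => ((u - x : ℝ) : ℂ) * ∑ i ∈ Finset.range (x / 2), mtKer (i + 1) a b c u) u *
        cexp (I * t * (-Real.log u : ℝ)) =
      (Set.Ioc (x : ℝ) (x + 1)).indicator (fun u : ℝ => ∑ i ∈ Finset.range (x / 2),
        ((u - x : ℝ) : ℂ) * mtKer (i + 1) a b (c + t * I) u) u := by
    intro x hx u
    by_cases hu : u ∈ Set.Ioc (x : ℝ) (x + 1)
    · have hx0 : (0 : ℝ) ≤ x := Nat.cast_nonneg x
      rw [Set.indicator_of_mem hu, Set.indicator_of_mem hu, Finset.mul_sum, Finset.sum_mul]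
      refine Finset.sum_congr rfl fun i _ => ?_
      rw [mtKer_add_mul_I a b c t (by linarith [hu.1])]
      ring
    · rw [Set.indicator_of_notMem hu, Set.indicator_of_notMem hu, zero_mul]
  have hint : ∀ x ∈ Finset.Ico N K, ∀ i ∈ Finset.range (x / 2), IntegrableOn (fun u : ℝ =>
      ((u - x : ℝ) : ℂ) * mtKer (i + 1) a b (c + t * I) u) (Set.Ioc (x : ℝ) (x + 1)) := by
    intro x hx i hi
    have hi' := Finset.mem_range.1 hi
    have hix : ((i + 1 : ℕ) : ℝ) < x := by exact_mod_cast (by omega : i + 1 < x)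
    rw [← intervalIntegrable_iff_integrableOn_Ioc_of_le (by linarith)]
    exact (intervalIntegrable_mtKer a b _ hix (by linarith)).continuousOn_mul
      (Continuous.continuousOn (by fun_prop))
  simp_rw [mtMellin, Finset.sum_mul]
  rw [integral_finsetSum]
  · refine Finset.sum_congr rfl fun x hx => ?_
    have hx' := Finset.mem_Ico.1 hx
    have hsub : Set.Ioc (x : ℝ) (x + 1) ⊆ Set.Ioc (N : ℝ) K := by
      refine Set.Ioc_subset_Ioc (by exact_mod_cast hx'.1) ?_
      exact_mod_cast (by omega : x + 1 ≤ K)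
    rw [integral_congr_ae (Eventually.of_forall (hterm x hx)),
      setIntegral_indicator measurableSet_Ioc, Set.inter_eq_right.2 hsub,
      integral_finsetSum _ (hint x hx), mtErrPart]
    refine Finset.sum_congr rfl fun i _ => ?_
    rw [intervalIntegral.integral_of_le (by linarith)]
  · intro x hx
    refine Integrable.congr ?_ (Eventually.of_forall fun u => (hterm x hx u).symm)
    refine IntegrableOn.integrable_indicator ?_ measurableSet_Ioc
    exact integrable_finsetSum _ fun i hi => (hint x hx i hi).mono_measure
      Measure.restrict_le_self


/-! ### Bounds for the remainders on a vertical line -/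

theorem add_mul_I_re (c t : ℝ) : ((c : ℂ) + t * I).re = c := by simp

theorem norm_add_mul_I_le {c t : ℝ} (hc : 0 ≤ c) (ht : 0 ≤ t) : ‖(c : ℂ) + t * I‖ ≤ c + t := by
  refine (norm_add_le _ _).trans_eq ?_
  rw [norm_mul, Complex.norm_I, mul_one, Complex.norm_real, Complex.norm_real,
    Real.norm_of_nonneg hc, Real.norm_of_nonneg ht]

theorem le_norm_of_le_im {z : ℂ} {t : ℝ} (h : t ≤ z.im) : t ≤ ‖z‖ :=
  h.trans ((le_abs_self _).trans (Complex.abs_im_le_norm z))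

theorem ne_ofReal_of_im_pos {z : ℂ} (h : 0 < z.im) (r : ℝ) : z ≠ r := by
  rintro rfl
  simp at h

/-- Since Im b ≥ 0, the denominator b + c + it - 1 has imaginary part at least t. Summing m^(-a)
over m ≤ M then costs M^(1 - Re a). -/
theorem exists_norm_sum_mtTail_le {a b : ℂ} {c : ℝ} (ha : 0 ≤ a.re) (ha1 : a.re < 1)
    (hb : 0 ≤ b.re) (hbi : 0 ≤ b.im) (hc : 0 < c) :
    ∃ C : ℝ, 0 ≤ C ∧ (∀ M : ℕ, 1 ≤ M → ∀ t : ℝ, 2 ≤ t →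
      ‖∑ i ∈ Finset.range M, mtTail (i + 1) (2 * M : ℕ) a b (c + t * I)‖ ≤
        C * ((M : ℝ) ^ (2 - (a.re + b.re + c)) / t)) ∧
      ∀ t : ℝ, 2 ≤ t → ‖mtINum b (c + t * I) / (b + (c + t * I) - 1)‖ ≤ C / t := by
  set D : ℝ := 2 ^ |b.re| + ‖b‖ * 2 ^ |b.re + 1| / (b.re + c) with hD
  have hbc : 0 < b.re + c := by linarith
  have hD0 : 0 ≤ D := by positivity
  have hα : 0 < 1 - a.re := by linarith
  have himt : ∀ t : ℝ, 2 ≤ t → t ≤ (b + (c + t * I) - 1).im := by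
    intro t ht
    simp
    linarith
  have htail : ∀ (m : ℕ) (a : ℂ) (X t : ℝ), 0 < m → 2 * (m : ℝ) ≤ X → 2 ≤ t →
      ‖mtTail m X a b (c + t * I)‖ ≤ D / t * ((m : ℝ) ^ (-a.re) * X ^ (1 - (b.re + c))) := by
    intro m a X t hm hX ht
    have hm' : (0 : ℝ) < m := by exact_mod_cast hm
    have hX0 : 0 < X := by linarith
    have h1 : b + (c + t * I) ≠ 1 := by
      have := ne_ofReal_of_im_pos (z := b + (c + t * I)) (by simp; linarith) 1
      simpa using this
    have h := norm_mtTail_le hm (a := a) (b := b) (c := c + t * I) h1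
      (by rw [add_mul_I_re]; exact hbc) hX
    rw [add_mul_I_re] at h
    refine h.trans ?_
    have := le_norm_of_le_im (himt t ht)
    gcongr
  refine ⟨D * 2 ^ |1 - (b.re + c)| * (1 / (1 - a.re) + 1), by positivity, fun M hM t ht => ?_,
    fun t ht => ?_⟩
  · have hM' : (0 : ℝ) < M := by exact_mod_cast hM
    have ht0 : 0 < t := by linarith
    have e1 : (((2 * M : ℕ) : ℝ)) ^ (1 - (b.re + c)) ≤
        2 ^ |1 - (b.re + c)| * (M : ℝ) ^ (1 - (b.re + c)) := by
      push_cast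
      rw [Real.mul_rpow (by norm_num) hM'.le]
      gcongr
      · norm_num
      · exact le_abs_self _
    calc _ ≤ ∑ i ∈ Finset.range M, D / t * (((i + 1 : ℕ) : ℝ) ^ (-a.re) *
          ((2 * M : ℕ) : ℝ) ^ (1 - (b.re + c))) := by
          refine (norm_sum_le _ _).trans (Finset.sum_le_sum fun i hi => ?_)
          have := Finset.mem_range.1 hi
          exact htail _ a _ t (Nat.succ_pos i)
            (by exact_mod_cast (by omega : 2 * (i + 1) ≤ 2 * M)) ht
      _ = D / t * ((∑ i ∈ Finset.range M, ((i + 1 : ℕ) : ℝ) ^ (-a.re)) *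
          ((2 * M : ℕ) : ℝ) ^ (1 - (b.re + c))) := by
          rw [← Finset.mul_sum, ← Finset.sum_mul]
      _ ≤ D / t * ((1 / (1 - a.re) * (M : ℝ) ^ (1 - a.re)) *
          (2 ^ |1 - (b.re + c)| * (M : ℝ) ^ (1 - (b.re + c)))) := by
          gcongr
          exact sum_range_rpow_neg_le ha ha1 M
      _ = D * 2 ^ |1 - (b.re + c)| * (1 / (1 - a.re)) *
          ((M : ℝ) ^ (2 - (a.re + b.re + c)) / t) := by
          rw [show 2 - (a.re + b.re + c) = (1 - a.re) + (1 - (b.re + c)) by ring,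
            Real.rpow_add hM']
          ring
      _ ≤ _ := by
          gcongr
          linarith
  · have ht0 : 0 < t := by linarith
    -- For m = 1 and X = 2 the subtracted integral in `mtTail` has equal endpoints, so the tail
    -- bound applies to this factor as well.
    have e : mtINum b (c + t * I) / (b + (c + t * I) - 1) = mtTail 1 2 0 b (c + t * I) := by
      rw [mtTail]
      simp
    rw [e]
    have h := htail 1 0 2 t one_pos (by norm_num) ht
    simp only [Nat.cast_one, Real.one_rpow, one_mul] at h
    refine h.trans ?_
    calc D / t * 2 ^ (1 - (b.re + c)) ≤ D / t * 2 ^ |1 - (b.re + c)| := by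
          gcongr
          · norm_num
          · exact le_abs_self _
      _ = D * 2 ^ |1 - (b.re + c)| * 1 / t := by ring
      _ ≤ _ := by
          gcongr
          have : 0 < 1 / (1 - a.re) := by positivity
          linarith

/-- The tail of the series of the zeta-function at `w`, after continuation. -/
theorem norm_zetaNum_div_sub_le {w : ℂ} (hw : 0 < w.re) {t : ℝ} (ht : 0 < t) (hwt : t ≤ w.im)
    {M : ℕ} (hM : 1 ≤ M) :
    ‖zetaNum w / (w - 1) - ∑ i ∈ Finset.range M, ((i + 1 : ℕ) : ℂ) ^ (-w)‖ ≤
      (M : ℝ) ^ (1 - w.re) / t + ‖w‖ * (2 ^ (w.re + 1) / w.re * (M : ℝ) ^ (-w.re)) := by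
  have him : t ≤ (w - 1).im := by simpa using hwt
  have hn : t ≤ ‖w - 1‖ := le_norm_of_le_im him
  have hpos : 0 < ‖w - 1‖ := ht.trans_le hn
  have hne : w - 1 ≠ 0 := norm_pos_iff.1 hpos
  have h := norm_zetaNum_sub_le hw hM
  have e : zetaNum w / (w - 1) - ∑ i ∈ Finset.range M, ((i + 1 : ℕ) : ℂ) ^ (-w) =
      (M : ℂ) ^ (1 - w) / (w - 1) + (zetaNum w - (w - 1) * ∑ i ∈ Finset.range M,
        ((i + 1 : ℕ) : ℂ) ^ (-w) - (M : ℂ) ^ (1 - w)) / (w - 1) := by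
    field_simp
    ring
  rw [e]
  refine (norm_add_le _ _).trans (add_le_add ?_ ?_)
  · rw [norm_div, Complex.norm_natCast_cpow_of_pos (by omega)]
    simp only [sub_re, one_re]
    gcongr
  · rw [norm_div, div_le_iff₀ hpos]
    refine h.trans_eq ?_
    ring

/-- The growing part is not estimated pointwise but recorded as t Q(t), where Q is the modulus of a
truncated Mellin transform with controlled mean square. Q may depend on M and T, while C may not. -/
theorem exists_norm_mtHalfErr_rem_le {a b : ℂ} {c : ℝ} (ha : 0 ≤ a.re) (ha1 : a.re < 1)
    (hc : 0 < c) (hσ : 1 < a.re + b.re + c) :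
    ∃ C : ℝ, 0 ≤ C ∧ ∀ M : ℕ, 1 ≤ M → ∀ T : ℝ, 2 ≤ T → ∃ Q : ℝ → ℝ, Continuous Q ∧
      (∫ t in (2 : ℝ)..T, Q t ^ 2) ≤ C * (M : ℝ) ^ (2 - 2 * (a.re + b.re + c)) ∧
      ∀ t ∈ Set.Icc 2 T, 0 ≤ Q t ∧
        ‖mtErrSum a b (c + t * I) - ∑ x ∈ Finset.range (2 * M), mtHalfErr x a b (c + t * I)‖ ≤
        C * (M : ℝ) ^ (1 - (a.re + b.re + c)) + C * (t * Q t) := by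
  set σ := a.re + b.re + c with hσd
  have hα : 0 < 1 - a.re := by linarith
  set A : ℝ := 2 ^ |b.re + 1| / (1 - a.re) + 2 ^ |b.re| / (1 - a.re) with hA
  have hA0 : 0 ≤ A := by positivity
  have hA1 : 2 ^ |b.re + 1| / (1 - a.re) ≤ A := by
    rw [hA]; exact le_add_of_nonneg_right (by positivity)
  have hA2 : 2 ^ |b.re| / (1 - a.re) ≤ A := by
    rw [hA]; exact le_add_of_nonneg_left (by positivity)
  set S : ℝ := 2 ^ σ / (σ - 1) with hS
  have hS0 : 0 ≤ S := div_nonneg (by positivity) (by linarith)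
  have hp1 : ∀ (t : ℝ) (x : ℕ), ‖mtErrPart x a (b + 1) (c + t * I)‖ ≤ A * (x : ℝ) ^ (-σ) := by
    intro t x
    have h := norm_mtErrPart_le (a := a) (b := b + 1) (c := c + t * I) ha ha1
      (by simp only [add_re, one_re]; simp; linarith) x
    rw [add_mul_I_re] at h
    simp only [add_re, one_re] at h
    rw [show a.re + (b.re + 1) + c - 1 = σ by rw [hσd]; ring] at h
    exact h.trans (by gcongr)
  have hp2 : ∀ (t : ℝ) (x : ℕ), ‖mtErrPart x a b (c + t * I + 1)‖ ≤ A * (x : ℝ) ^ (-σ) := by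
    intro t x
    have hre : ((c : ℂ) + t * I + 1).re = c + 1 := by simp
    have h := norm_mtErrPart_le (a := a) (b := b) (c := c + t * I + 1) ha ha1
      (by rw [hre]; linarith) x
    rw [hre, show a.re + b.re + (c + 1) - 1 = σ by rw [hσd]; ring] at h
    exact h.trans (by gcongr)
  have herr : ∀ (t : ℝ), 0 ≤ t → ∀ x : ℕ, ‖mtHalfErr x a b (c + t * I)‖ ≤
      A * (‖b‖ + (c + t)) * (x : ℝ) ^ (-σ) := by
    intro t ht x
    rw [mtHalfErr_eq]
    calc _ ≤ ‖b‖ * ‖mtErrPart x a (b + 1) (c + t * I)‖ +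
          ‖(c : ℂ) + t * I‖ * ‖mtErrPart x a b (c + t * I + 1)‖ := by
          rw [← norm_mul, ← norm_mul, ← norm_neg (b * _)]
          exact norm_sub_le _ _
      _ ≤ ‖b‖ * (A * (x : ℝ) ^ (-σ)) + (c + t) * (A * (x : ℝ) ^ (-σ)) := by
          gcongr
          · exact hp1 t x
          · exact norm_add_mul_I_le hc.le ht
          · exact hp2 t x
      _ = _ := by ring
  set C : ℝ := (‖b‖ * A * S + 1) + (c + 1) +
    Real.exp 1 * (A ^ 2 * (2 * Real.pi * (1 / (2 * σ - 2)))) with hC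
  have hσ2 : 0 < 2 * σ - 2 := by linarith
  have hG0 : 0 ≤ Real.exp 1 * (A ^ 2 * (2 * Real.pi * (1 / (2 * σ - 2)))) := by positivity
  have hB0 : 0 ≤ ‖b‖ * A * S + 1 := by positivity
  refine ⟨C, by rw [hC]; positivity, fun M hM T hT => ?_⟩
  have hM' : (0 : ℝ) < M := by exact_mod_cast hM
  have h2M : ∀ e : ℝ, e ≤ 0 → ((2 * M : ℕ) : ℝ) ^ e ≤ (M : ℝ) ^ e := fun e he =>
    Real.rpow_le_rpow_of_nonpos hM' (by exact_mod_cast (by omega : M ≤ 2 * M)) he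
  -- Beyond K, chosen in terms of M and T, the trivial bound is already good enough for all t ≤ T.
  -- The Mellin estimate over (2M, K] does not depend on K, so this choice costs nothing.
  obtain ⟨K, hK2, hK⟩ : ∃ K : ℕ, 2 * M ≤ K ∧
      A * (‖b‖ + (c + T)) * (S * (K : ℝ) ^ (1 - σ)) ≤ (M : ℝ) ^ (1 - σ) := by
    have hlim : Tendsto (fun K : ℕ => A * (‖b‖ + (c + T)) * (S * (K : ℝ) ^ (1 - σ))) atTop
        (nhds 0) := by
      have h := (tendsto_rpow_neg_atTop (by linarith : 0 < σ - 1)).comp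
        tendsto_natCast_atTop_atTop
      rw [neg_sub] at h
      simpa using (h.const_mul S).const_mul (A * (‖b‖ + (c + T)))
    have hev := hlim.eventually_le_const (by positivity : (0 : ℝ) < (M : ℝ) ^ (1 - σ))
    exact ((eventually_ge_atTop (2 * M)).and hev).exists
  set h : ℝ → ℂ := mtMellin (2 * M) K a b (c + 1 : ℝ) with hh
  have hmeas : Measurable h := measurable_mtMellin _ _ _ _ _
  have hbd : ∀ u ∈ Set.Ioc ((2 * M : ℕ) : ℝ) K, ‖h u‖ ≤ A * u ^ (-σ) := by
    intro u hu
    have h1 := norm_mtMellin_le (N := 2 * M) (by omega) (b := b) (c := c + 1) ha ha1 hu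
    rw [show a.re + b.re + (c + 1) - 1 = σ by rw [hσd]; ring] at h1
    have : 0 < u := lt_of_le_of_lt (Nat.cast_nonneg _) hu.1
    exact h1.trans (by gcongr)
  have h2M1 : (1 : ℝ) ≤ ((2 * M : ℕ) : ℝ) := by exact_mod_cast (by omega : 1 ≤ 2 * M)
  have hKr : ((2 * M : ℕ) : ℝ) ≤ K := by exact_mod_cast hK2
  have hint : Integrable h (volume.restrict (Set.Ioc ((2 * M : ℕ) : ℝ) K)) := by
    refine Integrable.of_bound (C := A) hmeas.aestronglyMeasurable ?_
    filter_upwards [ae_restrict_mem measurableSet_Ioc] with u hu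
    refine (hbd u hu).trans (mul_le_of_le_one_right hA0 ?_)
    exact Real.rpow_le_one_of_one_le_of_nonpos (by linarith [hu.1]) (by linarith)
  have hcont := continuous_integral_mul_cexp hint (l := fun u : ℝ => -Real.log u) (by fun_prop)
  refine ⟨fun t => ‖∫ u in Set.Ioc ((2 * M : ℕ) : ℝ) K, h u * cexp (I * t * (-Real.log u : ℝ))‖,
    hcont.norm, ?_, fun t ht => ⟨norm_nonneg _, ?_⟩⟩
  · refine (integral_norm_sq_mellin_le hmeas h2M1 hKr hA0 hσ hbd hT).trans ?_
    have e1 := h2M (2 - 2 * σ) (by linarith)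
    calc _ ≤ Real.exp 1 * (A ^ 2 * (2 * Real.pi * ((M : ℝ) ^ (2 - 2 * σ) / (2 * σ - 2)))) := by
          gcongr
      _ = Real.exp 1 * (A ^ 2 * (2 * Real.pi * (1 / (2 * σ - 2)))) * (M : ℝ) ^ (2 - 2 * σ) := by
          ring
      _ ≤ _ := by
          gcongr
          rw [hC]
          linarith
  · have ht0 : 0 ≤ t := by linarith [ht.1]
    have hre : ((c : ℂ) + t * I).re = c := add_mul_I_re c t
    have hsum : Summable (fun x => mtHalfErr x a b (c + t * I)) :=
      summable_mtHalfErr (by rw [hre]; linarith) (by rw [hre]; exact hσ)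
    have hsplit : mtErrSum a b (c + t * I) -
        ∑ x ∈ Finset.range (2 * M), mtHalfErr x a b (c + t * I) =
        ∑ x ∈ Finset.Ico (2 * M) K, mtHalfErr x a b (c + t * I) +
        ∑' i, mtHalfErr (i + K) a b (c + t * I) := by
      rw [mtErrSum, ← hsum.sum_add_tsum_nat_add K, ← Finset.sum_range_add_sum_Ico _ hK2]
      ring
    have htail : ‖∑' i, mtHalfErr (i + K) a b (c + t * I)‖ ≤ (M : ℝ) ^ (1 - σ) := by
      have hs : Summable (fun i : ℕ => ((i + K : ℕ) : ℝ) ^ (-σ)) :=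
        (summable_nat_add_iff K).2 (Real.summable_nat_rpow.2 (by linarith))
      refine (tsum_of_norm_bounded (hs.mul_left (A * (‖b‖ + (c + t)))).hasSum
        fun i => herr t ht0 (i + K)).trans ?_
      rw [tsum_mul_left]
      refine le_trans ?_ hK
      gcongr
      · exact ht.2
      · exact tsum_add_rpow_neg_le hσ (by omega)
    have hmid : ‖∑ x ∈ Finset.Ico (2 * M) K, mtHalfErr x a b (c + t * I)‖ ≤
        ‖b‖ * A * S * (M : ℝ) ^ (1 - σ) + (c + t) *
        ‖∫ u in Set.Ioc ((2 * M : ℕ) : ℝ) K, h u * cexp (I * t * (-Real.log u : ℝ))‖ := by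
      rw [hh, integral_mtMellin]
      have e : ((c + 1 : ℝ) : ℂ) + t * I = c + t * I + 1 := by push_cast; ring
      rw [e, Finset.sum_congr rfl fun x _ => mtHalfErr_eq x a b (c + t * I),
        Finset.sum_sub_distrib, Finset.sum_neg_distrib, ← Finset.mul_sum, ← Finset.mul_sum]
      refine (norm_sub_le _ _).trans (add_le_add ?_ ?_)
      · rw [norm_neg, norm_mul]
        calc ‖b‖ * ‖∑ x ∈ Finset.Ico (2 * M) K, mtErrPart x a (b + 1) (c + t * I)‖
            ≤ ‖b‖ * ∑ x ∈ Finset.Ico (2 * M) K, A * (x : ℝ) ^ (-σ) := by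
              gcongr
              exact (norm_sum_le _ _).trans (Finset.sum_le_sum fun x _ => hp1 t x)
          _ ≤ ‖b‖ * (A * (S * ((2 * M : ℕ) : ℝ) ^ (1 - σ))) := by
              rw [← Finset.mul_sum]
              gcongr
              exact sum_Ico_rpow_neg_le hσ (by omega) K
          _ ≤ ‖b‖ * (A * (S * (M : ℝ) ^ (1 - σ))) := by
              exact mul_le_mul_of_nonneg_left (mul_le_mul_of_nonneg_left
                (mul_le_mul_of_nonneg_left (h2M (1 - σ) (by linarith)) hS0) hA0) (norm_nonneg b)
          _ = _ := by ring
      · rw [norm_mul]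
        gcongr
        exact norm_add_mul_I_le hc.le ht0
    rw [hsplit]
    set Qt := ‖∫ u in Set.Ioc ((2 * M : ℕ) : ℝ) K, h u * cexp (I * t * (-Real.log u : ℝ))‖
    have hQ0 : 0 ≤ Qt := norm_nonneg _
    calc _ ≤ (‖b‖ * A * S * (M : ℝ) ^ (1 - σ) + (c + t) * Qt) + (M : ℝ) ^ (1 - σ) :=
          (norm_add_le _ _).trans (add_le_add hmid htail)
      _ = (‖b‖ * A * S + 1) * (M : ℝ) ^ (1 - σ) + (c + t) * Qt := by ring
      _ ≤ (‖b‖ * A * S + 1) * (M : ℝ) ^ (1 - σ) + ((c + 1) * t) * Qt := by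
          gcongr
          nlinarith [ht.1]
      _ ≤ C * (M : ℝ) ^ (1 - σ) + C * t * Qt := by
          gcongr
          · rw [hC]; linarith
          · rw [hC]; linarith
      _ = _ := by ring

theorem exists_norm_mtHalfRem_le {a b : ℂ} {c : ℝ} (ha : 0 ≤ a.re) (ha1 : a.re < 1)
    (hb : 0 ≤ b.re) (hai : 0 ≤ a.im) (hbi : 0 ≤ b.im) (hc : 0 < c) (hσ : 1 < a.re + b.re + c) :
    ∃ C : ℝ, 0 ≤ C ∧ ∀ M : ℕ, 1 ≤ M → ∀ T : ℝ, 2 ≤ T → ∃ Q : ℝ → ℝ, Continuous Q ∧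
      (∫ t in (2 : ℝ)..T, Q t ^ 2) ≤ C * (M : ℝ) ^ (2 - 2 * (a.re + b.re + c)) ∧
      ∀ t ∈ Set.Icc 2 T, 0 ≤ Q t ∧ ‖mtHalfRem M a b (c + t * I)‖ ≤
        C * ((M : ℝ) ^ (2 - (a.re + b.re + c)) / t + (M : ℝ) ^ (1 - (a.re + b.re + c)) +
          t * Q t) := by
  obtain ⟨C1, hC1, hT1, hI1⟩ := exists_norm_sum_mtTail_le ha ha1 hb hbi hc
  obtain ⟨C2, hC2, h2⟩ := exists_norm_mtHalfErr_rem_le ha ha1 hc hσ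
  set σ := a.re + b.re + c with hσd
  set B : ℝ := 2 ^ (σ - 1 + 1) / (σ - 1) with hB
  have hB0 : 0 ≤ B := div_nonneg (by positivity) (by linarith)
  set L : ℝ := ‖a‖ + ‖b‖ + c + 2 with hL
  have hL0 : 0 ≤ L := by positivity
  refine ⟨C1 + C1 + C1 * L * B + C2, by positivity, fun M hM T hT => ?_⟩
  obtain ⟨Q, hQc, hQi, hQ⟩ := h2 M hM T hT
  have hM' : (0 : ℝ) < M := by exact_mod_cast hM
  refine ⟨Q, hQc, hQi.trans ?_, fun t ht => ⟨(hQ t ht).1, ?_⟩⟩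
  · gcongr
    have : 0 ≤ C1 * L * B := by positivity
    linarith
  · obtain ⟨hQ0, hE⟩ := hQ t ht
    have ht2 := ht.1
    have ht0 : 0 < t := by linarith
    set w : ℂ := a + b + (c + t * I) - 1 with hw
    have hwre : w.re = σ - 1 := by simp [hw, hσd]
    have hwim : t ≤ w.im := by simp [hw]; linarith
    have hwn : ‖w‖ ≤ L * t := by
      calc ‖w‖ ≤ ‖a‖ + ‖b‖ + (c + t) + 1 := by
            rw [hw]
            refine (norm_sub_le _ _).trans ?_
            rw [norm_one]
            gcongr
            refine (norm_add_le _ _).trans (add_le_add (norm_add_le _ _) ?_)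
            exact norm_add_mul_I_le hc.le ht0.le
        _ ≤ _ := by
            rw [hL]
            nlinarith [norm_nonneg a, norm_nonneg b]
    have hz := norm_zetaNum_div_sub_le (w := w) (by rw [hwre]; linarith) ht0 hwim hM
    rw [hwre, show 1 - (σ - 1) = 2 - σ by ring, show -(σ - 1) = 1 - σ by ring, ← hB] at hz
    have hI := hI1 t ht2
    have hwe : a + b + (c + t * I) - 2 = w - 1 := by rw [hw]; ring
    set X := (M : ℝ) ^ (2 - σ) with hX
    set Y := (M : ℝ) ^ (1 - σ) with hY
    have hX0 : 0 ≤ X := by positivity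
    have hY0 : 0 ≤ Y := by positivity
    -- The error of the zeta tail grows like ‖w‖ ≤ L t, which the decay C1/t of the first factor
    -- cancels.
    have hmid : ‖mtINum b (c + t * I) / (b + (c + t * I) - 1) * (zetaNum w / (w - 1) -
        ∑ i ∈ Finset.range M, ((i + 1 : ℕ) : ℂ) ^ (-w))‖ ≤ C1 * (X / t) + C1 * L * B * Y := by
      rw [norm_mul]
      calc _ ≤ C1 / t * (X / t + (L * t) * (B * Y)) := by
            gcongr
            exact hz.trans (by gcongr)
        _ = C1 * (X / t) * (1 / t) + C1 * L * B * Y := by field_simp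
        _ ≤ C1 * (X / t) * 1 + C1 * L * B * Y := by
            gcongr
            rw [div_le_one ht0]
            linarith
        _ = _ := by ring
    rw [mtHalfRem, hwe]
    calc _ ≤ (C2 * Y + C2 * (t * Q t)) + (C1 * (X / t) + C1 * L * B * Y) + C1 * (X / t) :=
          (norm_add_le _ _).trans (add_le_add ((norm_add_le _ _).trans (add_le_add hE hmid))
            (hT1 M hM t ht2))
      _ = (C1 + C1) * (X / t) + (C1 * L * B + C2) * Y + C2 * (t * Q t) := by ring
      _ ≤ (C1 + C1 + C1 * L * B + C2) * (X / t) + (C1 + C1 + C1 * L * B + C2) * Y +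
          (C1 + C1 + C1 * L * B + C2) * (t * Q t) := by
          have : 0 ≤ C1 * L * B := by positivity
          exact add_le_add (add_le_add
            (mul_le_mul_of_nonneg_right (by linarith) (by positivity))
            (mul_le_mul_of_nonneg_right (by linarith) hY0))
            (mul_le_mul_of_nonneg_right (by linarith) (mul_nonneg ht0.le hQ0))
      _ = _ := by ring

/-- On the diagonal zeta is taken at real part σ instead of σ - 1, so the main tail is estimated
wastefully; the term t M^(-σ) is harmless once t ≤ 2M. -/
theorem exists_norm_mtDiagRem_le {a b : ℂ} {c : ℝ} (hai : 0 ≤ a.im) (hbi : 0 ≤ b.im)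
    (hc : 0 < c) (hσ : 1 < a.re + b.re + c) :
    ∃ C : ℝ, 0 ≤ C ∧ ∀ M : ℕ, 1 ≤ M → ∀ t : ℝ, 2 ≤ t → ‖mtDiagRem M a b (c + t * I)‖ ≤
      C * ((M : ℝ) ^ (2 - (a.re + b.re + c)) / t +
        t * (M : ℝ) ^ (-(a.re + b.re + c))) := by
  set σ := a.re + b.re + c with hσd
  set L : ℝ := ‖a‖ + ‖b‖ + c + 1 with hL
  have hL0 : 0 ≤ L := by positivity
  set B : ℝ := 2 ^ (σ + 1) / σ with hB
  have hB0 : 0 ≤ B := div_nonneg (by positivity) (by linarith)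
  refine ⟨2 ^ (-c) * (1 + L * B), by positivity, fun M hM t ht => ?_⟩
  have hM1 : (1 : ℝ) ≤ M := by exact_mod_cast hM
  have ht0 : 0 < t := by linarith
  set w : ℂ := a + b + (c + t * I) with hw
  have hwre : w.re = σ := by simp [hw, hσd]
  have hwim : t ≤ w.im := by simp [hw]; linarith
  have hwn : ‖w‖ ≤ L * t := by
    calc ‖w‖ ≤ ‖a‖ + ‖b‖ + (c + t) := by
          rw [hw]
          refine (norm_add_le _ _).trans (add_le_add (norm_add_le _ _) ?_)
          exact norm_add_mul_I_le hc.le ht0.le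
      _ ≤ _ := by
          rw [hL]
          nlinarith [norm_nonneg a, norm_nonneg b]
  have hz := norm_zetaNum_div_sub_le (w := w) (by rw [hwre]; linarith) ht0 hwim hM
  rw [hwre, ← hB] at hz
  have h2 : ‖(2 : ℂ) ^ (-((c : ℂ) + t * I))‖ = 2 ^ (-c) := by
    have := Complex.norm_natCast_cpow_of_pos (n := 2) (by norm_num) (-((c : ℂ) + t * I))
    rw [neg_re, add_mul_I_re] at this
    exact_mod_cast this
  have hXY : (M : ℝ) ^ (1 - σ) ≤ (M : ℝ) ^ (2 - σ) :=
    Real.rpow_le_rpow_of_exponent_le hM1 (by linarith)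
  rw [mtDiagRem, norm_mul, h2, mul_assoc]
  gcongr
  refine hz.trans ?_
  set X := (M : ℝ) ^ (2 - σ)
  set Y := (M : ℝ) ^ (-σ)
  have hX0 : 0 ≤ X := by positivity
  have hY0 : 0 ≤ Y := by positivity
  calc _ ≤ X / t + (L * t) * (B * Y) := by gcongr
    _ = 1 * (X / t) + L * B * (t * Y) := by ring
    _ ≤ (1 + L * B) * (X / t) + (1 + L * B) * (t * Y) := by
        have : 0 ≤ L * B := by positivity
        gcongr <;> linarith
    _ = _ := by ring


/-! ### Size of the coefficients and comparison of mean squares -/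

/-- Inserting 1 = (m + n)/k leaves in each of the two terms one positive power, bounded by the same
power of k, and one power whose sum is elementary. No case distinction at the midpoint is needed. -/
theorem norm_mtCoef_le {a b : ℂ} (ha : 0 ≤ a.re) (ha1 : a.re < 1) (hb : 0 ≤ b.re)
    (hb1 : b.re < 1) (x : ℕ) :
    ‖mtCoef x a b‖ ≤ (1 / (1 - a.re) + 1 / (1 - b.re)) *
      ((x + 1 : ℕ) : ℝ) ^ (1 - a.re - b.re) := by
  set k : ℝ := ((x + 1 : ℕ) : ℝ) with hk
  have hk0 : 0 < k := by positivity
  have hxk : (x : ℝ) ≤ k := by rw [hk]; exact_mod_cast Nat.le_succ x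
  have hα : 0 < 1 - a.re := by linarith
  have hβ : 0 < 1 - b.re := by linarith
  have hterm : ∀ i ∈ Finset.range x,
      ‖((i + 1 : ℕ) : ℂ) ^ (-a) * ((x - i : ℕ) : ℂ) ^ (-b)‖ ≤
        k⁻¹ * (k ^ (1 - b.re) * ((i + 1 : ℕ) : ℝ) ^ (-a.re) +
          k ^ (1 - a.re) * ((x - i : ℕ) : ℝ) ^ (-b.re)) := by
    intro i hi
    have hi' := Finset.mem_range.1 hi
    have hm : 0 < i + 1 := by omega
    have hn : 0 < x - i := by omega
    rw [norm_mul, Complex.norm_natCast_cpow_of_pos hm, Complex.norm_natCast_cpow_of_pos hn,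
      neg_re, neg_re]
    have hmk : ((i + 1 : ℕ) : ℝ) ≤ k := by rw [hk]; exact_mod_cast (by omega : i + 1 ≤ x + 1)
    have hnk : ((x - i : ℕ) : ℝ) ≤ k := by rw [hk]; exact_mod_cast (by omega : x - i ≤ x + 1)
    have hsum : k = ((i + 1 : ℕ) : ℝ) + ((x - i : ℕ) : ℝ) := by
      rw [hk, ← Nat.cast_add]; congr 1; omega
    have hm0 : (0 : ℝ) < ((i + 1 : ℕ) : ℝ) := by exact_mod_cast hm
    have hn0 : (0 : ℝ) < ((x - i : ℕ) : ℝ) := by exact_mod_cast hn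
    set m : ℝ := ((i + 1 : ℕ) : ℝ)
    set n : ℝ := ((x - i : ℕ) : ℝ)
    have e1 : n ^ (-b.re) * n = n ^ (1 - b.re) := by
      rw [← Real.rpow_add_one hn0.ne', show -b.re + 1 = 1 - b.re by ring]
    have e2 : m ^ (-a.re) * m = m ^ (1 - a.re) := by
      rw [← Real.rpow_add_one hm0.ne', show -a.re + 1 = 1 - a.re by ring]
    rw [← div_eq_inv_mul, le_div_iff₀ hk0]
    calc m ^ (-a.re) * n ^ (-b.re) * k
        = m ^ (-a.re) * (n ^ (-b.re) * n) + (m ^ (-a.re) * m) * n ^ (-b.re) := by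
          rw [hsum]; ring
      _ = n ^ (1 - b.re) * m ^ (-a.re) + m ^ (1 - a.re) * n ^ (-b.re) := by
          rw [e1, e2]; ring
      _ ≤ _ := by gcongr
  have hrefl : ∑ i ∈ Finset.range x, ((x - i : ℕ) : ℝ) ^ (-b.re) =
      ∑ i ∈ Finset.range x, ((i + 1 : ℕ) : ℝ) ^ (-b.re) := by
    rw [← Finset.sum_range_reflect]
    refine Finset.sum_congr rfl fun i hi => ?_
    have := Finset.mem_range.1 hi
    rw [show x - (x - 1 - i) = i + 1 by omega]
  calc ‖mtCoef x a b‖ ≤ ∑ i ∈ Finset.range x,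
        k⁻¹ * (k ^ (1 - b.re) * ((i + 1 : ℕ) : ℝ) ^ (-a.re) +
          k ^ (1 - a.re) * ((x - i : ℕ) : ℝ) ^ (-b.re)) :=
        (norm_sum_le _ _).trans (Finset.sum_le_sum hterm)
    _ = k⁻¹ * (k ^ (1 - b.re) * ∑ i ∈ Finset.range x, ((i + 1 : ℕ) : ℝ) ^ (-a.re) +
          k ^ (1 - a.re) * ∑ i ∈ Finset.range x, ((i + 1 : ℕ) : ℝ) ^ (-b.re)) := by
        rw [← Finset.mul_sum, Finset.sum_add_distrib, ← Finset.mul_sum, ← Finset.mul_sum, hrefl]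
    _ ≤ k⁻¹ * (k ^ (1 - b.re) * (1 / (1 - a.re) * k ^ (1 - a.re)) +
          k ^ (1 - a.re) * (1 / (1 - b.re) * k ^ (1 - b.re))) := by
        gcongr
        · exact (sum_range_rpow_neg_le ha ha1 x).trans (by gcongr)
        · exact (sum_range_rpow_neg_le hb hb1 x).trans (by gcongr)
    _ = (1 / (1 - a.re) + 1 / (1 - b.re)) * (k⁻¹ * (k ^ (1 - b.re) * k ^ (1 - a.re))) := by ring
    _ = _ := by
        rw [← Real.rpow_neg_one, ← Real.rpow_add hk0, ← Real.rpow_add hk0]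
        ring_nf

/-- The coefficients of the Mordell-Tornheim double zeta-function as a Dirichlet series in
`s₃` on the line with real part `c`. -/
def mtDirCoef (a b : ℂ) (c : ℝ) (x : ℕ) : ℂ :=
  mtCoef x a b * ((x + 1 : ℕ) : ℂ) ^ (-(c : ℂ))

theorem norm_mtDirCoef_le {a b : ℂ} {c : ℝ} (ha : 0 ≤ a.re) (ha1 : a.re < 1) (hb : 0 ≤ b.re)
    (hb1 : b.re < 1) (x : ℕ) :
    ‖mtDirCoef a b c x‖ ≤ (1 / (1 - a.re) + 1 / (1 - b.re)) *
      ((x + 1 : ℕ) : ℝ) ^ (-(a.re + b.re + c - 1)) := by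
  rw [mtDirCoef, norm_mul, Complex.norm_natCast_cpow_of_pos (by omega), neg_re, ofReal_re,
    show -(a.re + b.re + c - 1) = (1 - a.re - b.re) + -c by ring,
    Real.rpow_add (by positivity), ← mul_assoc]
  gcongr
  exact norm_mtCoef_le ha ha1 hb hb1 x

theorem dirPoly_mtDirCoef (a b : ℂ) (c : ℝ) (N : ℕ) (t : ℝ) :
    dirPoly (mtDirCoef a b c) N t =
      ∑ x ∈ Finset.range N, mtCoef x a b * ((x + 1 : ℕ) : ℂ) ^ (-((c : ℂ) + t * I)) := by
  refine Finset.sum_congr rfl fun x _ => ?_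
  have hx : ((x + 1 : ℕ) : ℂ) ≠ 0 := by exact_mod_cast Nat.succ_ne_zero x
  rw [mtDirCoef, mul_assoc, neg_add, cpow_add _ _ hx, cpow_def_of_ne_zero hx (-(t * I)),
    ← ofReal_natCast, ← ofReal_log (by positivity)]
  congr 3
  push_cast
  ring

theorem mtSquareTerm_eq (a b : ℂ) (c : ℝ) (x : ℕ) :
    mtSquareTerm a b (2 * (c : ℂ)) (x + 1) = ((‖mtDirCoef a b c x‖ ^ 2 : ℝ) : ℂ) := by
  have hsum : ∑ m ∈ Finset.Icc 1 (x + 1 - 1),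
      1 / ((m : ℂ) ^ a * ((x + 1 - m : ℕ) : ℂ) ^ b) = mtCoef x a b := by
    rw [mtCoef, add_tsub_cancel_right, ← Finset.Ico_add_one_right_eq_Icc,
      Finset.sum_Ico_eq_sum_range, add_tsub_cancel_right]
    refine Finset.sum_congr rfl fun i _ => ?_
    rw [cpow_neg, cpow_neg, one_div, mul_inv, add_comm 1 i, Nat.add_sub_add_right]
  have hx : (0 : ℝ) < ((x + 1 : ℕ) : ℝ) := by positivity
  rw [mtSquareTerm, hsum, mtDirCoef, norm_mul, mul_pow,
    Complex.norm_natCast_cpow_of_pos (by omega), neg_re, ofReal_re, ← Real.rpow_mul_natCast hx.le,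
    ofReal_mul, div_eq_mul_inv, ← cpow_neg, ofReal_cpow hx.le]
  push_cast
  ring_nf

theorem summable_norm_sq_of_le {b : ℕ → ℂ} {C s : ℝ} (hs : 1 / 2 < s)
    (hb : ∀ x, ‖b x‖ ≤ C * ((x + 1 : ℕ) : ℝ) ^ (-s)) : Summable fun x => ‖b x‖ ^ 2 := by
  refine Summable.of_nonneg_of_le (fun x => by positivity) (fun x => ?_)
    ((summable_succ_rpow_neg (p := 2 * s) (by linarith)).mul_left (C ^ 2))
  calc ‖b x‖ ^ 2 ≤ (C * ((x + 1 : ℕ) : ℝ) ^ (-s)) ^ 2 := by gcongr; exact hb x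
    _ = C ^ 2 * ((x + 1 : ℕ) : ℝ) ^ (-(2 * s)) := by
      rw [mul_pow, ← Real.rpow_mul_natCast (by positivity)]
      congr 2
      push_cast
      ring

theorem tsum_norm_sq_sub_sum_range_le {b : ℕ → ℂ} {C s : ℝ} (hs : 1 / 2 < s)
    (hb : ∀ x, ‖b x‖ ≤ C * ((x + 1 : ℕ) : ℝ) ^ (-s)) {N : ℕ} (hN : 1 ≤ N) :
    (∑' x, ‖b x‖ ^ 2) - ∑ x ∈ Finset.range N, ‖b x‖ ^ 2 ≤
      C ^ 2 * (2 ^ (2 * s) / (2 * s - 1)) * (N : ℝ) ^ (1 - 2 * s) := by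
  have hsum := summable_norm_sq_of_le hs hb
  rw [← hsum.sum_add_tsum_nat_add N, add_sub_cancel_left]
  have hq : 1 < 2 * s := by linarith
  have hle : ∀ i : ℕ, ‖b (i + N)‖ ^ 2 ≤ C ^ 2 * ((i + N : ℕ) : ℝ) ^ (-(2 * s)) := by
    intro i
    have hiN : (0 : ℝ) < ((i + N : ℕ) : ℝ) := by exact_mod_cast (by omega : 0 < i + N)
    calc ‖b (i + N)‖ ^ 2 ≤ (C * ((i + N + 1 : ℕ) : ℝ) ^ (-s)) ^ 2 := by gcongr; exact hb _
      _ = C ^ 2 * ((i + N + 1 : ℕ) : ℝ) ^ (-(2 * s)) := by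
        rw [mul_pow, ← Real.rpow_mul_natCast (by positivity)]
        congr 2
        push_cast
        ring
      _ ≤ _ := by
        refine mul_le_mul_of_nonneg_left (Real.rpow_le_rpow_of_nonpos hiN ?_ (by linarith))
          (sq_nonneg C)
        exact_mod_cast Nat.le_succ _
  have hsr : Summable fun i : ℕ => C ^ 2 * ((i + N : ℕ) : ℝ) ^ (-(2 * s)) :=
    ((summable_nat_add_iff N).2 (Real.summable_nat_rpow.2 (by linarith))).mul_left _
  calc _ ≤ ∑' i : ℕ, C ^ 2 * ((i + N : ℕ) : ℝ) ^ (-(2 * s)) :=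
        ((summable_nat_add_iff N).2 hsum).tsum_le_tsum hle hsr
    _ ≤ _ := by
        rw [tsum_mul_left, mul_assoc]
        exact mul_le_mul_of_nonneg_left (tsum_add_rpow_neg_le hq hN) (sq_nonneg C)

/-- Comparison of mean squares. -/
theorem abs_integral_norm_sq_sub_le {f g : ℝ → ℂ} {T δ : ℝ} (hT : 2 ≤ T) (hδ : 0 < δ)
    (hf : ContinuousOn f (Set.Icc 2 T)) (hg : ContinuousOn g (Set.Icc 2 T)) :
    |(∫ t in (2 : ℝ)..T, ‖f t‖ ^ 2) - ∫ t in (2 : ℝ)..T, ‖g t‖ ^ 2| ≤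
      δ * (∫ t in (2 : ℝ)..T, ‖g t‖ ^ 2) +
        (1 + 1 / δ) * ∫ t in (2 : ℝ)..T, ‖f t - g t‖ ^ 2 := by
  have hi : ∀ {h : ℝ → ℂ}, ContinuousOn h (Set.Icc 2 T) →
      IntervalIntegrable (fun t => ‖h t‖ ^ 2) volume 2 T := fun hh =>
    ContinuousOn.intervalIntegrable (by rw [Set.uIcc_of_le hT]; exact hh.norm.pow 2)
  have hif := hi hf
  have hig := hi hg
  have hid : IntervalIntegrable (fun t => ‖f t - g t‖ ^ 2) volume 2 T := hi (hf.sub hg)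
  rw [← intervalIntegral.integral_sub hif hig, ← intervalIntegral.integral_const_mul,
    ← intervalIntegral.integral_const_mul, ← intervalIntegral.integral_add
      (hig.const_mul δ) (hid.const_mul _)]
  refine (intervalIntegral.abs_integral_le_integral_abs hT).trans
    (intervalIntegral.integral_mono_on hT (hif.sub hig).abs
      ((hig.const_mul δ).add (hid.const_mul _)) fun t _ => ?_)
  have h1 : |‖f t‖ - ‖g t‖| ≤ ‖f t - g t‖ := abs_norm_sub_norm_le _ _
  have hg0 := norm_nonneg (g t)
  have hr0 := norm_nonneg (f t - g t)
  set p := ‖g t‖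
  set r := ‖f t - g t‖
  -- Weighted Young inequality for the cross term of (p + r)²; the free parameter δ is balanced at
  -- the end.
  have h2 : 2 * p * r ≤ δ * p ^ 2 + 1 / δ * r ^ 2 := by
    have : δ * p ^ 2 + 1 / δ * r ^ 2 - 2 * p * r = 1 / δ * (δ * p - r) ^ 2 := by
      field_simp; ring
    have h3 : 0 ≤ 1 / δ * (δ * p - r) ^ 2 := by positivity
    linarith
  obtain ⟨h3, h4⟩ := abs_le.1 h1
  have hf0 := norm_nonneg (f t)
  set q := ‖f t‖
  rw [abs_le]
  constructor
  · nlinarith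
  · nlinarith


/-! ### Approximation of the zeta-function in mean square -/

theorem mtZeta_eq {a b c : ℂ} (h : (a, b, c) ∈ mtTube 1) :
    mtZeta a b c = mtNum (a, b, c) / mtPolar 1 (a, b, c) :=
  mtZetaAt_eq isMTContinuation_mtNum h

theorem continuousOn_mtZeta_vertical {a b : ℂ} {c : ℝ} {s : Set ℝ} (hac : 0 < a.re + c)
    (hbc : 0 < b.re + c) (hσ : 1 < a.re + b.re + c)
    (h1 : ∀ t ∈ s, a + ((c : ℂ) + t * I) ≠ 1) (h2 : ∀ t ∈ s, b + ((c : ℂ) + t * I) ≠ 1)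
    (h3 : ∀ t ∈ s, a + b + ((c : ℂ) + t * I) ≠ 2) :
    ContinuousOn (fun t : ℝ => mtZeta a b (c + t * I)) s := by
  have hmem : ∀ t : ℝ, (a, b, (c : ℂ) + t * I) ∈ mtTube 1 := fun t => by
    rw [mem_mtTube_one]
    simp [hac, hbc, hσ]
  have hline : Continuous fun t : ℝ => ((a, b, (c : ℂ) + t * I) : ℂ × ℂ × ℂ) := by fun_prop
  have hnum : Continuous fun t : ℝ => mtNum (a, b, (c : ℂ) + t * I) :=
    isMTContinuation_mtNum.1.continuousOn.comp_continuous hline hmem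
  have hpol : Continuous fun t : ℝ => mtPolar 1 (a, b, (c : ℂ) + t * I) :=
    (differentiable_mtPolar 1).continuous.comp hline
  have : (fun t : ℝ => mtZeta a b (c + t * I)) =
      fun t : ℝ => mtNum (a, b, (c : ℂ) + t * I) / mtPolar 1 (a, b, (c : ℂ) + t * I) :=
    funext fun t => mtZeta_eq (hmem t)
  rw [this]
  refine hnum.continuousOn.div hpol.continuousOn fun t ht => ?_
  rw [mtPolar_one]
  exact mul_ne_zero (sub_ne_zero.2 (h3 t ht))
    (mul_ne_zero (sub_ne_zero.2 (h1 t ht)) (sub_ne_zero.2 (h2 t ht)))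

theorem intervalIntegrable_inv_sq {T : ℝ} (hT : 2 ≤ T) :
    IntervalIntegrable (fun t : ℝ => (t ^ 2)⁻¹) volume 2 T := by
  refine ContinuousOn.intervalIntegrable ((continuousOn_pow 2).inv₀ fun t ht => ?_)
  rw [Set.uIcc_of_le hT] at ht
  have := ht.1
  positivity

theorem integral_inv_sq_le {T : ℝ} (hT : 2 ≤ T) : ∫ t in (2 : ℝ)..T, (t ^ 2)⁻¹ ≤ 1 := by
  have h : ∀ t ∈ Set.uIcc 2 T, HasDerivAt (fun t : ℝ => -t⁻¹) ((t ^ 2)⁻¹) t := fun t ht => by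
    rw [Set.uIcc_of_le hT] at ht
    have := (hasDerivAt_inv (by linarith [ht.1] : t ≠ 0)).fun_neg
    rwa [neg_neg] at this
  rw [intervalIntegral.integral_eq_sub_of_hasDerivAt h (intervalIntegrable_inv_sq hT)]
  have : 0 < T⁻¹ := by positivity
  norm_num
  linarith

theorem sq_add_four_le (x y z w : ℝ) :
    (x + y + z + w) ^ 2 ≤ 4 * (x ^ 2 + y ^ 2 + z ^ 2 + w ^ 2) := by
  nlinarith [sq_nonneg (x - y), sq_nonneg (x - z), sq_nonneg (x - w), sq_nonneg (y - z),
    sq_nonneg (y - w), sq_nonneg (z - w)]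

/-- The mean square of the difference between the double zeta-function and its approximation
by a Dirichlet polynomial. -/
theorem exists_integral_norm_sq_mtZeta_sub_le {a b : ℂ} {c : ℝ} (ha : 0 ≤ a.re) (ha1 : a.re < 1)
    (hb : 0 ≤ b.re) (hb1 : b.re < 1) (hai : 0 ≤ a.im) (hbi : 0 ≤ b.im) (hc : 0 < c)
    (hσ : 1 < a.re + b.re + c) :
    ∃ C : ℝ, 0 ≤ C ∧ ∀ M : ℕ, 1 ≤ M → ∀ T : ℝ, 2 ≤ T → T ≤ 2 * M →
      ∫ t in (2 : ℝ)..T, ‖mtZeta a b (c + t * I) - dirPoly (mtDirCoef a b c) (2 * M) t‖ ^ 2 ≤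
        C * (M : ℝ) ^ (4 - 2 * (a.re + b.re + c)) := by
  have hσ' : 1 < b.re + a.re + c := by linarith
  obtain ⟨C1, hC1, H1⟩ := exists_norm_mtHalfRem_le ha ha1 hb hai hbi hc hσ
  obtain ⟨C2, hC2, H2⟩ := exists_norm_mtHalfRem_le hb hb1 ha hbi hai hc hσ'
  obtain ⟨C3, hC3, H3⟩ := exists_norm_mtDiagRem_le hai hbi hc hσ
  rw [add_comm b.re a.re] at H2
  have hne1 : ∀ t ∈ Set.Ici (2 : ℝ), a + ((c : ℂ) + t * I) ≠ 1 := fun t ht => by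
    have : (0 : ℝ) < t := lt_of_lt_of_le two_pos ht
    exact_mod_cast ne_ofReal_of_im_pos (z := a + ((c : ℂ) + t * I)) (by simp; linarith) 1
  have hne2 : ∀ t ∈ Set.Ici (2 : ℝ), b + ((c : ℂ) + t * I) ≠ 1 := fun t ht => by
    have : (0 : ℝ) < t := lt_of_lt_of_le two_pos ht
    exact_mod_cast ne_ofReal_of_im_pos (z := b + ((c : ℂ) + t * I)) (by simp; linarith) 1
  have hne3 : ∀ t ∈ Set.Ici (2 : ℝ), a + b + ((c : ℂ) + t * I) ≠ 2 := fun t ht => by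
    have : (0 : ℝ) < t := lt_of_lt_of_le two_pos ht
    exact_mod_cast ne_ofReal_of_im_pos (z := a + b + ((c : ℂ) + t * I)) (by simp; linarith) 2
  have hcont := continuousOn_mtZeta_vertical (by linarith) (by linarith) hσ hne1 hne2 hne3
  set σ := a.re + b.re + c with hσd
  set K : ℝ := 2 * (C1 + C2 + C3) with hK
  have hK0 : 0 ≤ K := by positivity
  refine ⟨4 * K ^ 2 * (3 + 4 * (C1 + C2)), by positivity, fun M hM T hT hTM => ?_⟩
  obtain ⟨Q1, hQ1c, hQ1i, hQ1⟩ := H1 M hM T hT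
  obtain ⟨Q2, hQ2c, hQ2i, hQ2⟩ := H2 M hM T hT
  have hM0 : (0 : ℝ) < M := by exact_mod_cast hM
  have hM1 : (1 : ℝ) ≤ M := by exact_mod_cast hM
  have hT0 : 0 < T := by linarith
  set X : ℝ := (M : ℝ) ^ (2 - σ) with hX
  set Y : ℝ := (M : ℝ) ^ (1 - σ) with hY
  have hX0 : 0 ≤ X := by positivity
  have hY0 : 0 ≤ Y := by positivity
  have hXY : X = M * Y := by
    rw [hX, hY, show 2 - σ = (1 - σ) + 1 by ring, Real.rpow_add_one hM0.ne', mul_comm]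
  have hX2 : (M : ℝ) ^ (4 - 2 * σ) = X ^ 2 := by
    rw [hX, ← Real.rpow_mul_natCast hM0.le]
    congr 1
    push_cast
    ring
  have hY2 : (M : ℝ) ^ (2 - 2 * σ) = Y ^ 2 := by
    rw [hY, ← Real.rpow_mul_natCast hM0.le]
    congr 1
    push_cast
    ring
  have hY1 : (M : ℝ) * (M : ℝ) ^ (-σ) = Y := by
    rw [hY, mul_comm, ← Real.rpow_add_one hM0.ne']
    congr 1
    ring
  rw [hY2] at hQ1i hQ2i
  rw [hX2]
  have hbound : ∀ t ∈ Set.Icc 2 T,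
      ‖mtZeta a b (c + t * I) - dirPoly (mtDirCoef a b c) (2 * M) t‖ ^ 2 ≤
        4 * K ^ 2 * (X ^ 2 * (t ^ 2)⁻¹ + Y ^ 2 + T ^ 2 * Q1 t ^ 2 + T ^ 2 * Q2 t ^ 2) := by
    intro t ht
    obtain ⟨hq1, hr1⟩ := hQ1 t ht
    obtain ⟨hq2, hr2⟩ := hQ2 t ht
    have hr3 := H3 M hM t ht.1
    have ht0 : 0 < t := by linarith [ht.1]
    have hmem : (a, b, (c : ℂ) + t * I) ∈ mtTube 1 := by
      rw [mem_mtTube_one]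
      simp only [add_mul_I_re]
      exact ⟨by linarith, by linarith, hσ⟩
    rw [mtZeta_eq hmem, mtNum_div_mtPolar M (hne1 t ht.1) (hne2 t ht.1) (hne3 t ht.1),
      dirPoly_mtDirCoef, add_sub_cancel_left]
    -- This is where T ≤ 2M is needed pointwise: the growing diagonal error is absorbed into
    -- M^(1-σ).
    have htM : t * (M : ℝ) ^ (-σ) ≤ 2 * Y := by
      calc t * (M : ℝ) ^ (-σ) ≤ (2 * M) * (M : ℝ) ^ (-σ) := by gcongr; exact ht.2.trans hTM
        _ = 2 * Y := by rw [mul_assoc, hY1]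
    have hXt : 0 ≤ X / t := by positivity
    have hq1' : 0 ≤ T * Q1 t := by positivity
    have hq2' : 0 ≤ T * Q2 t := by positivity
    -- Pulling T out leaves the mean square of Q, of order Y² = M^(2-2σ); then T² Y² is of order X²
    -- = M^(4-2σ), the target.
    have e1 : t * Q1 t ≤ T * Q1 t := by gcongr; exact ht.2
    have e2 : t * Q2 t ≤ T * Q2 t := by gcongr; exact ht.2
    have hR : ‖mtHalfRem M a b (c + t * I) + mtHalfRem M b a (c + t * I) +
        mtDiagRem M a b (c + t * I)‖ ≤ K * (X / t + Y + T * Q1 t + T * Q2 t) := by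
      refine (norm_add_le _ _).trans ((add_le_add ((norm_add_le _ _).trans
        (add_le_add hr1 hr2)) hr3).trans ?_)
      calc _ ≤ C1 * (X / t + Y + T * Q1 t) + C2 * (X / t + Y + T * Q2 t) +
            C3 * (X / t + 2 * Y) := by gcongr
        _ ≤ C1 * (2 * (X / t + Y + T * Q1 t + T * Q2 t)) +
            C2 * (2 * (X / t + Y + T * Q1 t + T * Q2 t)) +
            C3 * (2 * (X / t + Y + T * Q1 t + T * Q2 t)) := by
            refine add_le_add (add_le_add ?_ ?_) ?_
            · exact mul_le_mul_of_nonneg_left (by linarith) hC1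
            · exact mul_le_mul_of_nonneg_left (by linarith) hC2
            · exact mul_le_mul_of_nonneg_left (by linarith) hC3
        _ = _ := by rw [hK]; ring
    calc _ ≤ (K * (X / t + Y + T * Q1 t + T * Q2 t)) ^ 2 := by gcongr
      _ = K ^ 2 * (X / t + Y + T * Q1 t + T * Q2 t) ^ 2 := by ring
      _ ≤ K ^ 2 * (4 * ((X / t) ^ 2 + Y ^ 2 + (T * Q1 t) ^ 2 + (T * Q2 t) ^ 2)) := by
          exact mul_le_mul_of_nonneg_left (sq_add_four_le _ _ _ _) (sq_nonneg K)
      _ = _ := by rw [div_pow, div_eq_mul_inv]; ring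
  have hi1 : IntervalIntegrable (fun t : ℝ => X ^ 2 * (t ^ 2)⁻¹) volume 2 T :=
    (intervalIntegrable_inv_sq hT).const_mul _
  have hi2 : IntervalIntegrable (fun _ : ℝ => Y ^ 2) volume 2 T := intervalIntegrable_const
  have hi3 : IntervalIntegrable (fun t : ℝ => T ^ 2 * Q1 t ^ 2) volume 2 T :=
    Continuous.intervalIntegrable (by fun_prop) _ _
  have hi4 : IntervalIntegrable (fun t : ℝ => T ^ 2 * Q2 t ^ 2) volume 2 T :=
    Continuous.intervalIntegrable (by fun_prop) _ _
  have hi12 := hi1.add hi2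
  have hi123 := hi12.add hi3
  calc _ ≤ ∫ t in (2 : ℝ)..T,
        4 * K ^ 2 * (X ^ 2 * (t ^ 2)⁻¹ + Y ^ 2 + T ^ 2 * Q1 t ^ 2 + T ^ 2 * Q2 t ^ 2) := by
        refine intervalIntegral.integral_mono_on hT ?_ ((hi123.add hi4).const_mul _) hbound
        refine ContinuousOn.intervalIntegrable ?_
        rw [Set.uIcc_of_le hT]
        exact ((hcont.mono fun t ht => ht.1).sub
          (continuous_dirPoly _ _).continuousOn).norm.pow 2
    _ = 4 * K ^ 2 * (X ^ 2 * (∫ t in (2 : ℝ)..T, (t ^ 2)⁻¹) + (T - 2) * Y ^ 2 +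
          T ^ 2 * (∫ t in (2 : ℝ)..T, Q1 t ^ 2) + T ^ 2 * ∫ t in (2 : ℝ)..T, Q2 t ^ 2) := by
        rw [intervalIntegral.integral_const_mul, intervalIntegral.integral_add hi123 hi4,
          intervalIntegral.integral_add hi12 hi3, intervalIntegral.integral_add hi1 hi2,
          intervalIntegral.integral_const_mul, intervalIntegral.integral_const_mul,
          intervalIntegral.integral_const_mul, intervalIntegral.integral_const, smul_eq_mul]
    _ ≤ 4 * K ^ 2 * (X ^ 2 * 1 + (2 * M ^ 2) * Y ^ 2 + (2 * M) ^ 2 * (C1 * Y ^ 2) +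
          (2 * M) ^ 2 * (C2 * Y ^ 2)) := by
        have hTM2 : T - 2 ≤ 2 * (M : ℝ) ^ 2 := by nlinarith
        have hTsq : T ^ 2 ≤ (2 * (M : ℝ)) ^ 2 := by gcongr
        have hQ : ∀ {C J : ℝ}, 0 ≤ C → J ≤ C * Y ^ 2 →
            T ^ 2 * J ≤ (2 * (M : ℝ)) ^ 2 * (C * Y ^ 2) := fun hC hJ =>
          (mul_le_mul_of_nonneg_left hJ (sq_nonneg T)).trans
            (mul_le_mul_of_nonneg_right hTsq (by positivity))
        refine mul_le_mul_of_nonneg_left (add_le_add (add_le_add (add_le_add ?_ ?_)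
          (hQ hC1 hQ1i)) (hQ hC2 hQ2i)) (by positivity)
        · exact mul_le_mul_of_nonneg_left (integral_inv_sq_le hT) (sq_nonneg X)
        · gcongr
    _ = _ := by rw [hXY]; ring


/-! ### The asymptotic formula -/

/-- The mean square of a Dirichlet polynomial whose length is comparable with `T`. -/
theorem exists_abs_integral_dirPoly_sub_tsum_le {b : ℕ → ℂ} {A s : ℝ} (hA : 0 ≤ A)
    (hs : 1 / 2 < s) (hs1 : s < 1) (hb : ∀ x, ‖b x‖ ≤ A * ((x + 1 : ℕ) : ℝ) ^ (-s)) :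
    ∃ C : ℝ, 0 ≤ C ∧ ∀ (M : ℕ) (T : ℝ), 1 ≤ M → 2 ≤ T → (M : ℝ) ≤ T → T ≤ 2 * M →
      |(∫ t in (2 : ℝ)..T, ‖dirPoly b (2 * M) t‖ ^ 2) - (∑' x, ‖b x‖ ^ 2) * T| ≤
        C * T ^ (3 / 2 - s) := by
  obtain ⟨C, hC, H⟩ := exists_abs_integral_dirPoly_sub_le hA hs hs1 hb
  have hsum := summable_norm_sq_of_le hs hb
  have htail := fun {N : ℕ} (hN : 1 ≤ N) => tsum_norm_sq_sub_sum_range_le hs hb hN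
  set S : ℝ := ∑' x, ‖b x‖ ^ 2
  have hS0 : 0 ≤ S := tsum_nonneg fun x => by positivity
  set B : ℝ := A ^ 2 * (2 ^ (2 * s) / (2 * s - 1))
  have hB0 : 0 ≤ B := mul_nonneg (sq_nonneg _) (div_nonneg (by positivity) (by linarith))
  -- The logarithm is absorbed by T^ε; with this ε the exponent 2 - 2s + ε is exactly 3/2 - s.
  obtain ⟨ε, hε⟩ : ∃ ε : ℝ, ε = s - 1 / 2 := ⟨_, rfl⟩
  have hε0 : 0 < ε := by linarith
  set D : ℝ := C * (2 ^ (2 - 2 * s) * (1 + 2 ^ ε / ε)) with hD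
  have hD0 : 0 ≤ D := by positivity
  refine ⟨D + B + 2 * S, by positivity, fun M T hM hT hMT hTM => ?_⟩
  have hT0 : 0 < T := by linarith
  have hT1 : 1 ≤ T := by linarith
  have hN : 1 ≤ 2 * M := by omega
  have hM1 : (1 : ℝ) ≤ M := by exact_mod_cast hM
  have hNcast : ((2 * M : ℕ) : ℝ) = 2 * M := by push_cast; ring
  have hW1 : 1 ≤ T ^ (3 / 2 - s) := Real.one_le_rpow hT1 (by linarith)
  have hTE : T ^ (2 - 2 * s) * T ^ ε = T ^ (3 / 2 - s) := by
    rw [← Real.rpow_add hT0]; congr 1; rw [hε]; ring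
  have hTE1 : (1 : ℝ) ≤ T ^ ε := Real.one_le_rpow hT1 hε0.le
  set W : ℝ := T ^ (3 / 2 - s)
  set P : ℝ := ∫ t in (2 : ℝ)..T, ‖dirPoly b (2 * M) t‖ ^ 2
  have hH := H (2 * M) T hN
  have htl' := htail hN
  have hSN_le : ∑ x ∈ Finset.range (2 * M), ‖b x‖ ^ 2 ≤ S :=
    hsum.sum_le_tsum _ fun x _ => by positivity
  have hSN0 : 0 ≤ ∑ x ∈ Finset.range (2 * M), ‖b x‖ ^ 2 :=
    Finset.sum_nonneg fun x _ => by positivity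
  set SN : ℝ := ∑ x ∈ Finset.range (2 * M), ‖b x‖ ^ 2
  have hP1 : |P - (T - 2) * SN| ≤ D * W := by
    refine hH.trans ?_
    have hlog : 1 + Real.log ((2 * M : ℕ) : ℝ) ≤ (1 + 2 ^ ε / ε) * T ^ ε := by
      have h1 : Real.log ((2 * M : ℕ) : ℝ) ≤ (2 * T) ^ ε / ε := by
        rw [hNcast]
        exact (Real.log_le_log (by linarith) (by linarith)).trans
          (Real.log_le_rpow_div (by linarith) hε0)
      rw [Real.mul_rpow two_pos.le hT0.le] at h1
      have : (1 + 2 ^ ε / ε) * T ^ ε = T ^ ε + 2 ^ ε * T ^ ε / ε := by ring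
      linarith
    have hNp : ((2 * M : ℕ) : ℝ) ^ (2 - 2 * s) ≤ 2 ^ (2 - 2 * s) * T ^ (2 - 2 * s) := by
      rw [← Real.mul_rpow two_pos.le hT0.le]
      exact Real.rpow_le_rpow (Nat.cast_nonneg _) (by linarith) (by linarith)
    have hlog0 : 0 ≤ 1 + Real.log ((2 * M : ℕ) : ℝ) :=
      add_nonneg zero_le_one (Real.log_natCast_nonneg _)
    calc _ ≤ C * ((2 ^ (2 - 2 * s) * T ^ (2 - 2 * s)) * ((1 + 2 ^ ε / ε) * T ^ ε)) :=
          mul_le_mul_of_nonneg_left (mul_le_mul hNp hlog hlog0 (by positivity)) hC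
      _ = D * (T ^ (2 - 2 * s) * T ^ ε) := by rw [hD]; ring
      _ = _ := by rw [hTE]
  have htl : T * (S - SN) ≤ B * W := by
    have hNp : ((2 * M : ℕ) : ℝ) ^ (1 - 2 * s) ≤ T ^ (1 - 2 * s) := by
      rw [hNcast]
      exact Real.rpow_le_rpow_of_nonpos hT0 hTM (by linarith)
    calc T * (S - SN) ≤ T * (B * T ^ (1 - 2 * s)) :=
          mul_le_mul_of_nonneg_left
            (htl'.trans (mul_le_mul_of_nonneg_left hNp hB0)) hT0.le
      _ = B * (T ^ (2 - 2 * s) * 1) := by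
          rw [show 2 - 2 * s = (1 - 2 * s) + 1 by ring, Real.rpow_add_one hT0.ne']; ring
      _ ≤ B * (T ^ (2 - 2 * s) * T ^ ε) := by gcongr
      _ = _ := by rw [hTE]
  have hSW : S * 1 ≤ S * W := mul_le_mul_of_nonneg_left hW1 hS0
  have hT2 : 0 ≤ T * (S - SN) := mul_nonneg hT0.le (by linarith)
  have hBW : 0 ≤ B * W := mul_nonneg hB0 (by linarith)
  rw [abs_le] at hP1 ⊢
  have e1 : P - S * T = (P - (T - 2) * SN) - T * (S - SN) - 2 * SN := by ring
  have e2 : (D + B + 2 * S) * W = D * W + B * W + 2 * (S * W) := by ring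
  rw [e1, e2]
  constructor <;> linarith [hP1.1, hP1.2]

/-- With ε = σ - 3/2 the polynomial has mean square O(T) and the difference O(T^(1-2ε)). Comparison
with δ = T^(-ε) makes both contributions T^(1-ε), which is the stated exponent. -/
theorem exists_abs_integral_mtZeta_sub_le {a b : ℂ} {c : ℝ} (ha : 0 ≤ a.re) (ha1 : a.re < 1)
    (hb : 0 ≤ b.re) (hb1 : b.re < 1) (hai : 0 ≤ a.im) (hbi : 0 ≤ b.im) (hc : 0 < c)
    (hσ : 3 / 2 < a.re + b.re + c) (hσ2 : a.re + b.re + c < 2)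
    (hcont : ContinuousOn (fun t : ℝ => mtZeta a b (c + t * I)) (Set.Ici 2)) :
    ∃ C : ℝ, ∀ T : ℝ, 2 ≤ T →
      |(∫ t in (2 : ℝ)..T, ‖mtZeta a b (c + t * I)‖ ^ 2) -
        (∑' x, ‖mtDirCoef a b c x‖ ^ 2) * T| ≤ C * T ^ (5 / 2 - a.re - b.re - c) := by
  obtain ⟨C, hC, H⟩ := exists_integral_norm_sq_mtZeta_sub_le ha ha1 hb hb1 hai hbi hc
    (by linarith)
  have hA0 : 0 ≤ 1 / (1 - a.re) + 1 / (1 - b.re) :=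
    add_nonneg (div_nonneg zero_le_one (by linarith)) (div_nonneg zero_le_one (by linarith))
  obtain ⟨D, hD0, HD⟩ := exists_abs_integral_dirPoly_sub_tsum_le hA0
    (by linarith : 1 / 2 < a.re + b.re + c - 1) (by linarith)
    (norm_mtDirCoef_le (c := c) ha ha1 hb hb1)
  have hS0 : 0 ≤ ∑' x, ‖mtDirCoef a b c x‖ ^ 2 := tsum_nonneg fun x => by positivity
  generalize (∑' x, ‖mtDirCoef a b c x‖ ^ 2) = S at *
  obtain ⟨ε, hε⟩ : ∃ ε : ℝ, ε = a.re + b.re + c - 3 / 2 := ⟨_, rfl⟩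
  have hε0 : 0 < ε := by linarith
  rw [show 3 / 2 - (a.re + b.re + c - 1) = 1 - ε by rw [hε]; ring] at HD
  rw [show 4 - 2 * (a.re + b.re + c) = 1 - 2 * ε by rw [hε]; ring] at H
  rw [show 5 / 2 - a.re - b.re - c = 1 - ε by rw [hε]; ring]
  refine ⟨(S + D) + 2 * C + D, fun T hT => ?_⟩
  have hT0 : 0 < T := by linarith
  have hT1 : 1 ≤ T := by linarith
  -- M is the integer part of T, which gives M ≤ T ≤ 2M.
  obtain ⟨M, hMT, hTM1⟩ : ∃ M : ℕ, (M : ℝ) ≤ T ∧ T < M + 1 :=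
    ⟨⌊T⌋₊, Nat.floor_le hT0.le, Nat.lt_floor_add_one T⟩
  have hM : 1 ≤ M := by
    have : (1 : ℝ) < M + 1 := by linarith
    exact_mod_cast (by linarith : (0 : ℝ) < M)
  have hM1 : (1 : ℝ) ≤ M := by exact_mod_cast hM
  have hTM : T ≤ 2 * M := by linarith
  have hP1 := HD M T hM hT hMT hTM
  have hR : (M : ℝ) ^ (1 - 2 * ε) ≤ T ^ (1 - 2 * ε) :=
    Real.rpow_le_rpow (Nat.cast_nonneg _) hMT (by linarith)
  have hR2 := (H M hM T hT hTM).trans (mul_le_mul_of_nonneg_left hR hC)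
  have h := abs_integral_norm_sq_sub_le hT (by positivity : 0 < T ^ (-ε))
    (hcont.mono fun t ht => ht.1) (continuous_dirPoly (mtDirCoef a b c) (2 * M)).continuousOn
  have hR0 : 0 ≤ ∫ t in (2 : ℝ)..T,
      ‖mtZeta a b (c + t * I) - dirPoly (mtDirCoef a b c) (2 * M) t‖ ^ 2 :=
    intervalIntegral.integral_nonneg hT fun t _ => by positivity
  generalize (∫ t in (2 : ℝ)..T,
    ‖mtZeta a b (c + t * I) - dirPoly (mtDirCoef a b c) (2 * M) t‖ ^ 2) = R at *
  generalize (∫ t in (2 : ℝ)..T, ‖mtZeta a b (c + t * I)‖ ^ 2) = Z at *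
  generalize (∫ t in (2 : ℝ)..T, ‖dirPoly (mtDirCoef a b c) (2 * M) t‖ ^ 2) = P at *
  have hTE1 : (1 : ℝ) ≤ T ^ ε := Real.one_le_rpow hT1 hε0.le
  have hWT : T ^ (1 - ε) ≤ T := by
    simpa using Real.rpow_le_rpow_of_exponent_le hT1 (by linarith : 1 - ε ≤ 1)
  have hTE : T ^ ε * T ^ (1 - 2 * ε) = T ^ (1 - ε) := by
    rw [← Real.rpow_add hT0]; congr 1; ring
  have hTδ : T ^ (-ε) * T = T ^ (1 - ε) := by
    rw [← Real.rpow_add_one hT0.ne']; congr 1; ring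
  have hinv : 1 / T ^ (-ε) = T ^ ε := by rw [Real.rpow_neg hT0.le, one_div, inv_inv]
  rw [hinv] at h
  have hP2 : P ≤ (S + D) * T := by
    have h3 := mul_le_mul_of_nonneg_left hWT hD0
    linarith [(abs_le.1 hP1).2]
  have hdiff : |Z - P| ≤ ((S + D) + 2 * C) * T ^ (1 - ε) := by
    calc |Z - P| ≤ T ^ (-ε) * P + (1 + T ^ ε) * R := h
      _ ≤ T ^ (-ε) * ((S + D) * T) + (T ^ ε + T ^ ε) * (C * T ^ (1 - 2 * ε)) :=
          add_le_add (mul_le_mul_of_nonneg_left hP2 (by positivity))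
            (mul_le_mul (by linarith) hR2 hR0 (by positivity))
      _ = (S + D) * (T ^ (-ε) * T) + 2 * C * (T ^ ε * T ^ (1 - 2 * ε)) := by ring
      _ = _ := by rw [hTδ, hTE]; ring
  calc |Z - S * T| ≤ |Z - P| + |P - S * T| := abs_sub_le _ _ _
    _ ≤ ((S + D) + 2 * C) * T ^ (1 - ε) + D * T ^ (1 - ε) := add_le_add hdiff hP1
    _ = _ := by ring

theorem theorem1p4 (s₁ s₂ : ℂ) (σ₃ : ℝ)
    (hσ₁ : 0 ≤ s₁.re) (hσ₂ : 0 ≤ s₂.re) (hσ₃ : 0 < σ₃)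
    (ht₁ : 0 ≤ s₁.im) (ht₂ : 0 ≤ s₂.im)
    (h₁₃ : s₁.re + σ₃ ≤ 1) (h₂₃ : s₂.re + σ₃ ≤ 1)
    (h₁₂₃ : 3 / 2 < s₁.re + s₂.re + σ₃)
    (hs₁₃ : ∀ t₃ : ℝ, 2 ≤ t₃ → s₁ + ((σ₃ : ℂ) + t₃ * Complex.I) ≠ 1)
    (hs₂₃ : ∀ t₃ : ℝ, 2 ≤ t₃ → s₂ + ((σ₃ : ℂ) + t₃ * Complex.I) ≠ 1)
    (hs₁₂₃ : ∀ t₃ : ℝ, 2 ≤ t₃ → s₁ + s₂ + ((σ₃ : ℂ) + t₃ * Complex.I) ≠ 2) :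
    Summable (fun k : ℕ => mtSquareTerm s₁ s₂ (2 * (σ₃ : ℂ)) (k + 2)) ∧
    (∀ T : ℝ, 2 ≤ T → IntervalIntegrable
      (fun t₃ : ℝ => ‖mtZeta s₁ s₂ ((σ₃ : ℂ) + t₃ * Complex.I)‖ ^ 2) MeasureTheory.volume 2 T) ∧
    (s₁.re + s₂.re + σ₃ < 2 →
      (fun T : ℝ =>
        ((∫ t₃ in (2 : ℝ)..T, ‖mtZeta s₁ s₂ ((σ₃ : ℂ) + t₃ * Complex.I)‖ ^ 2 : ℝ) : ℂ)
          - mtSquareZeta s₁ s₂ (2 * (σ₃ : ℂ)) * (T : ℂ))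
        =O[Filter.atTop] fun T : ℝ => T ^ (5 / 2 - s₁.re - s₂.re - σ₃)) ∧
    (s₁.re + s₂.re + σ₃ = 2 →
      (fun T : ℝ =>
        ((∫ t₃ in (2 : ℝ)..T, ‖mtZeta s₁ s₂ ((σ₃ : ℂ) + t₃ * Complex.I)‖ ^ 2 : ℝ) : ℂ)
          - mtSquareZeta s₁ s₂ (2 * (σ₃ : ℂ)) * (T : ℂ))
        =O[Filter.atTop] fun T : ℝ => (T * Real.log T) ^ (1 / 2 : ℝ)) := by
  have h1 : s₁.re < 1 := by linarith
  have h2 : s₂.re < 1 := by linarith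
  have hcont := continuousOn_mtZeta_vertical (s := Set.Ici 2) (by linarith) (by linarith)
    (by linarith) hs₁₃ hs₂₃ hs₁₂₃
  have hterm : ∀ k : ℕ, mtSquareTerm s₁ s₂ (2 * (σ₃ : ℂ)) (k + 2) =
      ((‖mtDirCoef s₁ s₂ σ₃ (k + 1)‖ ^ 2 : ℝ) : ℂ) := fun k =>
    mtSquareTerm_eq s₁ s₂ σ₃ (k + 1)
  have hsum : Summable fun x => ‖mtDirCoef s₁ s₂ σ₃ x‖ ^ 2 :=
    summable_norm_sq_of_le (by linarith) (norm_mtDirCoef_le hσ₁ h1 hσ₂ h2)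
  -- Index 0 corresponds to k = 1, where the inner sum is empty; this reconciles the series from k =
  -- 2 with the one over all indices.
  have hzero : mtDirCoef s₁ s₂ σ₃ 0 = 0 := by simp [mtDirCoef, mtCoef]
  have hsq : mtSquareZeta s₁ s₂ (2 * (σ₃ : ℂ)) =
      ((∑' x, ‖mtDirCoef s₁ s₂ σ₃ x‖ ^ 2 : ℝ) : ℂ) := by
    rw [mtSquareZeta, tsum_congr hterm, ← ofReal_tsum, hsum.tsum_eq_zero_add, hzero]
    simp
  refine ⟨?_, fun T hT => ?_, fun hlt => ?_, fun heq => ?_⟩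
  · simp_rw [hterm]
    exact_mod_cast (summable_nat_add_iff 1).2 hsum
  · refine ContinuousOn.intervalIntegrable ?_
    rw [Set.uIcc_of_le hT]
    exact (hcont.mono fun t ht => ht.1).norm.pow 2
  · obtain ⟨C, hC⟩ := exists_abs_integral_mtZeta_sub_le hσ₁ h1 hσ₂ h2 ht₁ ht₂ hσ₃ h₁₂₃ hlt hcont
    refine IsBigO.of_bound C ?_
    filter_upwards [eventually_ge_atTop 2] with T hT
    have hT0 : 0 ≤ T := by linarith
    rw [hsq, ← ofReal_mul, ← ofReal_sub, Complex.norm_real, Real.norm_eq_abs,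
      Real.norm_of_nonneg (Real.rpow_nonneg hT0 _)]
    exact hC T hT
  -- The case σ = 2 is void: σ₁ ≤ 1 - σ₃ and σ₂ ≤ 1 - σ₃ give σ ≤ 2 - σ₃ < 2.
  · linarith

end
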